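/- **Theorem 1.1.** Let $N\ge 3$ be an integer, $\alpha\in(0,N)$, and let $$I_\alpha(x)=\frac{\Gamma\left(\frac{N-\alpha}{2}\right)}{\Gamma\left(\frac{\alpha}{2}\right)2^{\alpha}\pi^{N/2}|x|^{N-\alpha}},\qquad x\in\mathbb R^N\setminus\{0\},$$ be the Riesz potential. Let $V:\mathbb R^N\to\mathbb R$ and $f:\mathbb R\to\mathbb R$, and put $F(t)=\int_0^t f(s)\,ds$. Assume: - (V1) $V\in C(\mathbb R^N,[0,\infty))$ and $V_\infty:=\lim_{|x|\to\infty}V(x)$ exists and is $>0$; - (V2) $V(x)\le V_\infty$ for all $x\in\mathbb R^N$; - (V3) $V\in C^1(\mathbb R^N,\mathbb R)$ and there is $\theta\in[0,1)$ such that for every $x\in\mathbb R^N\setminus\{0\}$ the function $t\mapsto \frac{NV(tx)+\nabla V(tx)\cdot(tx)}{t^{\alpha}}+\frac{(N-2)^3\theta}{4t^{\alpha+2}|x|^2}$ is nonincreasing on $(0,\infty)$; - (F1) $f$ is continuous and there is a constant $C_0>0$ with $|f(t)t|\le C_0\left(|t|^{(N+\alpha)/N}+|t|^{(N+\alpha)/(N-2)}\right)$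 for all $t\in\mathbb R$; - (F2) $F(t)=o\left(|t|^{(N+\alpha)/N}\right)$ as $t\to0$ and $F(t)=o\left(|t|^{(N+\alpha)/(N-2)}\right)$ as $|t|\to\infty$; - (F3) there is $s_0>0$ with $F(s_0)\neq0$. For real-valued $u\in H^1(\mathbb R^N)$ define $$\mathcal I(u)=\frac12\int_{\mathbb R^N}\left(|\nabla u|^2+V(x)u^2\right)dx-\frac12\int_{\mathbb R^N}(I_\alpha*F(u))F(u)\,dx,$$ $$\mathcal P(u)=\frac{N-2}{2}\int_{\mathbb R^N}|\nabla u|^2dx+\frac12\int_{\mathbb R^N}\left[NV(x)+\nabla V(x)\cdot x\right]u^2dx-\frac{N+\alpha}{2}\int_{\mathbb R^N}(I_\alpha*F(u))F(u)\,dx,$$ and let $$\mathcal M=\left\{u\in H^1(\mathbb R^N)\setminus\{0\}:\mathcal P(u)=0\right\},\qquad \Lambda=\left\{u\in H^1(\mathbb R^N):\int_{\mathbb R^N}(I_\alpha*F(u))F(u)\,dx>0\right\},\qquad u_t(x)=u(x/t)\ (t>0).$$ Then for every $u\in\Lambda$ the maximum $\max_{t>0}\mathcal I(u_t)$ is attained,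 and there is $\bar u\in\mathcal M$ which is a weak solution of $$-\Delta u+V(x)u=(I_\alpha*F(u))f(u),\qquad u\in H^1(\mathbb R^N),$$ that is, $\int_{\mathbb R^N}\left(\nabla\bar u\cdot\nabla\varphi+V\bar u\varphi\right)dx=\int_{\mathbb R^N}(I_\alpha*F(\bar u))f(\bar u)\varphi\,dx$ for all $\varphi\in H^1(\mathbb R^N)$ (with an absolutely convergent right-hand side), and such that $$\mathcal I(\bar u)=\inf_{\mathcal M}\mathcal I=\inf_{u\in\Lambda}\max_{t>0}\mathcal I(u_t)>0.$$ -/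

import Mathlib

open MeasureTheory Set Filter Topology Asymptotics
open scoped ContDiff

noncomputable section

namespace Choquard

/-- The Euclidean space `ℝᴺ`. -/
abbrev E (N : ℕ) : Type := EuclideanSpace ℝ (Fin N)

/-- `g` is the weak (distributional) gradient of `u`: both are locally integrable and
`∫ u ∂_v φ = - ∫ (g · v) φ` for every direction `v` and every test function `φ ∈ C_c^∞(ℝᴺ)`. -/
def HasWeakGradient {N : ℕ} (u : E N → ℝ) (g : E N → E N) : Prop :=
  LocallyIntegrable u ∧ LocallyIntegrable g ∧
    ∀ φ : E N → ℝ, ContDiff ℝ ∞ φ → HasCompactSupport φ → ∀ v : E N,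
      ∫ x, u x * fderiv ℝ φ x v = -∫ x, inner ℝ (g x) v * φ x

/-- `u ∈ H¹(ℝᴺ)`: `u ∈ L²` has a weak gradient in `L²`. Elements of `H¹` are represented by
functions; everything below depends only on the almost-everywhere class of the function. -/
def MemH1 {N : ℕ} (u : E N → ℝ) : Prop :=
  MemLp u 2 ∧ ∃ g : E N → E N, HasWeakGradient u g ∧ MemLp g 2

open scoped Classical in
/-- The weak gradient `∇u` (a representative of it; it is unique up to null sets), and `0` by
convention if `u` has none. -/
def weakGradient {N : ℕ} (u : E N → ℝ) : E N → E N :=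
  if h : ∃ g : E N → E N, HasWeakGradient u g then h.choose else 0

/-- The Riesz potential
`I_α(x) = Γ((N-α)/2) / (Γ(α/2) 2^α π^{N/2} |x|^{N-α})`, `x ≠ 0`. -/
def rieszKernel {N : ℕ} (α : ℝ) (x : E N) : ℝ :=
  Real.Gamma (((N : ℝ) - α) / 2) /
    (Real.Gamma (α / 2) * (2 : ℝ) ^ α * Real.pi ^ ((N : ℝ) / 2) * ‖x‖ ^ ((N : ℝ) - α))

/-- The convolution `(I_α * w)(x) = ∫ I_α(x - y) w(y) dy`. -/
def rieszConv {N : ℕ} (α : ℝ) (w : E N → ℝ) (x : E N) : ℝ :=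
  ∫ y, rieszKernel α (x - y) * w y

/-- The primitive `F(t) = ∫₀ᵗ f(s) ds`. -/
def primitive (f : ℝ → ℝ) (t : ℝ) : ℝ := ∫ s in (0 : ℝ)..t, f s

/-- The nonlocal term `∫ (I_α * F(u)) F(u) dx`. -/
def nonlocalTerm {N : ℕ} (α : ℝ) (f : ℝ → ℝ) (u : E N → ℝ) : ℝ :=
  ∫ x, rieszConv α (fun y => primitive f (u y)) x * primitive f (u x)

/-- The energy functional `𝓘`. -/
def energy {N : ℕ} (α : ℝ) (V : E N → ℝ) (f : ℝ → ℝ) (u : E N → ℝ) : ℝ :=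
  1 / 2 * (∫ x, (‖weakGradient u x‖ ^ 2 + V x * u x ^ 2)) - 1 / 2 * nonlocalTerm α f u

/-- The Pohožaev functional `𝓟`. Here `fderiv ℝ V x x` is `∇V(x) · x`. -/
def pohozaev {N : ℕ} (α : ℝ) (V : E N → ℝ) (f : ℝ → ℝ) (u : E N → ℝ) : ℝ :=
  ((N : ℝ) - 2) / 2 * (∫ x, ‖weakGradient u x‖ ^ 2)
    + 1 / 2 * (∫ x, ((N : ℝ) * V x + fderiv ℝ V x x) * u x ^ 2)
    - ((N : ℝ) + α) / 2 * nonlocalTerm α f u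

/-- The Pohožaev manifold `𝓜 = {u ∈ H¹ \ {0} : 𝓟(u) = 0}`. -/
def pohozaevManifold {N : ℕ} (α : ℝ) (V : E N → ℝ) (f : ℝ → ℝ) : Set (E N → ℝ) :=
  {u | MemH1 u ∧ ¬ (u =ᵐ[volume] 0) ∧ pohozaev α V f u = 0}

/-- The set `Λ = {u ∈ H¹ : ∫ (I_α * F(u)) F(u) > 0}`. -/
def Lam (N : ℕ) (α : ℝ) (f : ℝ → ℝ) : Set (E N → ℝ) :=
  {u | MemH1 u ∧ 0 < nonlocalTerm α f u}

/-- The dilation `u_t(x) = u(x / t)`. -/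
def dilate {N : ℕ} (t : ℝ) (u : E N → ℝ) : E N → ℝ := fun x => u (t⁻¹ • x)

/-- `u ∈ H¹(ℝᴺ)` is a weak solution of `-Δu + V u = (I_α * F(u)) f(u)`, tested against all of
`H¹(ℝᴺ)`; the right-hand side is required to be an absolutely convergent integral. -/
def IsWeakSolution {N : ℕ} (α : ℝ) (V : E N → ℝ) (f : ℝ → ℝ) (u : E N → ℝ) : Prop :=
  MemH1 u ∧ ∀ φ : E N → ℝ, MemH1 φ →
    Integrable (fun x => rieszConv α (fun y => primitive f (u y)) x * f (u x) * φ x) ∧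
    ∫ x, (inner ℝ (weakGradient u x) (weakGradient φ x) + V x * u x * φ x)
      = ∫ x, rieszConv α (fun y => primitive f (u y)) x * f (u x) * φ x

/-- (V1): `V` is continuous and nonnegative, with limit `Vinf > 0` at infinity. -/
def CondV1 {N : ℕ} (V : E N → ℝ) (Vinf : ℝ) : Prop :=
  Continuous V ∧ (∀ x, 0 ≤ V x) ∧ Tendsto V (cocompact (E N)) (𝓝 Vinf) ∧ 0 < Vinf

/-- (V2): `V ≤ Vinf` everywhere. -/
def CondV2 {N : ℕ} (V : E N → ℝ) (Vinf : ℝ) : Prop := ∀ x, V x ≤ Vinf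

/-- (V3): `V` is `C¹` and, for some `θ ∈ [0, 1)` and all `x ≠ 0`, the function
`t ↦ (N V(tx) + ∇V(tx)·(tx)) / t^α + (N-2)³ θ / (4 t^{α+2} |x|²)` is nonincreasing on `(0, ∞)`. -/
def CondV3 {N : ℕ} (α : ℝ) (V : E N → ℝ) : Prop :=
  ContDiff ℝ 1 V ∧ ∃ θ : ℝ, 0 ≤ θ ∧ θ < 1 ∧ ∀ x : E N, x ≠ 0 →
    AntitoneOn (fun t : ℝ =>
      ((N : ℝ) * V (t • x) + fderiv ℝ V (t • x) (t • x)) / t ^ α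
        + ((N : ℝ) - 2) ^ 3 * θ / (4 * t ^ (α + 2) * ‖x‖ ^ 2)) (Ioi 0)

/-- (F1): `f` is continuous and `|f(t) t| ≤ C (|t|^{(N+α)/N} + |t|^{(N+α)/(N-2)})` for all real `t`. -/
def CondF1 (N : ℕ) (α : ℝ) (f : ℝ → ℝ) : Prop :=
  Continuous f ∧ ∃ C : ℝ, 0 < C ∧ ∀ t : ℝ,
    |f t * t| ≤ C * (|t| ^ (((N : ℝ) + α) / N) + |t| ^ (((N : ℝ) + α) / ((N : ℝ) - 2)))

/-- (F2): `F(t) = o(|t|^{(N+α)/N})` as `t → 0` and `F(t) = o(|t|^{(N+α)/(N-2)})` as `|t| → ∞`. -/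
def CondF2 (N : ℕ) (α : ℝ) (f : ℝ → ℝ) : Prop :=
  (primitive f =o[𝓝 0] fun t : ℝ => |t| ^ (((N : ℝ) + α) / N)) ∧
  (primitive f =o[cocompact ℝ] fun t : ℝ => |t| ^ (((N : ℝ) + α) / ((N : ℝ) - 2)))

/-- (F3): `F(s) ≠ 0` for some `s > 0`. -/
def CondF3 (f : ℝ → ℝ) : Prop := ∃ s : ℝ, 0 < s ∧ primitive f s ≠ 0

end Choquard

end

noncomputable section

namespace Choquard

open scoped ENNReal NNReal Convolution

/-! The heart of the matter is one inequality, `energy_ge_energy_dilate`: for u in H¹ and t > 0,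
𝓘(u) ≥ 𝓘(u_t) + (1 - t^(N+α))/(N+α) 𝓟(u) + (1-θ)(N-2)/2 · k(t) ‖∇u‖², where k ≥ 0 vanishes only at t
= 1. Integrating (V3) along the ray through x bounds V(x) - t^N V(tx) from below by a multiple of NV
+ ∇V·x, up to an error of size |x|⁻² (`sub_dilate_ge`); Hardy's inequality absorbs that error into
the gradient because θ < 1. Hence t ↦ 𝓘(u_t) is maximal at t = 1 when u ∈ 𝓜. Every u ∈ Λ has a
dilate on 𝓜 (`exists_dilate_mem`) and 𝓜 ⊆ Λ, so the max over t is attained and inf max over Λ is the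
infimum over 𝓜. The functional 𝓘 - 𝓟/(N+α) no longer contains the nonlinearity. It is a coercive
quadratic form that agrees with 𝓘 on 𝓜, so the infimum m is positive and minimizing sequences are
bounded.

The infimum is attained (`exists_minimizer`) by splitting a minimizing sequence into its weak limit
and a remainder. The quadratic terms split by weak convergence, the nonlocal term by a Brezis–Lieb
argument in L^(2N/(N+α)). A nonzero weak limit lies on 𝓜 and minimizes (`mem_of_weakTendsto`). If
the limit is zero, the sequence still does not vanish in measure, since its nonlocal term is bounded
below. Suitable translates then have a nonzero weak limit, which has energy at most m for the
constant potential V∞; as V ≤ V∞, one of its dilates lies on 𝓜 with energy at most m.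

A minimizer u is a critical point without any Lagrange multiplier or regularity of 𝓜
(`first_variation_nonneg`). For small s > 0 some dilate of u + sφ with factor t near 1 lies on 𝓜, so
𝓘((u+sφ)_t) ≥ 𝓘(u) ≥ 𝓘(u_t). Dividing the difference of the outer terms by s and letting (s, t) →
(0, 1) gives 𝓘'(u)φ ≥ 0, and -φ gives the converse. -/

/-- The normalising constant of the Riesz potential. -/
def rieszConst (N : ℕ) (α : ℝ) : ℝ :=
  Real.Gamma (((N : ℝ) - α) / 2) /
    (Real.Gamma (α / 2) * (2 : ℝ) ^ α * Real.pi ^ ((N : ℝ) / 2))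

/-! ### The Riesz kernel and its integrals over sets of given measure. -/

section Kernel

variable {N : ℕ} {α : ℝ}

lemma rieszConst_pos (hα0 : 0 < α) (hαN : α < N) : 0 < rieszConst N α := by
  have h1 := Real.Gamma_pos_of_pos (show 0 < ((N : ℝ) - α) / 2 by linarith)
  have h2 := Real.Gamma_pos_of_pos (show 0 < α / 2 by linarith)
  have h3 := Real.pi_pos
  unfold rieszConst
  positivity

lemma rieszKernel_eq (x : E N) : rieszKernel α x = rieszConst N α * ‖x‖ ^ (α - N) := by
  rw [show α - N = -((N : ℝ) - α) by ring, Real.rpow_neg (norm_nonneg x)]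
  unfold rieszKernel rieszConst
  rw [← div_div, div_eq_mul_inv _ (‖x‖ ^ _)]

lemma rieszKernel_nonneg (hα0 : 0 < α) (hαN : α < N) (x : E N) : 0 ≤ rieszKernel α x := by
  rw [rieszKernel_eq]
  have := rieszConst_pos hα0 hαN
  positivity

lemma measurable_rieszKernel : Measurable (rieszKernel α : E N → ℝ) := by
  unfold rieszKernel
  fun_prop

lemma rieszKernel_neg (x : E N) : rieszKernel α (-x) = rieszKernel α x := by
  simp [rieszKernel_eq]

lemma rieszKernel_smul {r : ℝ} (hr : 0 < r) (x : E N) :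
    rieszKernel α (r • x) = r ^ (α - N) * rieszKernel α x := by
  rw [rieszKernel_eq, rieszKernel_eq, norm_smul, Real.mul_rpow (norm_nonneg _) (norm_nonneg _),
    Real.norm_of_nonneg hr.le]
  ring

/-- The Riesz kernel with values in `[0, ⊤]`. -/
def kerE (α : ℝ) (x : E N) : ℝ≥0∞ := ENNReal.ofReal (rieszKernel α x)

lemma measurable_kerE : Measurable (kerE α : E N → ℝ≥0∞) :=
  measurable_rieszKernel.ennreal_ofReal

lemma kerE_sub_comm (x y : E N) : kerE α (x - y) = kerE α (y - x) := by
  unfold kerE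
  rw [← rieszKernel_neg, neg_sub]

lemma lintegral_comp_smul_pos {r : ℝ} (hr : 0 < r) (f : E N → ℝ≥0∞) :
    ∫⁻ x, f (r • x) = ENNReal.ofReal ((r ^ N)⁻¹) * ∫⁻ x, f x := by
  have h := (Homeomorph.smulOfNeZero r hr.ne').toMeasurableEquiv.measurableEmbedding.lintegral_map
    (μ := (volume : Measure (E N))) f
  have h2 : Measure.map (r • ·) (volume : Measure (E N)) = _ :=
    Measure.map_addHaar_smul volume hr.ne'
  change ∫⁻ x, f x ∂(Measure.map (r • ·) (volume : Measure (E N))) = ∫⁻ x, f (r • x) at h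
  rw [← h, h2, lintegral_smul_measure, smul_eq_mul]
  simp [abs_of_pos hr]

lemma lintegral_kerE_ball (hN : 0 < N) (hα0 : 0 < α) (hαN : α < N) :
    ∫⁻ x in Metric.ball (0 : E N) 1, kerE α x < ⊤ := by
  have h : IntegrableOn (rieszKernel α : E N → ℝ) (Metric.ball 0 1) volume := by
    refine integrableOn_ball_of_norm_le_rpow (C := rieszConst N α) (α := (N : ℝ) - α) ?_ ?_ ?_ ?_
    · simpa using (show 1 ≤ N from hN)
    · simpa using hα0
    · refine Eventually.of_forall fun x => ?_
      rw [Real.norm_of_nonneg (rieszKernel_nonneg hα0 hαN x), rieszKernel_eq,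
        show -((N : ℝ) - α) = α - N by ring]
    · exact measurable_rieszKernel.aestronglyMeasurable
  have := h.2
  unfold kerE
  simpa [HasFiniteIntegral, Real.enorm_eq_ofReal (rieszKernel_nonneg hα0 hαN _)] using this

/-- Homogeneity: the kernel contributes ρ^(α-N) and the change of variables ρ^N. -/
lemma lintegral_kerE_ball_radius {ρ : ℝ} (hρ : 0 < ρ) :
    ∫⁻ x in Metric.ball (0 : E N) ρ, kerE α x
      = ENNReal.ofReal (ρ ^ α) * ∫⁻ x in Metric.ball (0 : E N) 1, kerE α x := by
  have h := lintegral_comp_smul_pos hρ ((Metric.ball (0 : E N) ρ).indicator (kerE α))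
  have h1 : (fun x => (Metric.ball (0 : E N) ρ).indicator (kerE α) (ρ • x))
      = fun x => ENNReal.ofReal (ρ ^ (α - N)) * (Metric.ball (0 : E N) 1).indicator (kerE α) x := by
    ext x
    have : ρ • x ∈ Metric.ball (0 : E N) ρ ↔ x ∈ Metric.ball (0 : E N) 1 := by
      simp only [mem_ball_zero_iff, norm_smul, Real.norm_of_nonneg hρ.le]
      exact mul_lt_iff_lt_one_right hρ
    by_cases hx : x ∈ Metric.ball (0 : E N) 1
    · rw [indicator_of_mem (this.2 hx), indicator_of_mem hx]
      unfold kerE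
      rw [rieszKernel_smul hρ, ENNReal.ofReal_mul (by positivity)]
    · rw [indicator_of_notMem (fun hh => hx (this.1 hh)), indicator_of_notMem hx, mul_zero]
  rw [h1, lintegral_const_mul _ (measurable_kerE.indicator measurableSet_ball),
    lintegral_indicator measurableSet_ball, lintegral_indicator measurableSet_ball] at h
  have h2 : ENNReal.ofReal (ρ ^ N) * ENNReal.ofReal ((ρ ^ N)⁻¹) = 1 := by
    rw [← ENNReal.ofReal_mul (by positivity), mul_inv_cancel₀ (by positivity), ENNReal.ofReal_one]
  rw [← one_mul (∫⁻ x in Metric.ball (0 : E N) ρ, kerE α x), ← h2, mul_assoc, ← h, ← mul_assoc,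
    ← ENNReal.ofReal_mul (by positivity)]
  congr 2
  rw [← Real.rpow_natCast, ← Real.rpow_add hρ]
  congr 1
  ring

/-- A set of measure `m` has Riesz potential at most `C m ^ (α / N)`. -/
lemma exists_setLIntegral_kerE_le (hN : 0 < N) (hα0 : 0 < α) (hαN : α < N) :
    ∃ C : ℝ≥0∞, C ≠ ⊤ ∧ ∀ (x : E N) (B : Set (E N)), MeasurableSet B →
      ∫⁻ y in B, kerE α (x - y) ≤ C * volume B ^ (α / N) := by
  have hN' : (0 : ℝ) < N := by exact_mod_cast hN
  set κ := ∫⁻ x in Metric.ball (0 : E N) 1, kerE α x with hκ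
  have hc := rieszConst_pos hα0 hαN
  refine ⟨κ + ENNReal.ofReal (rieszConst N α), ?_, fun x B hB => ?_⟩
  · exact ENNReal.add_ne_top.2 ⟨(lintegral_kerE_ball hN hα0 hαN).ne, ENNReal.ofReal_ne_top⟩
  -- The right-hand side is infinite here because the constant contains the positive summand
  -- `rieszConst`.
  rcases eq_or_ne (volume B) ⊤ with h | h
  · rw [h, ENNReal.top_rpow_of_pos (by positivity), ENNReal.mul_top]
    · exact le_top
    · simp [hc]
  rcases eq_or_ne (volume B) 0 with h0 | h0
  · rw [setLIntegral_measure_zero _ _ h0]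
    exact zero_le
  set m := (volume B).toReal with hm
  have hmpos : 0 < m := ENNReal.toReal_pos h0 h
  have hmE : volume B = ENNReal.ofReal m := (ENNReal.ofReal_toReal h).symm
  -- At the radius whose N-th power is the measure of B, the two contributions balance: the kernel
  -- over the ball gives ρ^α κ, and its supremum outside times m gives a multiple of ρ^(α-N) m. Both
  -- are multiples of m^(α/N).
  set ρ := m ^ (1 / (N : ℝ)) with hρ
  have hρpos : 0 < ρ := by positivity
  have h1 : ∀ y, kerE α (x - y) ≤ (Metric.ball (0 : E N) ρ).indicator (kerE α) (x - y)
      + ENNReal.ofReal (rieszConst N α * ρ ^ (α - N)) := by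
    intro y
    by_cases hy : x - y ∈ Metric.ball (0 : E N) ρ
    · rw [indicator_of_mem hy]
      exact le_self_add
    · rw [indicator_of_notMem hy, zero_add]
      refine ENNReal.ofReal_le_ofReal ?_
      rw [rieszKernel_eq]
      simp only [mem_ball_zero_iff, not_lt] at hy
      exact mul_le_mul_of_nonneg_left
        (Real.rpow_le_rpow_of_nonpos hρpos hy (by linarith)) hc.le
  calc ∫⁻ y in B, kerE α (x - y)
      ≤ ∫⁻ y in B, ((Metric.ball (0 : E N) ρ).indicator (kerE α) (x - y)
      + ENNReal.ofReal (rieszConst N α * ρ ^ (α - N))) := lintegral_mono fun y => h1 y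
    _ = (∫⁻ y in B, (Metric.ball (0 : E N) ρ).indicator (kerE α) (x - y))
      + ENNReal.ofReal (rieszConst N α * ρ ^ (α - N)) * volume B := by
        rw [lintegral_add_right _ measurable_const, setLIntegral_const]
    _ ≤ (∫⁻ y, (Metric.ball (0 : E N) ρ).indicator (kerE α) (x - y))
      + ENNReal.ofReal (rieszConst N α * ρ ^ (α - N)) * volume B := by
        gcongr
        exact Measure.restrict_le_self
    _ = ENNReal.ofReal (ρ ^ α) * κ + ENNReal.ofReal (rieszConst N α * ρ ^ (α - N)) * volume B := by
        rw [lintegral_sub_left_eq_self (fun y => (Metric.ball (0 : E N) ρ).indicator (kerE α) y) x,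
          lintegral_indicator measurableSet_ball, lintegral_kerE_ball_radius hρpos]
    _ = (κ + ENNReal.ofReal (rieszConst N α)) * volume B ^ (α / N) := by
        have e1 : ρ ^ α = m ^ (α / N) := by
          rw [hρ, ← Real.rpow_mul hmpos.le]
          congr 1
          ring
        have e2 : rieszConst N α * ρ ^ (α - N) * m = rieszConst N α * m ^ (α / N) := by
          rw [hρ, ← Real.rpow_mul hmpos.le, mul_assoc]
          nth_rewrite 2 [← Real.rpow_one m]
          rw [← Real.rpow_add hmpos]
          congr 2
          field_simp
          ring
        rw [hmE, ← ENNReal.ofReal_mul (by positivity), e1, e2, ENNReal.ofReal_mul hc.le,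
          ENNReal.ofReal_rpow_of_pos hmpos]
        ring

end Kernel

/-! ### The diagonal Hardy–Littlewood–Sobolev inequality, proved by layer cake. -/

section HLS

variable {N : ℕ} {α : ℝ}

/-- The diagonal Hardy–Littlewood–Sobolev exponent `2N / (N + α)`. -/
def hlsExp (N : ℕ) (α : ℝ) : ℝ := 2 * N / (N + α)

lemma hlsExp_pos (hN : 0 < N) (hα0 : 0 < α) : 0 < hlsExp N α := by
  have hN' : (0 : ℝ) < N := by exact_mod_cast hN
  unfold hlsExp
  positivity

lemma one_lt_hlsExp (hα0 : 0 < α) (hαN : α < N) : 1 < hlsExp N α := by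
  unfold hlsExp
  rw [lt_div_iff₀ (by linarith)]
  linarith

/-- Equivalent to p(1 + α/N) = 2, the relation that singles out the diagonal exponent. It turns the
integral of b^(-pα/N) over levels b < s into a multiple of s^(p-1). -/
lemma one_sub_hlsExp_mul (hN : 0 < N) (hα0 : 0 < α) :
    1 - hlsExp N α * (α / N) = hlsExp N α - 1 := by
  have hN' : (0 : ℝ) < N := by exact_mod_cast hN
  unfold hlsExp
  field_simp
  ring

lemma lintegral_Ioo_rpow_neg {γ : ℝ} (hγ : γ < 1) (s : ℝ≥0) :
    ∫⁻ b in Ioo (0 : ℝ) s, ENNReal.ofReal (b ^ (-γ))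
      = ENNReal.ofReal ((s : ℝ) ^ (1 - γ) / (1 - γ)) := by
  have h1 : IntegrableOn (fun b : ℝ => b ^ (-γ)) (Ioc 0 (s : ℝ)) := by
    have := (intervalIntegral.intervalIntegrable_rpow' (a := 0) (b := (s : ℝ))
      (show -1 < -γ by linarith))
    rwa [intervalIntegrable_iff_integrableOn_Ioc_of_le s.coe_nonneg] at this
  have h2 : IntegrableOn (fun b : ℝ => b ^ (-γ)) (Ioo 0 (s : ℝ)) := h1.mono_set Ioo_subset_Ioc_self
  rw [← ofReal_integral_eq_lintegral_ofReal h2, ← integral_Ioc_eq_integral_Ioo,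
    ← intervalIntegral.integral_of_le s.coe_nonneg, integral_rpow (Or.inl (by linarith)),
    Real.zero_rpow (by linarith), sub_zero]
  · congr 2 <;> ring_nf
  · filter_upwards [self_mem_ae_restrict measurableSet_Ioo] with b hb
    exact Real.rpow_nonneg hb.1.le _

/-- Chebyshev's inequality for the p-th power, raised to the power α/N so that it can be combined
with the bound for the potential of a set. -/
lemma volume_lt_rpow_le (hN : 0 < N) (hα0 : 0 < α) {h : E N → ℝ≥0} (hh : Measurable h)
    {b : ℝ} (hb : 0 < b) :
    volume {y | b < h y} ^ (α / N) ≤ (∫⁻ x, (h x : ℝ≥0∞) ^ hlsExp N α) ^ (α / N)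
      * ENNReal.ofReal (b ^ (-(hlsExp N α * (α / N)))) := by
  have hN' : (0 : ℝ) < N := by exact_mod_cast hN
  have hp := hlsExp_pos hN hα0
  set p := hlsExp N α
  have h1 : ENNReal.ofReal (b ^ p) * volume {y | b < h y} ≤ ∫⁻ x, (h x : ℝ≥0∞) ^ p := by
    refine le_trans ?_ (mul_meas_ge_le_lintegral (hh.coe_nnreal_ennreal.pow_const p)
      (ENNReal.ofReal (b ^ p)))
    refine mul_le_mul_right (measure_mono fun y hy => ?_) _
    change ENNReal.ofReal (b ^ hlsExp N α) ≤ (h y : ℝ≥0∞) ^ hlsExp N α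
    rw [← ENNReal.ofReal_rpow_of_pos hb]
    gcongr
    rw [ENNReal.ofReal_le_iff_le_toReal ENNReal.coe_ne_top]
    exact (show b < h y from hy).le
  have h2 : volume {y | b < h y}
      ≤ ENNReal.ofReal (b ^ (-p)) * ∫⁻ x, (h x : ℝ≥0∞) ^ p := by
    calc volume {y | b < h y}
        = ENNReal.ofReal (b ^ (-p)) * (ENNReal.ofReal (b ^ p) * volume {y | b < h y}) := by
          rw [← mul_assoc, ← ENNReal.ofReal_mul (by positivity), ← Real.rpow_add hb]
          simp
      _ ≤ _ := by gcongr
  calc _ ≤ (ENNReal.ofReal (b ^ (-p)) * ∫⁻ x, (h x : ℝ≥0∞) ^ p) ^ (α / N) := by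
        gcongr
    _ = _ := by
        rw [ENNReal.mul_rpow_of_nonneg _ _ (by positivity),
          ENNReal.ofReal_rpow_of_pos (by positivity), ← Real.rpow_mul hb.le, mul_comm]
        congr 3
        ring

/-- **Hardy–Littlewood–Sobolev inequality**, diagonal quadratic case. -/
lemma exists_hls_quadratic (hN : 0 < N) (hα0 : 0 < α) (hαN : α < N) :
    ∃ C : ℝ≥0∞, C ≠ ⊤ ∧ ∀ h : E N → ℝ≥0, Measurable h →
      ∫⁻ x, ∫⁻ y, kerE α (x - y) * h x * h y
        ≤ C * (∫⁻ x, (h x : ℝ≥0∞) ^ hlsExp N α) ^ (2 / hlsExp N α) := by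
  have hN' : (0 : ℝ) < N := by exact_mod_cast hN
  obtain ⟨C, hC, hK⟩ := exists_setLIntegral_kerE_le hN hα0 hαN
  have hp1 := one_lt_hlsExp hα0 hαN
  have hp := hlsExp_pos hN hα0
  have hγ := one_sub_hlsExp_mul hN hα0
  set p := hlsExp N α with hpdef
  set γ := p * (α / N) with hγdef
  refine ⟨2 * (C * ENNReal.ofReal (1 / (p - 1))), by finiteness, fun h hh => ?_⟩
  set S := ∫⁻ x, (h x : ℝ≥0∞) ^ p with hS
  have hhE : Measurable fun x => (h x : ℝ≥0∞) := hh.coe_nnreal_ennreal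
  -- the potential of the part of `h` below a level `s`
  have key : ∀ (x : E N) (s : ℝ≥0), ∫⁻ y, {y | h y ≤ s}.indicator (fun y => kerE α (x - y) * h y) y
      ≤ C * S ^ (α / N) * ENNReal.ofReal ((s : ℝ) ^ (p - 1) / (p - 1)) := by
    intro x s
    -- Layer cake: where h(y) ≤ s, the value h(y) is the length of the set of levels b in (0, s)
    -- below h(y). The potential becomes an integral over b of potentials of superlevel sets.
    have e1 : ∀ y, {y | h y ≤ s}.indicator (fun y => kerE α (x - y) * h y) y
        ≤ ∫⁻ b in Ioo (0 : ℝ) s, {q : ℝ × E N | q.1 < h q.2}.indicator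
          (fun q => kerE α (x - q.2)) (b, y) := by
      intro y
      by_cases hy : h y ≤ s
      · rw [indicator_of_mem (by exact hy)]
        have : ∀ b, {q : ℝ × E N | q.1 < h q.2}.indicator (fun q => kerE α (x - q.2)) (b, y)
            = kerE α (x - y) * (Iio (h y : ℝ)).indicator 1 b := by
          intro b
          by_cases hb : b < h y
          · rw [indicator_of_mem (by exact hb), indicator_of_mem (by exact hb)]
            simp
          · rw [indicator_of_notMem (by exact hb), indicator_of_notMem (by exact hb)]
            simp
        simp_rw [this]
        rw [lintegral_const_mul _ (measurable_one.indicator measurableSet_Iio),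
          lintegral_indicator_one measurableSet_Iio, Measure.restrict_apply measurableSet_Iio]
        gcongr
        have : Ioo (0 : ℝ) (h y) ⊆ Iio (h y : ℝ) ∩ Ioo 0 s := fun b hb =>
          ⟨hb.2, hb.1, hb.2.trans_le (by exact_mod_cast hy)⟩
        refine le_trans ?_ (measure_mono this)
        simp
      · rw [indicator_of_notMem (by exact hy)]
        exact zero_le
    have hmeas : Measurable ({q : ℝ × E N | q.1 < h q.2}.indicator
        (fun q => kerE α (x - q.2))) := by
      refine Measurable.indicator ?_ ?_
      · exact measurable_kerE.comp (by fun_prop)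
      · exact measurableSet_lt (by fun_prop) (by fun_prop)
    calc _ ≤ ∫⁻ y, ∫⁻ b in Ioo (0 : ℝ) s, {q : ℝ × E N | q.1 < h q.2}.indicator
          (fun q => kerE α (x - q.2)) (b, y) := lintegral_mono e1
      _ = ∫⁻ b in Ioo (0 : ℝ) s, ∫⁻ y, {q : ℝ × E N | q.1 < h q.2}.indicator
          (fun q => kerE α (x - q.2)) (b, y) := by
          rw [lintegral_lintegral_swap]
          exact (hmeas.comp measurable_swap).aemeasurable
      _ ≤ ∫⁻ b in Ioo (0 : ℝ) s, C * S ^ (α / N) * ENNReal.ofReal (b ^ (-γ)) := by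
          refine setLIntegral_mono (by fun_prop) fun b hb => ?_
          have hms : MeasurableSet {y | b < h y} := measurableSet_lt (by fun_prop) (by fun_prop)
          have : (fun y => {q : ℝ × E N | q.1 < h q.2}.indicator
              (fun q => kerE α (x - q.2)) (b, y))
              = {y | b < h y}.indicator fun y => kerE α (x - y) := by
            ext y
            by_cases hy : b < h y
            · rw [indicator_of_mem (by exact hy), indicator_of_mem (by exact hy)]
            · rw [indicator_of_notMem (by exact hy), indicator_of_notMem (by exact hy)]
          rw [this, lintegral_indicator hms]
          refine (hK x _ hms).trans ?_
          rw [mul_assoc]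
          gcongr
          exact volume_lt_rpow_le hN hα0 hh hb.1
      _ = _ := by
          rw [lintegral_const_mul _ (by fun_prop), lintegral_Ioo_rpow_neg (by linarith), hγ]
  -- By symmetry of the kernel it suffices to integrate over pairs in which the second value is the
  -- smaller one. There only the part of h below the level h(x) acts on the point x.
  have hsplit : ∀ x y, kerE α (x - y) * h x * h y
      ≤ h x * {y | h y ≤ h x}.indicator (fun y => kerE α (x - y) * h y) y
        + h y * {x | h x ≤ h y}.indicator (fun x => kerE α (y - x) * h x) x := by
    intro x y
    rcases le_total (h y) (h x) with hxy | hxy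
    · rw [indicator_of_mem (by exact hxy)]
      refine le_trans (le_of_eq ?_) le_self_add
      ring
    · rw [indicator_of_mem (s := {x | h x ≤ h y}) (by exact hxy)]
      refine le_trans (le_of_eq ?_) le_add_self
      rw [kerE_sub_comm]
      ring
  have hG : Measurable fun q : E N × E N =>
      h q.1 * {y | h y ≤ h q.1}.indicator (fun y => kerE α (q.1 - y) * (h y : ℝ≥0∞)) q.2 := by
    have : (fun q : E N × E N =>
        h q.1 * {y | h y ≤ h q.1}.indicator (fun y => kerE α (q.1 - y) * (h y : ℝ≥0∞)) q.2)
        = fun q => h q.1 * {q : E N × E N | h q.2 ≤ h q.1}.indicator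
          (fun q => kerE α (q.1 - q.2) * (h q.2 : ℝ≥0∞)) q := by
      ext q
      by_cases hq : h q.2 ≤ h q.1
      · rw [indicator_of_mem (by exact hq), indicator_of_mem (by exact hq)]
      · rw [indicator_of_notMem (by exact hq), indicator_of_notMem (by exact hq)]
    rw [this]
    refine Measurable.mul (by fun_prop) (Measurable.indicator ?_ ?_)
    · exact (measurable_kerE.comp (by fun_prop)).mul (by fun_prop)
    · exact measurableSet_le (by fun_prop) (by fun_prop)
  -- With the level s = h(x), the inner integral is at most a multiple of h(x)^(p-1), and the outer
  -- factor h(x) completes it to h(x)^p.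
  have half : ∫⁻ x, ∫⁻ y, h x * {y | h y ≤ h x}.indicator (fun y => kerE α (x - y) * h y) y
      ≤ C * ENNReal.ofReal (1 / (p - 1)) * S ^ (2 / p) := by
    calc _ ≤ ∫⁻ x, C * S ^ (α / N) * ENNReal.ofReal (1 / (p - 1)) * (h x : ℝ≥0∞) ^ p := by
          refine lintegral_mono fun x => ?_
          rw [lintegral_const_mul']
          · refine (mul_le_mul_right (key x (h x)) _).trans (le_of_eq ?_)
            have : (h x : ℝ≥0∞) ^ p = h x * ENNReal.ofReal ((h x : ℝ) ^ (p - 1)) := by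
              rw [← ENNReal.ofReal_rpow_of_nonneg (h x).coe_nonneg (by linarith)]
              nth_rewrite 2 [← ENNReal.rpow_one (h x : ℝ≥0∞)]
              rw [ENNReal.ofReal_coe_nnreal]
              rw [← ENNReal.rpow_add_of_nonneg _ _ (by norm_num) (by linarith)]
              congr 1
              ring
            rw [this, div_eq_mul_one_div (_ ^ (p - 1)), ENNReal.ofReal_mul (by positivity)]
            ring
          · exact ENNReal.coe_ne_top
      _ = C * S ^ (α / N) * ENNReal.ofReal (1 / (p - 1)) * S := by
          rw [lintegral_const_mul _ (by fun_prop)]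
      _ = _ := by
          have : S ^ (2 / p) = S ^ (α / N) * S := by
            have e : 2 / p = α / N + 1 := by
              rw [hpdef, hlsExp]
              field_simp
              ring
            rw [e, ENNReal.rpow_add_of_nonneg _ _ (by positivity) (by norm_num), ENNReal.rpow_one]
          rw [this]
          ring
  calc _ ≤ ∫⁻ x, ∫⁻ y, (h x * {y | h y ≤ h x}.indicator (fun y => kerE α (x - y) * h y) y
        + h y * {x | h x ≤ h y}.indicator (fun x => kerE α (y - x) * h x) x) :=
        lintegral_mono fun x => lintegral_mono fun y => hsplit x y
    _ = (∫⁻ x, ∫⁻ y, h x * {y | h y ≤ h x}.indicator (fun y => kerE α (x - y) * h y) y)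
        + ∫⁻ x, ∫⁻ y, h y * {x | h x ≤ h y}.indicator (fun x => kerE α (y - x) * h x) x := by
        rw [← lintegral_add_left]
        · refine lintegral_congr fun x => ?_
          rw [← lintegral_add_left]
          exact hG.comp (by fun_prop : Measurable fun y => (x, y))
        · exact hG.lintegral_prod_right'
    _ = 2 * ∫⁻ x, ∫⁻ y, h x * {y | h y ≤ h x}.indicator (fun y => kerE α (x - y) * h y) y := by
        rw [lintegral_lintegral_swap (f := fun x y =>
          h y * {x | h x ≤ h y}.indicator (fun x => kerE α (y - x) * (h x : ℝ≥0∞)) x), two_mul]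
        exact (hG.comp measurable_swap).aemeasurable
    _ ≤ _ := by
        rw [mul_assoc]
        gcongr

/-- **Hardy–Littlewood–Sobolev inequality** with both exponents `2N / (N + α)`. -/
lemma exists_hls (hN : 0 < N) (hα0 : 0 < α) (hαN : α < N) :
    ∃ C : ℝ≥0∞, C ≠ ⊤ ∧ ∀ h k : E N → ℝ≥0∞, AEMeasurable h → AEMeasurable k →
      ∫⁻ x, ∫⁻ y, kerE α (x - y) * h x * k y
        ≤ C * (∫⁻ x, h x ^ hlsExp N α) ^ (1 / hlsExp N α)
          * (∫⁻ x, k x ^ hlsExp N α) ^ (1 / hlsExp N α) := by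
  obtain ⟨C, hC, hQ⟩ := exists_hls_quadratic hN hα0 hαN
  have hp := hlsExp_pos hN hα0
  have hp1 := one_lt_hlsExp hα0 hαN
  set p := hlsExp N α with hpdef
  -- The summand 1 keeps the constant nonzero, so the right-hand side is infinite when one norm is
  -- infinite and the other is not zero. The factor 4 is the square of the bound 2 for the norm of a
  -- sum of two normalised functions.
  refine ⟨(C + 1) * 4, by finiteness, fun h k hh hk => ?_⟩
  have hcongr : ∀ h' k' : E N → ℝ≥0∞, h =ᵐ[volume] h' → k =ᵐ[volume] k' →
      ∫⁻ x, ∫⁻ y, kerE α (x - y) * h x * k y = ∫⁻ x, ∫⁻ y, kerE α (x - y) * h' x * k' y := by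
    intro h' k' e1 e2
    refine lintegral_congr_ae ?_
    filter_upwards [e1] with x hx
    refine lintegral_congr_ae ?_
    filter_upwards [e2] with y hy
    rw [hx, hy]
  have hzero : ∀ g : E N → ℝ≥0∞, AEMeasurable g → ∫⁻ x, g x ^ p = 0 → g =ᵐ[volume] 0 := by
    intro g hg h0
    rw [lintegral_eq_zero_iff' (hg.pow_const p)] at h0
    filter_upwards [h0] with x hx
    simpa [hp, hp.not_gt] using hx
  rcases eq_or_ne (∫⁻ x, h x ^ p) 0 with h0 | h0
  · rw [hcongr 0 k (hzero h hh h0) (ae_eq_refl k)]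
    simp
  rcases eq_or_ne (∫⁻ x, k x ^ p) 0 with k0 | k0
  · rw [hcongr h 0 (ae_eq_refl h) (hzero k hk k0)]
    simp
  have hip : 0 < 1 / p := by positivity
  rcases eq_or_ne (∫⁻ x, h x ^ p) ⊤ with h1 | h1
  · rw [h1, ENNReal.top_rpow_of_pos hip, ENNReal.mul_top (by simp), ENNReal.top_mul]
    · exact le_top
    · simp [ENNReal.rpow_eq_zero_iff, k0, hp.le]
  rcases eq_or_ne (∫⁻ x, k x ^ p) ⊤ with k1 | k1
  · rw [k1, ENNReal.top_rpow_of_pos hip, ENNReal.mul_top]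
    · exact le_top
    · simp [ENNReal.rpow_eq_zero_iff, h0, hp.le]
  set a := (∫⁻ x, h x ^ p) ^ (1 / p) with ha
  set b := (∫⁻ x, k x ^ p) ^ (1 / p) with hb
  have ha0 : a ≠ 0 := by simp [ha, ENNReal.rpow_eq_zero_iff, h0, hp.le]
  have hb0 : b ≠ 0 := by simp [hb, ENNReal.rpow_eq_zero_iff, k0, hp.le]
  have ha1 : a ≠ ⊤ := ENNReal.rpow_ne_top_of_nonneg hip.le h1
  have hb1 : b ≠ ⊤ := ENNReal.rpow_ne_top_of_nonneg hip.le k1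
  have hap : a ^ p = ∫⁻ x, h x ^ p := by
    rw [ha, ← ENNReal.rpow_mul, one_div_mul_cancel hp.ne', ENNReal.rpow_one]
  have hbp : b ^ p = ∫⁻ x, k x ^ p := by
    rw [hb, ← ENNReal.rpow_mul, one_div_mul_cancel hp.ne', ENNReal.rpow_one]
  -- normalise and test the quadratic form with the sum
  set g : E N → ℝ≥0∞ := fun x => a⁻¹ * h x + b⁻¹ * k x with hg
  have hgm : AEMeasurable g := by fun_prop
  have hgp : ∫⁻ x, g x ^ p ≤ 2 ^ p := by
    calc ∫⁻ x, g x ^ p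
        ≤ ∫⁻ x, 2 ^ (p - 1) * ((a⁻¹ * h x) ^ p + (b⁻¹ * k x) ^ p) :=
          lintegral_mono fun x => ENNReal.rpow_add_le_mul_rpow_add_rpow _ _ hp1.le
      _ = 2 ^ (p - 1) * ((∫⁻ x, (a⁻¹ * h x) ^ p) + ∫⁻ x, (b⁻¹ * k x) ^ p) := by
          rw [lintegral_const_mul'' _ (by fun_prop), lintegral_add_left' (by fun_prop)]
      _ = 2 ^ (p - 1) * (1 + 1) := by
          have : ∀ (c : ℝ≥0∞) (w : E N → ℝ≥0∞), AEMeasurable w → c ≠ 0 → c ≠ ⊤ →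
              c ^ p = ∫⁻ x, w x ^ p → ∫⁻ x, (c⁻¹ * w x) ^ p = 1 := by
            intro c w hw c0 c1 hc
            simp_rw [ENNReal.mul_rpow_of_nonneg _ _ hp.le]
            rw [lintegral_const_mul'' _ (by fun_prop), ← hc, ← ENNReal.mul_rpow_of_nonneg _ _ hp.le,
              ENNReal.inv_mul_cancel c0 c1, ENNReal.one_rpow]
          rw [this a h hh ha0 ha1 hap, this b k hk hb0 hb1 hbp]
      _ = 2 ^ p := by
          rw [show (1 : ℝ≥0∞) + 1 = 2 ^ (1 : ℝ) by norm_num,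
            ← ENNReal.rpow_add _ _ (by norm_num) (by norm_num)]
          congr 1
          ring
  have hgfin : ∀ᵐ x, g x ≠ ⊤ := by
    have := ae_lt_top' (hgm.pow_const p) (ne_top_of_le_ne_top (by finiteness) hgp)
    filter_upwards [this] with x hx hx'
    rw [hx', ENNReal.top_rpow_of_pos hp] at hx
    exact hx.ne rfl
  -- The quadratic estimate is stated for measurable functions with finite values; g has such a
  -- representative because its p-th power has finite integral.
  set g' : E N → ℝ≥0 := fun x => (hgm.mk g x).toNNReal with hg'
  have hg'm : Measurable g' := hgm.measurable_mk.ennreal_toNNReal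
  have hgg' : g =ᵐ[volume] fun x => (g' x : ℝ≥0∞) := by
    filter_upwards [hgm.ae_eq_mk, hgfin] with x hx hx'
    rw [hg']
    simp only
    rw [← hx, ENNReal.coe_toNNReal hx']
  have hbound : ∫⁻ x, ∫⁻ y, kerE α (x - y) * g x * g y ≤ C * 4 := by
    calc _ = ∫⁻ x, ∫⁻ y, kerE α (x - y) * g' x * g' y := by
          refine lintegral_congr_ae ?_
          filter_upwards [hgg'] with x hx
          refine lintegral_congr_ae ?_
          filter_upwards [hgg'] with y hy
          rw [hx, hy]
      _ ≤ _ := hQ g' hg'm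
      _ = C * (∫⁻ x, g x ^ p) ^ (2 / p) := by
          congr 2
          refine lintegral_congr_ae ?_
          filter_upwards [hgg'] with x hx
          rw [hx]
      _ ≤ C * (2 ^ p) ^ (2 / p) := by gcongr
      _ = C * 4 := by
          rw [← ENNReal.rpow_mul, mul_div_cancel₀ _ hp.ne']
          norm_num
  calc ∫⁻ x, ∫⁻ y, kerE α (x - y) * h x * k y
      ≤ ∫⁻ x, ∫⁻ y, a * b * (kerE α (x - y) * g x * g y) := by
        refine lintegral_mono fun x => lintegral_mono fun y => ?_
        have e1 : h x ≤ a * g x := by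
          rw [hg]
          simp only
          rw [mul_add, ← mul_assoc, ENNReal.mul_inv_cancel ha0 ha1, one_mul]
          exact le_self_add
        have e2 : k y ≤ b * g y := by
          rw [hg]
          simp only
          rw [mul_add, ← mul_assoc b b⁻¹, ENNReal.mul_inv_cancel hb0 hb1, one_mul]
          exact le_add_self
        calc kerE α (x - y) * h x * k y ≤ kerE α (x - y) * (a * g x) * (b * g y) := by gcongr
          _ = _ := by ring
    _ = a * b * ∫⁻ x, ∫⁻ y, kerE α (x - y) * g x * g y := by
        simp_rw [lintegral_const_mul' (a * b) _ (ENNReal.mul_ne_top ha1 hb1)]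
    _ ≤ a * b * ((C + 1) * 4) := by
        gcongr
        refine hbound.trans ?_
        gcongr
        exact le_self_add
    _ = _ := by ring

end HLS

/-! ### The bilinear form of the Riesz potential on L^(2N/(N+α)). -/

section BilinearForm

variable {N : ℕ} {α : ℝ}

/-- The bilinear form `∫ (I_α * k) h`. -/
def rieszForm (α : ℝ) (h k : E N → ℝ) : ℝ := ∫ x, rieszConv α k x * h x

/-- The exponent `2N / (N + α)` as an extended nonnegative real. -/
def hlsExpE (N : ℕ) (α : ℝ) : ℝ≥0∞ := ENNReal.ofReal (hlsExp N α)

lemma hlsExpE_toReal (hN : 0 < N) (hα0 : 0 < α) : (hlsExpE N α).toReal = hlsExp N α :=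
  ENNReal.toReal_ofReal (hlsExp_pos hN hα0).le

lemma hlsExpE_ne_zero (hN : 0 < N) (hα0 : 0 < α) : hlsExpE N α ≠ 0 := by
  simpa [hlsExpE] using hlsExp_pos hN hα0

lemma hlsExpE_ne_top : hlsExpE N α ≠ ⊤ := ENNReal.ofReal_ne_top

lemma one_le_hlsExpE (hα0 : 0 < α) (hαN : α < N) : 1 ≤ hlsExpE N α := by
  simpa [hlsExpE] using (one_lt_hlsExp hα0 hαN).le

lemma eLpNorm_hlsExpE (hN : 0 < N) (hα0 : 0 < α) (h : E N → ℝ) :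
    eLpNorm h (hlsExpE N α) volume
      = (∫⁻ x, ‖h x‖ₑ ^ hlsExp N α) ^ (1 / hlsExp N α) := by
  rw [eLpNorm_eq_lintegral_rpow_enorm_toReal (hlsExpE_ne_zero hN hα0) hlsExpE_ne_top,
    hlsExpE_toReal hN hα0]

/-- The integrand of `rieszForm` on the product space. -/
def rieszProd (α : ℝ) (h k : E N → ℝ) (q : E N × E N) : ℝ :=
  rieszKernel α (q.1 - q.2) * k q.2 * h q.1

lemma exists_lintegral_rieszProd_le (hN : 0 < N) (hα0 : 0 < α) (hαN : α < N) :
    ∃ C : ℝ≥0∞, C ≠ ⊤ ∧ ∀ h k : E N → ℝ, AEStronglyMeasurable h → AEStronglyMeasurable k →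
      ∫⁻ x, ∫⁻ y, ‖rieszProd α h k (x, y)‖ₑ
        ≤ C * eLpNorm h (hlsExpE N α) volume * eLpNorm k (hlsExpE N α) volume := by
  obtain ⟨C, hC, hH⟩ := exists_hls hN hα0 hαN
  refine ⟨C, hC, fun h k hh hk => ?_⟩
  rw [eLpNorm_hlsExpE hN hα0, eLpNorm_hlsExpE hN hα0]
  refine le_trans (le_of_eq ?_) (hH (fun x => ‖h x‖ₑ) (fun x => ‖k x‖ₑ) hh.enorm hk.enorm)
  refine lintegral_congr fun x => lintegral_congr fun y => ?_
  simp only [rieszProd, enorm_mul, kerE]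
  rw [Real.enorm_eq_ofReal (rieszKernel_nonneg hα0 hαN _)]
  ring

lemma aestronglyMeasurable_rieszProd {h k : E N → ℝ} (hh : AEStronglyMeasurable h)
    (hk : AEStronglyMeasurable k) :
    AEStronglyMeasurable (rieszProd α h k) (volume.prod volume) := by
  unfold rieszProd
  refine AEStronglyMeasurable.mul (AEStronglyMeasurable.mul ?_ hk.comp_snd) hh.comp_fst
  exact (measurable_rieszKernel.comp (by fun_prop)).aestronglyMeasurable

lemma integrable_rieszProd (hN : 0 < N) (hα0 : 0 < α) (hαN : α < N) {h k : E N → ℝ}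
    (hh : MemLp h (hlsExpE N α)) (hk : MemLp k (hlsExpE N α)) :
    Integrable (rieszProd α h k) (volume.prod volume) := by
  obtain ⟨C, hC, hH⟩ := exists_lintegral_rieszProd_le hN hα0 hαN
  have hm := aestronglyMeasurable_rieszProd (α := α) hh.1 hk.1
  refine ⟨hm, ?_⟩
  rw [HasFiniteIntegral, lintegral_prod _ hm.enorm]
  refine (hH h k hh.1 hk.1).trans_lt ?_
  exact ENNReal.mul_lt_top (ENNReal.mul_lt_top hC.lt_top hh.2) hk.2

lemma rieszConv_mul_eq (h k : E N → ℝ) (x : E N) :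
    rieszConv α k x * h x = ∫ y, rieszProd α h k (x, y) := by
  simp only [rieszConv, rieszProd]
  rw [integral_mul_const]

lemma integrable_rieszConv_mul (hN : 0 < N) (hα0 : 0 < α) (hαN : α < N) {h k : E N → ℝ}
    (hh : MemLp h (hlsExpE N α)) (hk : MemLp k (hlsExpE N α)) :
    Integrable fun x => rieszConv α k x * h x := by
  simp_rw [rieszConv_mul_eq]
  exact (integrable_rieszProd hN hα0 hαN hh hk).integral_prod_left

lemma rieszForm_eq (hN : 0 < N) (hα0 : 0 < α) (hαN : α < N) {h k : E N → ℝ}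
    (hh : MemLp h (hlsExpE N α)) (hk : MemLp k (hlsExpE N α)) :
    rieszForm α h k = ∫ q, rieszProd α h k q ∂(volume.prod volume) := by
  rw [integral_prod _ (integrable_rieszProd hN hα0 hαN hh hk), rieszForm]
  simp_rw [rieszConv_mul_eq]

lemma rieszForm_comm (hN : 0 < N) (hα0 : 0 < α) (hαN : α < N) {h k : E N → ℝ}
    (hh : MemLp h (hlsExpE N α)) (hk : MemLp k (hlsExpE N α)) :
    rieszForm α h k = rieszForm α k h := by
  rw [rieszForm_eq hN hα0 hαN hh hk, rieszForm_eq hN hα0 hαN hk hh, ← integral_prod_swap]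
  refine integral_congr_ae (Eventually.of_forall fun q => ?_)
  simp only [rieszProd, Prod.fst_swap, Prod.snd_swap]
  rw [← rieszKernel_neg, neg_sub]
  ring

lemma rieszForm_add_left (hN : 0 < N) (hα0 : 0 < α) (hαN : α < N) {h₁ h₂ k : E N → ℝ}
    (hh₁ : MemLp h₁ (hlsExpE N α)) (hh₂ : MemLp h₂ (hlsExpE N α)) (hk : MemLp k (hlsExpE N α)) :
    rieszForm α (fun x => h₁ x + h₂ x) k = rieszForm α h₁ k + rieszForm α h₂ k := by
  unfold rieszForm
  rw [← integral_add (integrable_rieszConv_mul hN hα0 hαN hh₁ hk)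
    (integrable_rieszConv_mul hN hα0 hαN hh₂ hk)]
  simp_rw [mul_add]

lemma rieszForm_smul_left (c : ℝ) (h k : E N → ℝ) :
    rieszForm α (fun x => c * h x) k = c * rieszForm α h k := by
  unfold rieszForm
  rw [← integral_const_mul]
  congr 1
  ext x
  ring

lemma rieszForm_add_right (hN : 0 < N) (hα0 : 0 < α) (hαN : α < N) {h₁ h₂ k : E N → ℝ}
    (hh₁ : MemLp h₁ (hlsExpE N α)) (hh₂ : MemLp h₂ (hlsExpE N α)) (hk : MemLp k (hlsExpE N α)) :
    rieszForm α k (fun x => h₁ x + h₂ x) = rieszForm α k h₁ + rieszForm α k h₂ := by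
  have hadd : MemLp (fun x => h₁ x + h₂ x) (hlsExpE N α) := hh₁.add hh₂
  rw [rieszForm_comm hN hα0 hαN hk hadd, rieszForm_comm hN hα0 hαN hk hh₁,
    rieszForm_comm hN hα0 hαN hk hh₂]
  exact rieszForm_add_left hN hα0 hαN hh₁ hh₂ hk

lemma rieszForm_congr {h h' k k' : E N → ℝ} (e1 : h =ᵐ[volume] h') (e2 : k =ᵐ[volume] k') :
    rieszForm α h k = rieszForm α h' k' := by
  have : rieszConv α k = rieszConv α k' := by
    ext x
    refine integral_congr_ae ?_
    filter_upwards [e2] with y hy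
    rw [hy]
  unfold rieszForm
  rw [this]
  refine integral_congr_ae ?_
  filter_upwards [e1] with x hx
  rw [hx]

lemma enorm_rieszForm_le (h k : E N → ℝ) :
    ‖rieszForm α h k‖ₑ ≤ ∫⁻ x, ∫⁻ y, ‖rieszProd α h k (x, y)‖ₑ := by
  unfold rieszForm
  simp_rw [rieszConv_mul_eq]
  refine (enorm_integral_le_lintegral_enorm _).trans (lintegral_mono fun x => ?_)
  exact enorm_integral_le_lintegral_enorm _

lemma exists_enorm_rieszForm_le (hN : 0 < N) (hα0 : 0 < α) (hαN : α < N) :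
    ∃ C : ℝ≥0∞, C ≠ ⊤ ∧ ∀ h k : E N → ℝ, AEStronglyMeasurable h → AEStronglyMeasurable k →
      ‖rieszForm α h k‖ₑ
        ≤ C * eLpNorm h (hlsExpE N α) volume * eLpNorm k (hlsExpE N α) volume := by
  obtain ⟨C, hC, hH⟩ := exists_lintegral_rieszProd_le hN hα0 hαN
  exact ⟨C, hC, fun h k hh hk => (enorm_rieszForm_le h k).trans (hH h k hh hk)⟩

lemma tendsto_rieszForm (hN : 0 < N) (hα0 : 0 < α) (hαN : α < N) {ι : Type*} {l : Filter ι}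
    {h k : ι → E N → ℝ} {h₀ k₀ : E N → ℝ}
    (hh : ∀ i, MemLp (h i) (hlsExpE N α)) (hk : ∀ i, MemLp (k i) (hlsExpE N α))
    (hh₀ : MemLp h₀ (hlsExpE N α)) (hk₀ : MemLp k₀ (hlsExpE N α))
    (hlim : Tendsto (fun i => eLpNorm (fun x => h i x - h₀ x) (hlsExpE N α) volume) l (𝓝 0))
    (klim : Tendsto (fun i => eLpNorm (fun x => k i x - k₀ x) (hlsExpE N α) volume) l (𝓝 0)) :
    Tendsto (fun i => rieszForm α (h i) (k i)) l (𝓝 (rieszForm α h₀ k₀)) := by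
  obtain ⟨C, hC, hH⟩ := exists_enorm_rieszForm_le hN hα0 hαN
  have hd : ∀ i, MemLp (fun x => h i x - h₀ x) (hlsExpE N α) := fun i => (hh i).sub hh₀
  have kd : ∀ i, MemLp (fun x => k i x - k₀ x) (hlsExpE N α) := fun i => (hk i).sub hk₀
  have hz : ∀ {u v : ι → E N → ℝ}, (∀ i, AEStronglyMeasurable (u i)) →
      (∀ i, AEStronglyMeasurable (v i)) →
      Tendsto (fun i => C * eLpNorm (u i) (hlsExpE N α) volume
        * eLpNorm (v i) (hlsExpE N α) volume) l (𝓝 0) →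
      Tendsto (fun i => rieszForm α (u i) (v i)) l (𝓝 0) := by
    intro u v hu hv hlim
    rw [tendsto_zero_iff_enorm_tendsto_zero]
    exact tendsto_of_tendsto_of_tendsto_of_le_of_le tendsto_const_nhds hlim (fun _ => zero_le)
      fun i => hH _ _ (hu i) (hv i)
  have t1 : Tendsto (fun i => rieszForm α (fun x => h i x - h₀ x) fun x => k i x - k₀ x) l (𝓝 0) := by
    refine hz (fun i => (hd i).1) (fun i => (kd i).1) ?_
    have := ENNReal.Tendsto.mul (ENNReal.Tendsto.const_mul hlim (Or.inr hC)) (Or.inr (by simp)) klim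
      (Or.inr (by simp))
    simpa using this
  have t2 : Tendsto (fun i => rieszForm α (fun x => h i x - h₀ x) k₀) l (𝓝 0) := by
    refine hz (v := fun _ => k₀) (fun i => (hd i).1) (fun _ => hk₀.1) ?_
    have := ENNReal.Tendsto.mul_const (ENNReal.Tendsto.const_mul hlim (Or.inr hC))
      (Or.inr hk₀.2.ne)
    simpa using this
  have t3 : Tendsto (fun i => rieszForm α h₀ fun x => k i x - k₀ x) l (𝓝 0) := by
    refine hz (u := fun _ => h₀) (fun _ => hh₀.1) (fun i => (kd i).1) ?_
    have := ENNReal.Tendsto.const_mul klim (Or.inr (ENNReal.mul_ne_top hC hh₀.2.ne))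
    simpa using this
  have key : ∀ i, rieszForm α (h i) (k i)
      = rieszForm α (fun x => h i x - h₀ x) (fun x => k i x - k₀ x)
        + rieszForm α (fun x => h i x - h₀ x) k₀ + rieszForm α h₀ (fun x => k i x - k₀ x)
        + rieszForm α h₀ k₀ := by
    intro i
    rw [← rieszForm_add_right hN hα0 hαN (kd i) hk₀ (hd i), add_assoc,
      ← rieszForm_add_right hN hα0 hαN (kd i) hk₀ hh₀]
    have kadd : MemLp (fun x => k i x - k₀ x + k₀ x) (hlsExpE N α) := (kd i).add hk₀
    rw [← rieszForm_add_left hN hα0 hαN (hd i) hh₀ kadd]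
    simp
  simp_rw [key]
  simpa using ((t1.add t2).add t3).add_const (rieszForm α h₀ k₀)

lemma integral_comp_inv_smul_pos {t : ℝ} (ht : 0 < t) (w : E N → ℝ) :
    ∫ x, w (t⁻¹ • x) = t ^ (N : ℝ) * ∫ x, w x := by
  rw [Measure.integral_comp_inv_smul_of_nonneg _ _ ht.le]
  simp

/-- Each of the two integrations contributes t^N and the kernel contributes t^(α-N). The changes of
variables hold for Bochner integrals without integrability assumptions. -/
lemma rieszForm_comp_smul {t : ℝ} (ht : 0 < t) (h k : E N → ℝ) :
    rieszForm α (fun x => h (t⁻¹ • x)) (fun x => k (t⁻¹ • x))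
      = t ^ ((N : ℝ) + α) * rieszForm α h k := by
  have h1 : ∀ x, rieszConv α (fun y => k (t⁻¹ • y)) x = t ^ α * rieszConv α k (t⁻¹ • x) := by
    intro x
    have e : ∀ y, rieszKernel α (x - y) * k (t⁻¹ • y)
        = t ^ (α - N) * (fun z => rieszKernel α (t⁻¹ • x - z) * k z) (t⁻¹ • y) := by
      intro y
      simp only
      rw [← mul_assoc, ← rieszKernel_smul ht, smul_sub, smul_inv_smul₀ ht.ne', smul_inv_smul₀ ht.ne']
    unfold rieszConv
    simp_rw [e]
    rw [integral_const_mul,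
      integral_comp_inv_smul_pos ht (fun z => rieszKernel α (t⁻¹ • x - z) * k z),
      ← mul_assoc, ← Real.rpow_add ht]
    congr 2
    ring
  unfold rieszForm
  simp_rw [h1]
  have e : ∀ x, t ^ α * rieszConv α k (t⁻¹ • x) * h (t⁻¹ • x)
      = t ^ α * (fun z => rieszConv α k z * h z) (t⁻¹ • x) := fun x => by ring
  simp_rw [e]
  rw [integral_const_mul, integral_comp_inv_smul_pos ht (fun z => rieszConv α k z * h z),
    ← mul_assoc, ← Real.rpow_add ht]
  congr 2
  ring

lemma rieszForm_comp_add (y : E N) (h k : E N → ℝ) :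
    rieszForm α (fun x => h (x + y)) (fun x => k (x + y)) = rieszForm α h k := by
  have h1 : ∀ x, rieszConv α (fun z => k (z + y)) x = rieszConv α k (x + y) := by
    intro x
    unfold rieszConv
    rw [← integral_add_right_eq_self (fun z => rieszKernel α (x + y - z) * k z) y]
    simp
  unfold rieszForm
  simp_rw [h1]
  exact integral_add_right_eq_self (fun z => rieszConv α k z * h z) y

/-- The `[0, ∞]`-valued Riesz potential. -/
def rieszPot (α : ℝ) (c : E N → ℝ) (x : E N) : ℝ≥0∞ := ∫⁻ y, kerE α (x - y) * ‖c y‖ₑ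

/-- Duality: by Hardy–Littlewood–Sobolev, pairing with the potential of c is bounded on L^p, so this
potential lies in L^q with q = p/(p-1). Truncations make the usual choice of test function
legitimate, and Fatou removes them. -/
lemma lintegral_rieszPot_rpow_lt_top (hN : 0 < N) (hα0 : 0 < α) (hαN : α < N) {c : E N → ℝ}
    (hc : MemLp c (hlsExpE N α)) :
    AEMeasurable (rieszPot α c) ∧
      ∫⁻ x, rieszPot α c x ^ (hlsExp N α / (hlsExp N α - 1)) < ⊤ := by
  obtain ⟨C, hC, hH⟩ := exists_hls hN hα0 hαN
  have hp1 := one_lt_hlsExp hα0 hαN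
  have hp := hlsExp_pos hN hα0
  have hcn := eLpNorm_hlsExpE hN hα0 c
  set p := hlsExp N α with hpdef
  set q := p / (p - 1) with hq
  have hp1' : 0 < p - 1 := by linarith
  have hq1 : p * (q - 1) = q := by
    rw [hq]
    field_simp
    ring
  have hq0 : 0 < q := by positivity
  have hq1' : 0 < q - 1 := by
    rw [hq, sub_pos, lt_div_iff₀ hp1']
    linarith
  have hmeas : AEMeasurable (rieszPot α c) := by
    have : AEMeasurable (fun z : E N × E N => kerE α (z.1 - z.2) * ‖c z.2‖ₑ)
        (volume.prod volume) :=
      (measurable_kerE.comp (by fun_prop)).aemeasurable.mul hc.1.comp_snd.enorm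
    exact this.lintegral_prod_right'
  refine ⟨hmeas, ?_⟩
  set G := rieszPot α c with hG
  set C' := C * eLpNorm c (hlsExpE N α) volume with hC'
  have hC'top : C' ≠ ⊤ := ENNReal.mul_ne_top hC hc.2.ne
  have dual : ∀ φ : E N → ℝ≥0∞, AEMeasurable φ →
      ∫⁻ x, G x * φ x ≤ C' * (∫⁻ x, φ x ^ p) ^ (1 / p) := by
    intro φ hφ
    have := hH φ (fun x => ‖c x‖ₑ) hφ hc.1.enorm
    rw [hC', hcn]
    refine le_trans (le_of_eq ?_) (this.trans (le_of_eq (by ring)))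
    refine lintegral_congr fun x => ?_
    rw [hG, rieszPot, ← lintegral_mul_const'']
    · refine lintegral_congr fun y => by ring
    · exact (measurable_kerE.comp (by fun_prop)).aemeasurable.mul hc.1.enorm
  -- truncations
  set T : ℕ → E N → ℝ≥0∞ := fun n => (Metric.ball (0 : E N) n).indicator fun x => min (G x) n
    with hT
  have hTm : ∀ n, AEMeasurable (T n) := fun n =>
    (hmeas.min aemeasurable_const).indicator measurableSet_ball
  have hTle : ∀ n x, T n x ≤ G x := fun n x =>
    indicator_le_self' (fun _ _ => zero_le) x |>.trans (min_le_left _ _)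
  have hTb : ∀ n, ∫⁻ x, T n x ^ q ≤ C' ^ q := by
    intro n
    set I := ∫⁻ x, T n x ^ q with hI
    -- Truncating both the values and the domain makes I finite, which is what permits dividing by a
    -- power of I below.
    have hIfin : I ≠ ⊤ := by
      have : I ≤ ∫⁻ x in Metric.ball (0 : E N) n, (n : ℝ≥0∞) ^ q := by
        rw [← lintegral_indicator measurableSet_ball]
        refine lintegral_mono fun x => ?_
        by_cases hx : x ∈ Metric.ball (0 : E N) n
        · simp only [hT, indicator_of_mem hx]
          gcongr
          exact min_le_right _ _
        · simp [hT, indicator_of_notMem hx, hq0]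
      rw [setLIntegral_const] at this
      refine ne_top_of_le_ne_top (ENNReal.mul_ne_top (by finiteness) ?_) this
      exact measure_ball_lt_top.ne
    -- The test function is T^(q-1); since p(q-1) = q, its p-th power is again T^q.
    have h1 : I ≤ C' * I ^ (1 / p) := by
      have := dual (fun x => T n x ^ (q - 1)) ((hTm n).pow_const _)
      simp_rw [← ENNReal.rpow_mul, mul_comm (q - 1) p, hq1] at this
      refine le_trans (lintegral_mono fun x => ?_) this
      calc T n x ^ q = T n x * T n x ^ (q - 1) := by
            nth_rewrite 2 [← ENNReal.rpow_one (T n x)]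
            rw [← ENNReal.rpow_add_of_nonneg _ _ (by norm_num) hq1'.le]
            congr 1
            ring
        _ ≤ _ := by
            gcongr
            exact hTle n x
    rcases eq_or_ne I 0 with h0 | h0
    · rw [h0]
      exact zero_le
    have h2 : I ^ (1 / q) ≤ C' := by
      have e : I = I ^ (1 / q) * I ^ (1 / p) := by
        rw [← ENNReal.rpow_add _ _ h0 hIfin]
        have : 1 / q + 1 / p = 1 := by
          rw [hq]
          field_simp
          ring
        rw [this, ENNReal.rpow_one]
      nth_rewrite 1 [e] at h1
      refine (ENNReal.mul_le_mul_iff_left ?_ ?_).1 h1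
      · simp [ENNReal.rpow_eq_zero_iff, h0, hIfin]
      · exact ENNReal.rpow_ne_top_of_nonneg (by positivity) hIfin
    calc I = (I ^ (1 / q)) ^ q := by
          rw [← ENNReal.rpow_mul, one_div_mul_cancel hq0.ne', ENNReal.rpow_one]
      _ ≤ C' ^ q := by gcongr
  have hlim : ∀ x, Tendsto (fun n => T n x ^ q) atTop (𝓝 (G x ^ q)) := by
    intro x
    refine (ENNReal.continuous_rpow_const.tendsto _).comp ?_
    have h1 : Tendsto (fun n : ℕ => min (G x) (n : ℝ≥0∞)) atTop (𝓝 (min (G x) ⊤)) :=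
      tendsto_const_nhds.min ENNReal.tendsto_nat_nhds_top
    rw [min_eq_left le_top] at h1
    refine h1.congr' ?_
    filter_upwards [eventually_gt_atTop (Nat.ceil ‖x‖)] with n hn
    have : x ∈ Metric.ball (0 : E N) n := by
      rw [mem_ball_zero_iff]
      exact (Nat.le_ceil _).trans_lt (by exact_mod_cast hn)
    simp only [hT, indicator_of_mem this]
  have hle : ∫⁻ x, G x ^ q ≤ C' ^ q := by
    calc ∫⁻ x, G x ^ q = ∫⁻ x, liminf (fun n => T n x ^ q) atTop :=
          lintegral_congr fun x => ((hlim x).liminf_eq).symm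
      _ ≤ liminf (fun n => ∫⁻ x, T n x ^ q) atTop :=
          lintegral_liminf_le' fun n => (hTm n).pow_const _
      _ ≤ C' ^ q := by
          refine liminf_le_of_le (by isBoundedDefault) fun b hb => ?_
          obtain ⟨n, hn⟩ := hb.exists
          exact hn.trans (hTb n)
  exact hle.trans_lt (by finiteness)

/-- A sequence bounded in `L^{2N/(N+α)}` that tends to `0` almost everywhere has vanishing
interaction with every fixed function of that space. -/
lemma tendsto_rieszForm_of_ae_tendsto_zero (hN : 0 < N) (hα0 : 0 < α) (hαN : α < N)
    {b : ℕ → E N → ℝ} {c : E N → ℝ} (hb : ∀ n, MemLp (b n) (hlsExpE N α))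
    (hc : MemLp c (hlsExpE N α)) {M : ℝ≥0∞} (hM : M ≠ ⊤)
    (hbM : ∀ n, ∫⁻ x, ‖b n x‖ₑ ^ hlsExp N α ≤ M)
    (hlim : ∀ᵐ x, Tendsto (fun n => b n x) atTop (𝓝 0)) :
    Tendsto (fun n => rieszForm α (b n) c) atTop (𝓝 0) := by
  obtain ⟨hGm, hGq⟩ := lintegral_rieszPot_rpow_lt_top hN hα0 hαN hc
  have hp1 := one_lt_hlsExp hα0 hαN
  have hp := hlsExp_pos hN hα0
  set p := hlsExp N α with hpdef
  set q := p / (p - 1) with hq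
  set G := rieszPot α c with hG
  have hp1' : 0 < p - 1 := by linarith
  have hq0 : 0 < q := by positivity
  have hq1' : 0 < q - 1 := by
    rw [hq, sub_pos, lt_div_iff₀ hp1']
    linarith
  have hqp : (q - 1) * (p - 1) = 1 := by
    rw [hq]
    field_simp
    ring
  have hbd : ∀ n, ‖rieszForm α (b n) c‖ₑ ≤ ∫⁻ x, G x * ‖b n x‖ₑ := by
    intro n
    refine (enorm_rieszForm_le _ _).trans (le_of_eq ?_)
    refine lintegral_congr fun x => ?_
    rw [hG, rieszPot, ← lintegral_mul_const'']
    · refine lintegral_congr fun y => ?_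
      simp only [rieszProd, enorm_mul, kerE]
      rw [Real.enorm_eq_ofReal (rieszKernel_nonneg hα0 hαN _)]
    · exact (measurable_kerE.comp (by fun_prop)).aemeasurable.mul hc.1.enorm
  -- Cut |b_n| at the height L G^(q-1). Below it the product with G is dominated by the integrable L
  -- G^q. Above it, (q-1)(p-1) = 1 gives G ≤ (|b_n|/L)^(p-1), and the contribution is at most
  -- L^(-(p-1)) |b_n|^p, small uniformly in n for large L.
  have split : ∀ (L : ℝ≥0∞), L ≠ 0 → L ≠ ⊤ → ∀ n x, G x * ‖b n x‖ₑ
      ≤ G x * min ‖b n x‖ₑ (L * G x ^ (q - 1)) + L⁻¹ ^ (p - 1) * ‖b n x‖ₑ ^ p := by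
    intro L hL0 hL1 n x
    rcases le_total ‖b n x‖ₑ (L * G x ^ (q - 1)) with h | h
    · rw [min_eq_left h]
      exact le_self_add
    · refine le_trans ?_ le_add_self
      have h1 : G x ^ (q - 1) ≤ L⁻¹ * ‖b n x‖ₑ := by
        rw [← ENNReal.div_eq_inv_mul, ENNReal.le_div_iff_mul_le (Or.inl hL0) (Or.inl hL1), mul_comm]
        exact h
      have h2 : G x ≤ L⁻¹ ^ (p - 1) * ‖b n x‖ₑ ^ (p - 1) := by
        calc G x = (G x ^ (q - 1)) ^ (p - 1) := by
              rw [← ENNReal.rpow_mul, hqp, ENNReal.rpow_one]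
          _ ≤ (L⁻¹ * ‖b n x‖ₑ) ^ (p - 1) := by gcongr
          _ = _ := ENNReal.mul_rpow_of_nonneg _ _ hp1'.le
      calc G x * ‖b n x‖ₑ ≤ L⁻¹ ^ (p - 1) * ‖b n x‖ₑ ^ (p - 1) * ‖b n x‖ₑ := by gcongr
        _ = L⁻¹ ^ (p - 1) * ‖b n x‖ₑ ^ p := by
            rw [mul_assoc]
            congr 1
            nth_rewrite 2 [← ENNReal.rpow_one ‖b n x‖ₑ]
            rw [← ENNReal.rpow_add_of_nonneg _ _ hp1'.le (by norm_num)]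
            congr 1
            ring
  have main : ∀ (L : ℝ≥0∞), L ≠ 0 → L ≠ ⊤ →
      Tendsto (fun n => ∫⁻ x, G x * min ‖b n x‖ₑ (L * G x ^ (q - 1))) atTop (𝓝 0) := by
    intro L hL0 hL1
    have hdom : ∀ x, L * G x ^ q = G x * (L * G x ^ (q - 1)) := by
      intro x
      rw [mul_left_comm]
      congr 1
      nth_rewrite 2 [← ENNReal.rpow_one (G x)]
      rw [← ENNReal.rpow_add_of_nonneg _ _ (by norm_num) hq1'.le]
      congr 1
      ring
    have := tendsto_lintegral_of_dominated_convergence' (μ := (volume : Measure (E N)))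
      (F := fun n x => G x * min ‖b n x‖ₑ (L * G x ^ (q - 1))) (f := fun _ => 0)
      (fun x => L * G x ^ q) (fun n => ?_) (fun n => Eventually.of_forall fun x => ?_) ?_ ?_
    · simpa using this
    · exact hGm.mul ((hb n).1.enorm.min ((hGm.pow_const _).const_mul _))
    · simp only
      rw [hdom]
      gcongr
      exact min_le_right _ _
    · rw [lintegral_const_mul' _ _ hL1]
      exact ENNReal.mul_ne_top hL1 hGq.ne
    · have hfin : ∀ᵐ x, G x ^ q < ⊤ := ae_lt_top' (hGm.pow_const _) hGq.ne
      filter_upwards [hlim, hfin] with x hx hx'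
      have hGx : G x ≠ ⊤ := fun h => by
        rw [h, ENNReal.top_rpow_of_pos hq0] at hx'
        exact hx'.ne rfl
      have h1 : Tendsto (fun n => G x * ‖b n x‖ₑ) atTop (𝓝 (G x * 0)) := by
        refine ENNReal.Tendsto.const_mul ?_ (Or.inr hGx)
        simpa using hx.enorm
      rw [mul_zero] at h1
      refine tendsto_of_tendsto_of_tendsto_of_le_of_le tendsto_const_nhds h1 (fun _ => zero_le)
        fun n => ?_
      simp only
      gcongr
      exact min_le_left _ _
  rw [tendsto_zero_iff_enorm_tendsto_zero, ENNReal.tendsto_nhds_zero]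
  intro ε hε
  -- choose the truncation level
  obtain ⟨L, hL0, hL1, hL⟩ : ∃ L : ℝ≥0∞, L ≠ 0 ∧ L ≠ ⊤ ∧ L⁻¹ ^ (p - 1) * M ≤ ε / 2 := by
    have ht : Tendsto (fun n : ℕ => ((n : ℝ≥0∞))⁻¹ ^ (p - 1) * M) atTop (𝓝 (0 ^ (p - 1) * M)) := by
      refine ENNReal.Tendsto.mul_const ?_ (Or.inr hM)
      exact (ENNReal.continuous_rpow_const.tendsto _).comp ENNReal.tendsto_inv_nat_nhds_zero
    rw [ENNReal.zero_rpow_of_pos hp1', zero_mul] at ht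
    have hε2 : 0 < ε / 2 := ENNReal.half_pos hε.ne'
    obtain ⟨n, hn, hn0⟩ := ((ht.eventually (ge_mem_nhds hε2)).and (eventually_gt_atTop 0)).exists
    exact ⟨n, by simpa using hn0.ne', by finiteness, hn⟩
  have hε2 : 0 < ε / 2 := ENNReal.half_pos hε.ne'
  filter_upwards [(main L hL0 hL1).eventually (ge_mem_nhds hε2)] with n hn
  calc ‖rieszForm α (b n) c‖ₑ ≤ ∫⁻ x, G x * ‖b n x‖ₑ := hbd n
    _ ≤ ∫⁻ x, (G x * min ‖b n x‖ₑ (L * G x ^ (q - 1)) + L⁻¹ ^ (p - 1) * ‖b n x‖ₑ ^ p) :=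
        lintegral_mono fun x => split L hL0 hL1 n x
    _ = (∫⁻ x, G x * min ‖b n x‖ₑ (L * G x ^ (q - 1))) + L⁻¹ ^ (p - 1) * ∫⁻ x, ‖b n x‖ₑ ^ p := by
        rw [lintegral_add_right' _ (((hb n).1.enorm.pow_const _).const_mul _),
          lintegral_const_mul'' _ ((hb n).1.enorm.pow_const _)]
    _ ≤ ε / 2 + ε / 2 := by
        refine add_le_add hn (le_trans ?_ hL)
        gcongr
        exact hbM n
    _ = ε := ENNReal.add_halves ε

end BilinearForm

/-! ### H¹ functions with an explicit gradient: uniqueness, algebra, dilations and translations. -/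

section SobolevSpace

variable {N : ℕ}

/-- `u ∈ L²` with weak gradient `g ∈ L²`. -/
structure IsH1 (u : E N → ℝ) (g : E N → E N) : Prop where
  memLp : MemLp u 2
  memLp_grad : MemLp g 2
  integral_eq : ∀ φ : E N → ℝ, ContDiff ℝ ∞ φ → HasCompactSupport φ → ∀ v : E N,
    ∫ x, u x * fderiv ℝ φ x v = -∫ x, inner ℝ (g x) v * φ x

lemma locallyIntegrable_of_memLp {F : Type*} [NormedAddCommGroup F] {u : E N → F}
    (hu : MemLp u 2) : LocallyIntegrable u :=
  hu.locallyIntegrable (by norm_num)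

lemma IsH1.hasWeakGradient {u : E N → ℝ} {g : E N → E N} (h : IsH1 u g) : HasWeakGradient u g :=
  ⟨locallyIntegrable_of_memLp h.memLp, locallyIntegrable_of_memLp h.memLp_grad, h.integral_eq⟩

lemma IsH1.memH1 {u : E N → ℝ} {g : E N → E N} (h : IsH1 u g) : MemH1 u :=
  ⟨h.memLp, g, h.hasWeakGradient, h.memLp_grad⟩

/-- The fundamental lemma of the calculus of variations, applied after pairing with a fixed
direction. It allows any explicit gradient to replace the chosen representative `weakGradient` under
integrals. -/
lemma HasWeakGradient.unique {u : E N → ℝ} {g g' : E N → E N} (h : HasWeakGradient u g)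
    (h' : HasWeakGradient u g') : g =ᵐ[volume] g' := by
  refine ae_eq_of_integral_contDiff_smul_eq h.2.1 h'.2.1 fun φ hφ hc => ?_
  have i1 : Integrable fun x => φ x • g x :=
    h.2.1.integrable_smul_left_of_hasCompactSupport hφ.continuous hc
  have i2 : Integrable fun x => φ x • g' x :=
    h'.2.1.integrable_smul_left_of_hasCompactSupport hφ.continuous hc
  refine ext_inner_left ℝ fun v => ?_
  rw [← integral_inner i1, ← integral_inner i2]
  have e1 := h.2.2 φ hφ hc v
  have e2 := h'.2.2 φ hφ hc v
  rw [e1] at e2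
  have : ∀ g : E N → E N, (fun x => inner ℝ v (φ x • g x)) = fun x => inner ℝ (g x) v * φ x := by
    intro g
    ext x
    rw [inner_smul_right, real_inner_comm, mul_comm]
  rw [this, this]
  linarith

lemma HasWeakGradient.weakGradient_ae_eq {u : E N → ℝ} {g : E N → E N} (h : HasWeakGradient u g) :
    weakGradient u =ᵐ[volume] g := by
  have hex : ∃ g, HasWeakGradient u g := ⟨g, h⟩
  unfold weakGradient
  rw [dif_pos hex]
  exact hex.choose_spec.unique h

lemma IsH1.weakGradient_ae_eq {u : E N → ℝ} {g : E N → E N} (h : IsH1 u g) :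
    weakGradient u =ᵐ[volume] g :=
  h.hasWeakGradient.weakGradient_ae_eq

lemma MemH1.isH1 {u : E N → ℝ} (h : MemH1 u) : IsH1 u (weakGradient u) := by
  obtain ⟨h1, g, h2, h3⟩ := h
  have hex : ∃ g, HasWeakGradient u g := ⟨g, h2⟩
  have e := h2.weakGradient_ae_eq
  refine ⟨h1, h3.ae_eq e.symm, ?_⟩
  unfold weakGradient
  rw [dif_pos hex]
  exact hex.choose_spec.2.2

lemma memLp_fderiv_apply {φ : E N → ℝ} (hφ : ContDiff ℝ ∞ φ) (hc : HasCompactSupport φ) (v : E N) :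
    MemLp (fun x => fderiv ℝ φ x v) 2 := by
  have h1 : Continuous fun x => fderiv ℝ φ x v :=
    (hφ.continuous_fderiv (by simp)).clm_apply continuous_const
  have h2 : HasCompactSupport fun x => fderiv ℝ φ x v := (hc.fderiv_apply ℝ v)
  exact h1.memLp_of_hasCompactSupport h2

lemma memLp_testFunction {φ : E N → ℝ} (hφ : ContDiff ℝ ∞ φ) (hc : HasCompactSupport φ) :
    MemLp φ 2 :=
  hφ.continuous.memLp_of_hasCompactSupport hc

lemma integrable_mul_of_memLp_two {u w : E N → ℝ} (hu : MemLp u 2) (hw : MemLp w 2) :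
    Integrable fun x => u x * w x :=
  hu.integrable_mul hw

lemma integrable_inner_of_memLp_two {g h : E N → E N} (hg : MemLp g 2) (hh : MemLp h 2) :
    Integrable fun x => inner ℝ (g x) (h x) := by
  have := L2.integrable_inner (𝕜 := ℝ) hg.toLp hh.toLp
  refine this.congr ?_
  filter_upwards [hg.coeFn_toLp, hh.coeFn_toLp] with x h1 h2
  rw [h1, h2]

lemma memLp_inner_const {g : E N → E N} (hg : MemLp g 2) (v : E N) :
    MemLp (fun x => inner ℝ (g x) v) 2 :=
  hg.inner_const v

lemma IsH1.congr {u u' : E N → ℝ} {g g' : E N → E N} (h : IsH1 u g) (e : u =ᵐ[volume] u')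
    (e' : g =ᵐ[volume] g') : IsH1 u' g' := by
  refine ⟨h.memLp.ae_eq e, h.memLp_grad.ae_eq e', fun φ hφ hc v => ?_⟩
  have h1 : ∫ x, u' x * fderiv ℝ φ x v = ∫ x, u x * fderiv ℝ φ x v :=
    integral_congr_ae (by filter_upwards [e] with x hx; rw [hx])
  have h2 : ∫ x, inner ℝ (g' x) v * φ x = ∫ x, inner ℝ (g x) v * φ x :=
    integral_congr_ae (by filter_upwards [e'] with x hx; rw [hx])
  rw [h1, h2, h.integral_eq φ hφ hc v]

lemma IsH1.add {u w : E N → ℝ} {g k : E N → E N} (hu : IsH1 u g) (hw : IsH1 w k) :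
    IsH1 (fun x => u x + w x) (fun x => g x + k x) := by
  refine ⟨hu.memLp.add hw.memLp, hu.memLp_grad.add hw.memLp_grad, fun φ hφ hc v => ?_⟩
  simp_rw [inner_add_left, add_mul]
  have d := memLp_fderiv_apply hφ hc v
  have t := memLp_testFunction hφ hc
  rw [integral_add (integrable_mul_of_memLp_two hu.memLp d) (integrable_mul_of_memLp_two hw.memLp d),
    integral_add (integrable_mul_of_memLp_two (memLp_inner_const hu.memLp_grad v) t)
      (integrable_mul_of_memLp_two (memLp_inner_const hw.memLp_grad v) t),
    hu.integral_eq φ hφ hc v, hw.integral_eq φ hφ hc v]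
  ring

lemma IsH1.const_mul {u : E N → ℝ} {g : E N → E N} (hu : IsH1 u g) (c : ℝ) :
    IsH1 (fun x => c * u x) (fun x => c • g x) := by
  refine ⟨hu.memLp.const_mul c, hu.memLp_grad.const_smul c, fun φ hφ hc v => ?_⟩
  simp_rw [inner_smul_left, mul_assoc]
  rw [integral_const_mul, integral_const_mul, hu.integral_eq φ hφ hc v]
  simp

lemma IsH1.sub {u w : E N → ℝ} {g k : E N → E N} (hu : IsH1 u g) (hw : IsH1 w k) :
    IsH1 (fun x => u x - w x) (fun x => g x - k x) := by
  have := hu.add (hw.const_mul (-1))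
  refine this.congr (Eventually.of_forall fun x => by simp [sub_eq_add_neg])
    (Eventually.of_forall fun x => by simp [sub_eq_add_neg])

lemma memLp_comp_smul {F : Type*} [NormedAddCommGroup F] {u : E N → F} {t : ℝ} (ht : t ≠ 0)
    (hu : MemLp u 2) : MemLp (fun x => u (t • x)) 2 := by
  have h2 : Measure.map (t • ·) (volume : Measure (E N)) = _ :=
    Measure.map_addHaar_smul volume ht
  have h3 : MemLp u 2 (Measure.map (t • ·) (volume : Measure (E N))) := by
    rw [h2]
    exact hu.smul_measure ENNReal.ofReal_ne_top
  exact h3.comp_of_map (by fun_prop)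

/-- The change of variables moves the dilation to the test function: the defining identity for u is
used with y ↦ φ(ty). -/
lemma IsH1.comp_inv_smul {u : E N → ℝ} {g : E N → E N} (hu : IsH1 u g) {t : ℝ} (ht : 0 < t) :
    IsH1 (dilate t u) (fun x => t⁻¹ • g (t⁻¹ • x)) := by
  have ht' : t⁻¹ ≠ 0 := by positivity
  refine ⟨memLp_comp_smul ht' hu.memLp, (memLp_comp_smul ht' hu.memLp_grad).const_smul t⁻¹,
    fun φ hφ hc v => ?_⟩
  have hψ : ContDiff ℝ ∞ fun y => φ (t • y) := hφ.comp (contDiff_const_smul t)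
  have hψc : HasCompactSupport fun y => φ (t • y) :=
    hc.comp_homeomorph (Homeomorph.smulOfNeZero t ht.ne')
  have key := hu.integral_eq _ hψ hψc v
  have hd : ∀ y, fderiv ℝ (fun y => φ (t • y)) y v = t * fderiv ℝ φ (t • y) v := by
    intro y
    rw [fderiv_comp_smul]
    simp
  simp_rw [hd] at key
  have e1 : ∀ x, dilate t u x * fderiv ℝ φ x v
      = (fun y => u y * fderiv ℝ φ (t • y) v) (t⁻¹ • x) := by
    intro x
    simp [dilate, smul_inv_smul₀ ht.ne']
  have e2 : ∀ x, inner ℝ (t⁻¹ • g (t⁻¹ • x)) v * φ x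
      = t⁻¹ * (fun y => inner ℝ (g y) v * φ (t • y)) (t⁻¹ • x) := by
    intro x
    simp [inner_smul_left, smul_inv_smul₀ ht.ne', mul_assoc]
  simp_rw [e1, e2]
  rw [integral_const_mul, integral_comp_inv_smul_pos ht (fun y => u y * fderiv ℝ φ (t • y) v),
    integral_comp_inv_smul_pos ht (fun y => inner ℝ (g y) v * φ (t • y))]
  simp_rw [mul_left_comm _ t] at key
  rw [integral_const_mul] at key
  have : ∫ x, inner ℝ (g x) v * φ (t • x) = - (t * ∫ x, u x * fderiv ℝ φ (t • x) v) := by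
    rw [key, neg_neg]
  rw [this]
  field_simp

lemma memLp_comp_add {F : Type*} [NormedAddCommGroup F] {u : E N → F} (y : E N)
    (hu : MemLp u 2) : MemLp (fun x => u (x + y)) 2 :=
  hu.comp_measurePreserving (measurePreserving_add_right volume y)

lemma IsH1.comp_add {u : E N → ℝ} {g : E N → E N} (hu : IsH1 u g) (y : E N) :
    IsH1 (fun x => u (x + y)) (fun x => g (x + y)) := by
  refine ⟨memLp_comp_add y hu.memLp, memLp_comp_add y hu.memLp_grad, fun φ hφ hc v => ?_⟩
  have hψ : ContDiff ℝ ∞ fun z => φ (z - y) := hφ.comp (contDiff_id.sub contDiff_const)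
  have hψc : HasCompactSupport fun z => φ (z - y) :=
    hc.comp_homeomorph (Homeomorph.subRight y)
  have key := hu.integral_eq _ hψ hψc v
  simp_rw [fderiv_comp_sub] at key
  rw [← integral_add_right_eq_self (fun x => u x * fderiv ℝ φ (x - y) v) y,
    ← integral_add_right_eq_self (fun x => inner ℝ (g x) v * φ (x - y)) y] at key
  simpa using key

lemma IsH1.of_contDiff {u : E N → ℝ} (hu : ContDiff ℝ 1 u) (hc : HasCompactSupport u) :
    IsH1 u (gradient u) := by
  have hgc : Continuous (gradient u) := by
    unfold gradient
    exact (InnerProductSpace.toDual ℝ (E N)).symm.continuous.comp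
      (hu.continuous_fderiv (by simp))
  have hgs : HasCompactSupport (gradient u) := by
    unfold gradient
    exact (hc.fderiv ℝ).comp_left (g := (InnerProductSpace.toDual ℝ (E N)).symm) (by simp)
  refine ⟨hu.continuous.memLp_of_hasCompactSupport hc, hgc.memLp_of_hasCompactSupport hgs,
    fun φ hφ hφc v => ?_⟩
  have e : ∀ x, inner ℝ (gradient u x) v = fderiv ℝ u x v := by
    intro x
    unfold gradient
    simp
  simp_rw [e]
  have hφ1 : ContDiff ℝ 1 φ := hφ.of_le (by simp)
  have c1 : Continuous fun x => fderiv ℝ u x v :=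
    (hu.continuous_fderiv (by simp)).clm_apply continuous_const
  have c2 : Continuous fun x => fderiv ℝ φ x v :=
    (hφ1.continuous_fderiv (by simp)).clm_apply continuous_const
  refine integral_mul_fderiv_eq_neg_fderiv_mul_of_integrable ?_ ?_ ?_ ?_ ?_
  · exact (c1.mul hφ.continuous).integrable_of_hasCompactSupport hφc.mul_left
  · exact (hu.continuous.mul c2).integrable_of_hasCompactSupport hc.mul_right
  · exact (hu.continuous.mul hφ.continuous).integrable_of_hasCompactSupport hφc.mul_left
  · exact fun x _ => (hu.differentiable (by simp)) x
  · exact fun x _ => (hφ1.differentiable (by simp)) x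

/-- The `L²` norm squared of the gradient. -/
def gradSq (u : E N → ℝ) : ℝ := ∫ x, ‖weakGradient u x‖ ^ 2

/-- The `L²` norm squared. -/
def massSq (u : E N → ℝ) : ℝ := ∫ x, u x ^ 2

lemma gradSq_nonneg (u : E N → ℝ) : 0 ≤ gradSq u := integral_nonneg fun _ => by positivity

lemma massSq_nonneg (u : E N → ℝ) : 0 ≤ massSq u := integral_nonneg fun _ => by positivity

lemma IsH1.gradSq_eq {u : E N → ℝ} {g : E N → E N} (h : IsH1 u g) :
    gradSq u = ∫ x, ‖g x‖ ^ 2 := by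
  refine integral_congr_ae ?_
  filter_upwards [h.weakGradient_ae_eq] with x hx
  rw [hx]

lemma IsH1.gradSq_dilate {u : E N → ℝ} {g : E N → E N} (h : IsH1 u g) {t : ℝ} (ht : 0 < t) :
    gradSq (dilate t u) = t ^ ((N : ℝ) - 2) * gradSq u := by
  rw [(h.comp_inv_smul ht).gradSq_eq, h.gradSq_eq]
  have e : ∀ x, ‖t⁻¹ • g (t⁻¹ • x)‖ ^ 2 = t ^ (-2 : ℝ) * (fun y => ‖g y‖ ^ 2) (t⁻¹ • x) := by
    intro x
    rw [norm_smul, mul_pow, Real.norm_of_nonneg (by positivity), Real.rpow_neg ht.le]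
    norm_num
  simp_rw [e]
  rw [integral_const_mul, integral_comp_inv_smul_pos ht (fun y => ‖g y‖ ^ 2), ← mul_assoc,
    ← Real.rpow_add ht]
  congr 2
  ring

lemma MemH1.dilate {u : E N → ℝ} (h : MemH1 u) {t : ℝ} (ht : 0 < t) : MemH1 (dilate t u) :=
  (h.isH1.comp_inv_smul ht).memH1

lemma MemH1.gradSq_dilate {u : E N → ℝ} (h : MemH1 u) {t : ℝ} (ht : 0 < t) :
    gradSq (Choquard.dilate t u) = t ^ ((N : ℝ) - 2) * gradSq u :=
  h.isH1.gradSq_dilate ht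

lemma integral_mul_dilate_sq {t : ℝ} (ht : 0 < t) (Q u : E N → ℝ) :
    ∫ x, Q x * dilate t u x ^ 2 = t ^ (N : ℝ) * ∫ x, Q (t • x) * u x ^ 2 := by
  rw [← integral_comp_inv_smul_pos ht (fun x => Q (t • x) * u x ^ 2)]
  simp [dilate, smul_inv_smul₀ ht.ne']

lemma MemH1.comp_add {u : E N → ℝ} (h : MemH1 u) (y : E N) : MemH1 fun x => u (x + y) :=
  (h.isH1.comp_add y).memH1

lemma MemH1.gradSq_comp_add {u : E N → ℝ} (h : MemH1 u) (y : E N) :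
    gradSq (fun x => u (x + y)) = gradSq u := by
  rw [(h.isH1.comp_add y).gradSq_eq]
  exact integral_add_right_eq_self (fun x => ‖weakGradient u x‖ ^ 2) y

lemma massSq_comp_add (u : E N → ℝ) (y : E N) : massSq (fun x => u (x + y)) = massSq u :=
  integral_add_right_eq_self (fun x => u x ^ 2) y

lemma MemH1.add {u w : E N → ℝ} (hu : MemH1 u) (hw : MemH1 w) : MemH1 fun x => u x + w x :=
  (hu.isH1.add hw.isH1).memH1

lemma MemH1.sub {u w : E N → ℝ} (hu : MemH1 u) (hw : MemH1 w) : MemH1 fun x => u x - w x :=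
  (hu.isH1.sub hw.isH1).memH1

lemma MemH1.const_mul {u : E N → ℝ} (hu : MemH1 u) (c : ℝ) : MemH1 fun x => c * u x :=
  (hu.isH1.const_mul c).memH1

lemma integrable_normSq_of_memLp_two {F : Type*} [NormedAddCommGroup F] {g : E N → F}
    (hg : MemLp g 2) : Integrable fun x => ‖g x‖ ^ 2 :=
  hg.integrable_norm_pow (by norm_num)

lemma MemH1.integrable_sq {u : E N → ℝ} (hu : MemH1 u) : Integrable fun x => u x ^ 2 := by
  simpa using integrable_normSq_of_memLp_two hu.1

lemma MemH1.integrable_grad {u : E N → ℝ} (hu : MemH1 u) :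
    Integrable fun x => ‖weakGradient u x‖ ^ 2 :=
  integrable_normSq_of_memLp_two hu.isH1.memLp_grad

lemma MemH1.gradSq_add {u w : E N → ℝ} (hu : MemH1 u) (hw : MemH1 w) :
    gradSq (fun x => u x + w x) = gradSq u + gradSq w
      + 2 * ∫ x, inner ℝ (weakGradient u x) (weakGradient w x) := by
  rw [(hu.isH1.add hw.isH1).gradSq_eq]
  simp_rw [norm_add_sq_real]
  have hi := integrable_inner_of_memLp_two hu.isH1.memLp_grad hw.isH1.memLp_grad
  have hi2 : Integrable fun x => ‖weakGradient u x‖ ^ 2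
      + 2 * inner ℝ (weakGradient u x) (weakGradient w x) := hu.integrable_grad.add (hi.const_mul 2)
  rw [integral_add hi2 hw.integrable_grad,
    integral_add hu.integrable_grad (hi.const_mul 2), integral_const_mul]
  simp only [gradSq]
  ring

lemma MemH1.gradSq_const_mul {u : E N → ℝ} (hu : MemH1 u) (c : ℝ) :
    gradSq (fun x => c * u x) = c ^ 2 * gradSq u := by
  rw [(hu.isH1.const_mul c).gradSq_eq, gradSq, ← integral_const_mul]
  simp_rw [norm_smul, mul_pow, Real.norm_eq_abs, sq_abs]

lemma MemH1.integral_inner_const_mul {u w : E N → ℝ} (hw : MemH1 w) (c : ℝ) :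
    ∫ x, inner ℝ (weakGradient u x) (weakGradient (fun x => c * w x) x)
      = c * ∫ x, inner ℝ (weakGradient u x) (weakGradient w x) := by
  rw [← integral_const_mul]
  refine integral_congr_ae ?_
  filter_upwards [(hw.isH1.const_mul c).weakGradient_ae_eq] with x hx
  rw [hx, inner_smul_right]

/-- Closedness of the weak gradient under weak limits. -/
lemma IsH1.of_tendsto {u : ℕ → E N → ℝ} {g : ℕ → E N → E N} {u₀ : E N → ℝ} {g₀ : E N → E N}
    (h : ∀ n, IsH1 (u n) (g n)) (hu₀ : MemLp u₀ 2) (hg₀ : MemLp g₀ 2)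
    (hu : ∀ w : E N → ℝ, MemLp w 2 → Tendsto (fun n => ∫ x, u n x * w x) atTop
      (𝓝 (∫ x, u₀ x * w x)))
    (hg : ∀ w : E N → E N, MemLp w 2 → Tendsto (fun n => ∫ x, inner ℝ (g n x) (w x)) atTop
      (𝓝 (∫ x, inner ℝ (g₀ x) (w x)))) : IsH1 u₀ g₀ := by
  refine ⟨hu₀, hg₀, fun φ hφ hc v => ?_⟩
  have h1 := hu _ (memLp_fderiv_apply hφ hc v)
  have h2 := hg (fun x => φ x • v) (by
    have hcont : Continuous fun x => φ x • v := hφ.continuous.smul continuous_const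
    exact hcont.memLp_of_hasCompactSupport hc.smul_right)
  simp_rw [inner_smul_right, mul_comm (φ _)] at h2
  refine tendsto_nhds_unique h1 ?_
  simp_rw [(h _).integral_eq φ hφ hc v]
  exact h2.neg

end SobolevSpace

/-! ### Mollification in H¹ and approximation by compactly supported C¹ functions. -/

section Mollification

variable {N : ℕ}

/-- Cauchy–Schwarz after writing w f as √w · (√w f); a Jensen inequality for a weight of total mass
at most one. -/
lemma sq_lintegral_mul_le {X : Type*} [MeasurableSpace X] {μ : Measure X} {w f : X → ℝ≥0∞}
    (hw : AEMeasurable w μ) (hf : AEMeasurable f μ) (h1 : ∫⁻ x, w x ∂μ ≤ 1) :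
    (∫⁻ x, w x * f x ∂μ) ^ 2 ≤ ∫⁻ x, w x * f x ^ 2 ∂μ := by
  have hc : Real.HolderConjugate 2 2 := Real.HolderConjugate.two_two
  have h := ENNReal.lintegral_mul_le_Lp_mul_Lq μ hc (f := fun x => w x ^ (1 / 2 : ℝ))
    (g := fun x => w x ^ (1 / 2 : ℝ) * f x) (hw.pow_const _) ((hw.pow_const _).mul hf)
  have e1 : ∀ x, w x ^ (1 / 2 : ℝ) * (w x ^ (1 / 2 : ℝ) * f x) = w x * f x := by
    intro x
    rw [← mul_assoc, ← ENNReal.rpow_add_of_nonneg _ _ (by norm_num) (by norm_num)]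
    norm_num
  have e2 : ∀ x, (w x ^ (1 / 2 : ℝ)) ^ (2 : ℝ) = w x := by
    intro x
    rw [← ENNReal.rpow_mul]
    norm_num
  have e3 : ∀ x, (w x ^ (1 / 2 : ℝ) * f x) ^ (2 : ℝ) = w x * f x ^ 2 := by
    intro x
    rw [ENNReal.mul_rpow_of_nonneg _ _ (by norm_num), e2]
    norm_num
  simp only [Pi.mul_apply, e1, e2, e3] at h
  have h2 : (∫⁻ x, w x ∂μ) ^ (1 / 2 : ℝ) ≤ 1 :=
    ENNReal.rpow_le_one h1 (by norm_num)
  calc (∫⁻ x, w x * f x ∂μ) ^ 2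
      ≤ (1 * (∫⁻ x, w x * f x ^ 2 ∂μ) ^ (1 / 2 : ℝ)) ^ 2 := by
        gcongr
        exact h.trans (by gcongr)
    _ = _ := by
        rw [one_mul, ← ENNReal.rpow_natCast, ← ENNReal.rpow_mul]
        norm_num

lemma lintegral_enorm_sq_eq {X F : Type*} [MeasurableSpace X] {μ : Measure X}
    [NormedAddCommGroup F] (f : X → F) : ∫⁻ x, ‖f x‖ₑ ^ 2 ∂μ = eLpNorm f 2 μ ^ 2 := by
  have := eLpNorm_nnreal_pow_eq_lintegral (f := f) (μ := μ) (p := 2) (by norm_num)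
  simp only [NNReal.coe_ofNat, ENNReal.rpow_ofNat, ENNReal.coe_ofNat] at this
  exact this.symm

/-- Mollification by a normalised bump function. -/
def moll {F : Type*} [NormedAddCommGroup F] [NormedSpace ℝ F] (ρ : ContDiffBump (0 : E N))
    (f : E N → F) : E N → F :=
  ρ.normed volume ⋆[ContinuousLinearMap.lsmul ℝ ℝ, volume] f

variable (ρ : ContDiffBump (0 : E N))

lemma moll_apply {F : Type*} [NormedAddCommGroup F] [NormedSpace ℝ F] (f : E N → F) (x : E N) :
    moll ρ f x = ∫ t, ρ.normed volume t • f (x - t) := by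
  simp [moll, convolution_def]

lemma continuous_normed : Continuous (ρ.normed (volume : Measure (E N))) :=
  (ρ.contDiff_normed (n := 1)).continuous

lemma lintegral_normed : ∫⁻ t, ‖ρ.normed (volume : Measure (E N)) t‖ₑ = 1 := by
  have h := ofReal_integral_eq_lintegral_ofReal (ρ.integrable_normed (μ := (volume : Measure (E N))))
    (Eventually.of_forall ρ.nonneg_normed)
  rw [ρ.integral_normed, ENNReal.ofReal_one] at h
  rw [h]
  exact lintegral_congr fun t => Real.enorm_eq_ofReal (ρ.nonneg_normed t)

lemma contDiff_moll {u : E N → ℝ} (hu : LocallyIntegrable u) : ContDiff ℝ 1 (moll ρ u) :=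
  ρ.hasCompactSupport_normed.contDiff_convolution_left (n := 1) _ ρ.contDiff_normed hu

lemma aestronglyMeasurable_sub_prod {F : Type*} [NormedAddCommGroup F] {f : E N → F}
    (hf : AEStronglyMeasurable f) :
    AEStronglyMeasurable (fun q : E N × E N => f (q.2 - q.1)) (volume.prod volume) := by
  have h : Measure.QuasiMeasurePreserving (fun q : E N × E N => q.2 - q.1)
      (volume.prod volume) volume :=
    (quasiMeasurePreserving_sub_of_right_invariant volume volume).comp
      Measure.measurePreserving_swap.quasiMeasurePreserving
  exact hf.comp_quasiMeasurePreserving h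

lemma aestronglyMeasurable_comp_sub {F : Type*} [NormedAddCommGroup F] {f : E N → F}
    (hf : AEStronglyMeasurable f) (x : E N) :
    AEStronglyMeasurable (fun t : E N => f (x - t)) volume :=
  hf.comp_measurePreserving (Measure.measurePreserving_sub_left volume x)

/-- A mollification averages translates with a weight of mass one: Jensen pointwise, then Tonelli
and translation invariance. -/
lemma eLpNorm_moll_le {F : Type*} [NormedAddCommGroup F] [NormedSpace ℝ F] {f : E N → F}
    (hf : AEStronglyMeasurable f) : eLpNorm (moll ρ f) 2 volume ≤ eLpNorm f 2 volume := by
  rw [← ENNReal.pow_le_pow_left_iff (n := 2) (by norm_num), ← lintegral_enorm_sq_eq,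
    ← lintegral_enorm_sq_eq]
  have hw : AEMeasurable (fun t => ‖ρ.normed (volume : Measure (E N)) t‖ₑ) :=
    (continuous_normed ρ).enorm.aemeasurable
  calc ∫⁻ x, ‖moll ρ f x‖ₑ ^ 2
      ≤ ∫⁻ x, ∫⁻ t, ‖ρ.normed volume t‖ₑ * ‖f (x - t)‖ₑ ^ 2 := by
        refine lintegral_mono fun x => ?_
        have hfx := (aestronglyMeasurable_comp_sub hf x).enorm
        refine le_trans ?_ (sq_lintegral_mul_le hw hfx (lintegral_normed ρ).le)
        gcongr
        rw [moll_apply]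
        refine (enorm_integral_le_lintegral_enorm _).trans (le_of_eq ?_)
        exact lintegral_congr fun t => enorm_smul _ _
    _ = ∫⁻ t, ∫⁻ x, ‖ρ.normed volume t‖ₑ * ‖f (x - t)‖ₑ ^ 2 := by
        rw [lintegral_lintegral_swap]
        refine AEMeasurable.mul (f := fun q : E N × E N => ‖ρ.normed volume q.2‖ₑ)
          (g := fun q : E N × E N => ‖f (q.1 - q.2)‖ₑ ^ 2) ?_ ?_
        · exact ((continuous_normed ρ).enorm.comp continuous_snd).aemeasurable
        · exact ((aestronglyMeasurable_sub_prod hf).comp_measurePreserving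
            Measure.measurePreserving_swap).enorm.pow_const 2
    _ = ∫⁻ t, ‖ρ.normed volume t‖ₑ * ∫⁻ x, ‖f x‖ₑ ^ 2 := by
        refine lintegral_congr fun t => ?_
        rw [lintegral_const_mul' _ _ (by simp), lintegral_sub_right_eq_self (fun x => ‖f x‖ₑ ^ 2) t]
    _ = ∫⁻ x, ‖f x‖ₑ ^ 2 := by
        rw [lintegral_mul_const'' _ hw, lintegral_normed, one_mul]

/-- Mollification commutes with the weak gradient, because y ↦ ρ(x - y) is an admissible test
function and differentiation of the convolution falls on it. -/
lemma IsH1.fderiv_moll {u : E N → ℝ} {g : E N → E N} (h : IsH1 u g) (x v : E N) :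
    fderiv ℝ (moll ρ u) x v = inner ℝ (moll ρ g x) v := by
  have hρ : ContDiff ℝ ∞ (ρ.normed (volume : Measure (E N))) := ρ.contDiff_normed (n := ⊤)
  have hρ1 : ContDiff ℝ 1 (ρ.normed (volume : Measure (E N))) := ρ.contDiff_normed (n := 1)
  have hρc := ρ.hasCompactSupport_normed (μ := (volume : Measure (E N)))
  have hu := locallyIntegrable_of_memLp h.memLp
  have hg := locallyIntegrable_of_memLp h.memLp_grad
  have hd := hρc.hasFDerivAt_convolution_left (ContinuousLinearMap.lsmul ℝ ℝ) hρ1 hu x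
  have e0 : fderiv ℝ (moll ρ u) x v
      = ∫ t, fderiv ℝ (ρ.normed volume) t v * u (x - t) := by
    change fderiv ℝ (_ ⋆[_, _] _) x v = _
    rw [hd.fderiv, convolution_def, ContinuousLinearMap.integral_apply]
    · rfl
    · have := (hρc.fderiv ℝ).convolutionExists_left
        ((ContinuousLinearMap.lsmul ℝ ℝ : ℝ →L[ℝ] ℝ →L[ℝ] ℝ).precompL (E N))
        (hρ1.continuous_fderiv (by simp)) hu x
      exact this
  -- test the weak gradient against the reflected translate
  have key := h.integral_eq (fun y => ρ.normed volume (x - y))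
    (hρ.comp (contDiff_const.sub contDiff_id)) (hρc.comp_homeomorph (Homeomorph.subLeft x)) v
  have hd2 : ∀ y, fderiv ℝ (fun y => ρ.normed volume (x - y)) y v
      = - fderiv ℝ (ρ.normed volume) (x - y) v := by
    intro y
    have h1 : HasFDerivAt (fun y => ρ.normed volume (x - y))
        ((fderiv ℝ (ρ.normed volume) (x - y)).comp (-(ContinuousLinearMap.id ℝ (E N)))) y :=
      ((hρ1.differentiable (by simp)) (x - y)).hasFDerivAt.comp y
        ((hasFDerivAt_id y).const_sub x)
    rw [h1.fderiv]
    simp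
  simp_rw [hd2] at key
  have e1 : ∫ t, fderiv ℝ (ρ.normed volume) t v * u (x - t)
      = ∫ y, fderiv ℝ (ρ.normed volume) (x - y) v * u y := by
    rw [← integral_sub_left_eq_self (fun t => fderiv ℝ (ρ.normed volume) t v * u (x - t)) volume x]
    simp
  have e2 : inner ℝ (moll ρ g x) v = ∫ y, inner ℝ (g y) v * ρ.normed volume (x - y) := by
    rw [moll_apply, real_inner_comm, ← integral_inner, ← integral_sub_left_eq_self _ volume x]
    · refine integral_congr_ae (Eventually.of_forall fun y => ?_)
      simp only [sub_sub_cancel]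
      rw [inner_smul_right, real_inner_comm, mul_comm]
    · exact hρc.convolutionExists_left (ContinuousLinearMap.lsmul ℝ ℝ) hρ1.continuous hg x
  rw [e0, e1, e2, ← neg_eq_iff_eq_neg.2 key, ← integral_neg]
  congr 1
  ext y
  ring

lemma IsH1.norm_fderiv_moll {u : E N → ℝ} {g : E N → E N} (h : IsH1 u g) (x : E N) :
    ‖fderiv ℝ (moll ρ u) x‖ = ‖moll ρ g x‖ := by
  have : fderiv ℝ (moll ρ u) x = InnerProductSpace.toDual ℝ (E N) (moll ρ g x) := by
    ext v
    rw [h.fderiv_moll, InnerProductSpace.toDual_apply_apply]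
  rw [this, LinearIsometryEquiv.norm_map]

/-- A sequence of bump functions shrinking to the origin. -/
def bumpSeq (N : ℕ) (k : ℕ) : ContDiffBump (0 : E N) where
  rIn := 1 / (k + 1 : ℝ)
  rOut := 2 / (k + 1 : ℝ)
  rIn_pos := by positivity
  rIn_lt_rOut := by gcongr; norm_num

lemma tendsto_moll_bumpSeq {u : E N → ℝ} (hu : LocallyIntegrable u) :
    ∀ᵐ x, Tendsto (fun k => moll (bumpSeq N k) u x) atTop (𝓝 (u x)) := by
  refine ContDiffBump.ae_convolution_tendsto_right_of_locallyIntegrable (K := 2) ?_ ?_ hu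
  · have := (tendsto_one_div_add_atTop_nhds_zero_nat (𝕜 := ℝ)).const_mul 2
    simpa [bumpSeq, div_eq_mul_inv] using this
  · refine Eventually.of_forall fun k => ?_
    simp only [bumpSeq]
    rw [mul_one_div]

/-- Every element of `H¹` is an almost everywhere limit of `C¹` functions with compact support whose
Dirichlet norms are asymptotically not larger. -/
theorem IsH1.exists_approx {u : E N → ℝ} {g : E N → E N} (h : IsH1 u g) :
    ∃ (v : ℕ → E N → ℝ) (δ : ℕ → ℝ≥0∞), (∀ k, ContDiff ℝ 1 (v k)) ∧
      (∀ k, HasCompactSupport (v k)) ∧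
      (∀ᵐ x, Tendsto (fun k => v k x) atTop (𝓝 (u x))) ∧ Tendsto δ atTop (𝓝 0) ∧
      ∀ k, eLpNorm (fderiv ℝ (v k)) 2 volume ≤ eLpNorm g 2 volume + δ k := by
  have hu := locallyIntegrable_of_memLp h.memLp
  let η : ContDiffBump (0 : E N) := ⟨1, 2, one_pos, one_lt_two⟩
  have hη : ContDiff ℝ 1 η := η.contDiff (n := 1)
  have hηd : Continuous (fderiv ℝ η) := hη.continuous_fderiv (by simp)
  obtain ⟨M, hM⟩ := (η.hasCompactSupport.fderiv ℝ).exists_bound_of_continuous hηd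
  have hM0 : 0 ≤ M := (norm_nonneg _).trans (hM 0)
  let a : ℕ → ℝ := fun k => 1 / (k + 1 : ℝ)
  have ha : ∀ k, 0 < a k := fun k => by positivity
  have hχ : ∀ k, ContDiff ℝ 1 fun x => η (a k • x) := fun k => hη.comp (contDiff_const_smul _)
  have hm : ∀ k, ContDiff ℝ 1 (moll (bumpSeq N k) u) := fun k => contDiff_moll _ hu
  -- The approximants are cut-off mollifications. The gradient of the mollification has norm at most
  -- that of g; the error δ_k comes only from the gradient of the cutoff, bounded by a_k M,
  -- multiplied by ‖u‖₂.
  refine ⟨fun k x => η (a k • x) * moll (bumpSeq N k) u x,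
    fun k => ENNReal.ofReal (a k * M) * eLpNorm u 2 volume, fun k => (hχ k).mul (hm k),
    fun k => ?_, ?_, ?_, fun k => ?_⟩
  · exact HasCompactSupport.mul_right
      (η.hasCompactSupport.comp_homeomorph (Homeomorph.smulOfNeZero (a k) (ha k).ne'))
  · filter_upwards [tendsto_moll_bumpSeq hu] with x hx
    refine hx.congr' ?_
    filter_upwards [eventually_ge_atTop (Nat.ceil ‖x‖)] with k hk
    have : a k • x ∈ Metric.closedBall (0 : E N) η.rIn := by
      rw [mem_closedBall_zero_iff, norm_smul, Real.norm_of_nonneg (ha k).le]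
      have h1 : ‖x‖ ≤ k + 1 := by
        have := (Nat.le_ceil ‖x‖).trans (by exact_mod_cast hk : ((Nat.ceil ‖x‖ : ℕ) : ℝ) ≤ k)
        linarith
      change 1 / (k + 1 : ℝ) * ‖x‖ ≤ 1
      rw [one_div_mul_eq_div]
      exact div_le_one_of_le₀ h1 (by positivity)
    rw [η.one_of_mem_closedBall this, one_mul]
  · have h1 : Tendsto (fun k => ENNReal.ofReal (a k * M)) atTop (𝓝 (ENNReal.ofReal (0 * M))) :=
      ENNReal.tendsto_ofReal ((tendsto_one_div_add_atTop_nhds_zero_nat (𝕜 := ℝ)).mul_const M)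
    have := ENNReal.Tendsto.mul_const (b := eLpNorm u 2 volume) h1 (Or.inr h.memLp.2.ne)
    simpa using this
  · have hnorm : ∀ x, ‖fderiv ℝ (fun x => η (a k • x) * moll (bumpSeq N k) u x) x‖
        ≤ ‖‖moll (bumpSeq N k) g x‖ + a k * M * ‖moll (bumpSeq N k) u x‖‖ := by
      intro x
      have hx1 := ((hχ k).differentiable (by simp)) x
      have hx2 := ((hm k).differentiable (by simp)) x
      rw [fderiv_fun_mul hx1 hx2, ← h.norm_fderiv_moll]
      rw [Real.norm_of_nonneg (by have := ha k; positivity)]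
      refine (norm_add_le _ _).trans ?_
      rw [norm_smul, norm_smul]
      refine add_le_add ?_ ?_
      · refine mul_le_of_le_one_left (norm_nonneg _) ?_
        rw [Real.norm_of_nonneg η.nonneg]
        exact η.le_one
      · rw [mul_comm]
        refine mul_le_mul_of_nonneg_right ?_ (norm_nonneg _)
        rw [fderiv_comp_smul, norm_smul, Real.norm_of_nonneg (ha k).le]
        exact mul_le_mul_of_nonneg_left (hM _) (ha k).le
    refine (eLpNorm_mono hnorm).trans ?_
    have hmg : AEStronglyMeasurable (moll (bumpSeq N k) g) := by
      have hρc := (bumpSeq N k).hasCompactSupport_normed (μ := (volume : Measure (E N)))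
      exact (hρc.continuous_convolution_left _ (continuous_normed _)
        (locallyIntegrable_of_memLp h.memLp_grad)).aestronglyMeasurable
    refine (eLpNorm_add_le hmg.norm ((hm k).continuous.norm.aestronglyMeasurable.const_mul _)
      (by norm_num)).trans ?_
    refine add_le_add ?_ ?_
    · rw [eLpNorm_norm]
      exact eLpNorm_moll_le _ h.memLp_grad.1
    · have := eLpNorm_const_smul (a k * M) (fun x => ‖moll (bumpSeq N k) u x‖) 2
        (volume : Measure (E N))
      change eLpNorm (fun x => a k * M * ‖moll (bumpSeq N k) u x‖) 2 volume = _ at this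
      rw [this, eLpNorm_norm, Real.enorm_eq_ofReal (by have := ha k; positivity)]
      exact mul_le_mul_right (eLpNorm_moll_le _ h.memLp.1) _

end Mollification

/-! ### Sobolev, translation and Hardy inequalities in H¹. -/

section Inequalities

variable {N : ℕ}

/-- The critical Sobolev exponent `2N / (N - 2)`. -/
def sobExp (N : ℕ) : ℝ := 2 * N / (N - 2)

lemma sobExp_pos (hN : 3 ≤ N) : 0 < sobExp N := by
  have hN' : (3 : ℝ) ≤ N := by exact_mod_cast hN
  unfold sobExp
  have : (0 : ℝ) < N - 2 := by linarith
  positivity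

/-- **Sobolev inequality** in `H¹`. -/
lemma exists_sobolev (hN : 3 ≤ N) :
    ∃ C : ℝ≥0∞, C ≠ ⊤ ∧ ∀ (u : E N → ℝ) (g : E N → E N), IsH1 u g →
      eLpNorm u (ENNReal.ofReal (sobExp N)) volume ≤ C * eLpNorm g 2 volume := by
  have hN' : (3 : ℝ) ≤ N := by exact_mod_cast hN
  refine ⟨eLpNormLESNormFDerivOfEqInnerConst (volume : Measure (E N)) (2 : ℝ≥0), by finiteness,
    fun u g h => ?_⟩
  set C : ℝ≥0∞ := (eLpNormLESNormFDerivOfEqInnerConst (volume : Measure (E N)) (2 : ℝ≥0) : ℝ≥0∞) with hC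
  obtain ⟨v, δ, hv, hvc, hlim, hδ, hle⟩ := h.exists_approx
  -- The inequality for compactly supported C¹ functions applies to the approximants; Fatou's lemma
  -- then transfers it to u, and only an asymptotic upper bound on the gradient norms is needed.
  have hsob : ∀ k, eLpNorm (v k) (ENNReal.ofReal (sobExp N)) volume
      ≤ C * (eLpNorm g 2 volume + δ k) := by
    intro k
    have := eLpNorm_le_eLpNorm_fderiv_of_eq_inner (volume : Measure (E N)) (hv k) (hvc k)
      (p := 2) (p' := (sobExp N).toNNReal) (by norm_num) (by simp; omega) (by
        rw [Real.coe_toNNReal _ (sobExp_pos hN).le]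
        simp only [finrank_euclideanSpace, Fintype.card_fin, sobExp]
        have : (N : ℝ) - 2 ≠ 0 := by linarith
        field_simp
        push_cast
        ring)
    exact this.trans (mul_le_mul_right (hle k) _)
  have hfat := Lp.eLpNorm_lim_le_liminf_eLpNorm (p := ENNReal.ofReal (sobExp N))
    (fun k => (hv k).continuous.aestronglyMeasurable) u hlim
  have hrhs : Tendsto (fun k => C * (eLpNorm g 2 volume + δ k)) atTop
      (𝓝 (C * (eLpNorm g 2 volume + 0))) :=
    ENNReal.Tendsto.const_mul (tendsto_const_nhds.add hδ) (Or.inr (by finiteness))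
  rw [add_zero] at hrhs
  calc _ ≤ _ := hfat
    _ ≤ liminf (fun k => C * (eLpNorm g 2 volume + δ k)) atTop :=
        liminf_le_liminf (Eventually.of_forall hsob)
    _ = _ := hrhs.liminf_eq

/-- Fatou's lemma along an approximating sequence. -/
lemma lintegral_le_of_approx {u : E N → ℝ≥0∞} {v : ℕ → E N → ℝ≥0∞} {c G : ℝ≥0∞} {δ : ℕ → ℝ≥0∞}
    (hc : c ≠ ⊤) (hv : ∀ k, AEMeasurable (v k)) (hlim : ∀ᵐ x, Tendsto (fun k => v k x) atTop (𝓝 (u x)))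
    (hδ : Tendsto δ atTop (𝓝 0)) (hle : ∀ k, ∫⁻ x, v k x ≤ c * (G + δ k) ^ 2) :
    ∫⁻ x, u x ≤ c * G ^ 2 := by
  have hrhs : Tendsto (fun k => c * (G + δ k) ^ 2) atTop (𝓝 (c * (G + 0) ^ 2)) :=
    ENNReal.Tendsto.const_mul (((ENNReal.continuous_pow 2).tendsto _).comp
      (tendsto_const_nhds.add hδ)) (Or.inr hc)
  rw [add_zero] at hrhs
  calc ∫⁻ x, u x = ∫⁻ x, liminf (fun k => v k x) atTop :=
        lintegral_congr_ae (hlim.mono fun x hx => hx.liminf_eq.symm)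
    _ ≤ liminf (fun k => ∫⁻ x, v k x) atTop := lintegral_liminf_le' hv
    _ ≤ liminf (fun k => c * (G + δ k) ^ 2) atTop := liminf_le_liminf (Eventually.of_forall hle)
    _ = _ := hrhs.liminf_eq

/-- The increment is the integral of the directional derivative along the segment; Cauchy–Schwarz in
the segment variable and translation invariance in x finish. -/
lemma lintegral_sub_translate_le_of_contDiff {v : E N → ℝ} (hv : ContDiff ℝ 1 v) (h : E N) :
    ∫⁻ x, ‖v (x + h) - v x‖ₑ ^ 2 ≤ ‖h‖ₑ ^ 2 * ∫⁻ x, ‖fderiv ℝ v x‖ₑ ^ 2 := by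
  have hd : Continuous (fderiv ℝ v) := hv.continuous_fderiv (by simp)
  have hpt : ∀ x, ‖v (x + h) - v x‖ₑ ≤ ∫⁻ s in Ioc (0 : ℝ) 1, 1 * (‖fderiv ℝ v (x + s • h)‖ₑ * ‖h‖ₑ) := by
    intro x
    have h1 : ∀ s : ℝ, HasDerivAt (fun s : ℝ => v (x + s • h)) (fderiv ℝ v (x + s • h) h) s := by
      intro s
      have h2 : HasDerivAt (fun s : ℝ => x + s • h) h s := by
        simpa using ((hasDerivAt_id s).smul_const h).const_add x
      exact ((hv.differentiable (by simp)) (x + s • h)).hasFDerivAt.comp_hasDerivAt s h2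
    have hc : Continuous fun s : ℝ => fderiv ℝ v (x + s • h) h :=
      (hd.comp (by fun_prop)).clm_apply continuous_const
    have h3 := intervalIntegral.integral_eq_sub_of_hasDerivAt (a := 0) (b := 1)
      (fun s _ => h1 s) (hc.intervalIntegrable _ _)
    simp only [one_smul, zero_smul, add_zero] at h3
    rw [← h3, intervalIntegral.integral_of_le zero_le_one]
    refine (enorm_integral_le_lintegral_enorm _).trans (lintegral_mono fun s => ?_)
    rw [one_mul]
    exact ContinuousLinearMap.le_opENorm _ _
  have hcE : Continuous fun q : E N × ℝ => ‖fderiv ℝ v (q.1 + q.2 • h)‖ₑ * ‖h‖ₑ := by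
    refine ENNReal.continuous_mul_const (by simp) |>.comp ?_
    exact (hd.comp (by fun_prop)).enorm
  calc ∫⁻ x, ‖v (x + h) - v x‖ₑ ^ 2
      ≤ ∫⁻ x, ∫⁻ s in Ioc (0 : ℝ) 1, (‖fderiv ℝ v (x + s • h)‖ₑ * ‖h‖ₑ) ^ 2 := by
        refine lintegral_mono fun x => ?_
        have hm : AEMeasurable (fun s : ℝ => ‖fderiv ℝ v (x + s • h)‖ₑ * ‖h‖ₑ)
            (volume.restrict (Ioc 0 1)) :=
          (hcE.comp (by fun_prop : Continuous fun s : ℝ => (x, s))).aemeasurable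
        have := sq_lintegral_mul_le (w := fun _ => 1) aemeasurable_const hm (by simp)
        simp only [one_mul] at this
        refine le_trans ?_ this
        gcongr
        simpa using hpt x
    _ = ∫⁻ s in Ioc (0 : ℝ) 1, ∫⁻ x, (‖fderiv ℝ v (x + s • h)‖ₑ * ‖h‖ₑ) ^ 2 := by
        rw [lintegral_lintegral_swap]
        exact ((ENNReal.continuous_pow 2).comp hcE).aemeasurable
    _ = ∫⁻ s in Ioc (0 : ℝ) 1, ‖h‖ₑ ^ 2 * ∫⁻ x, ‖fderiv ℝ v x‖ₑ ^ 2 := by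
        refine lintegral_congr fun s => ?_
        rw [← lintegral_add_right_eq_self (fun x => ‖fderiv ℝ v x‖ₑ ^ 2) (s • h),
          ← lintegral_const_mul' _ _ (by finiteness)]
        refine lintegral_congr fun x => ?_
        rw [mul_pow, mul_comm]
    _ = _ := by simp

lemma IsH1.lintegral_sub_translate_le {u : E N → ℝ} {g : E N → E N} (hu : IsH1 u g) (h : E N) :
    ∫⁻ x, ‖u (x + h) - u x‖ₑ ^ 2 ≤ ‖h‖ₑ ^ 2 * eLpNorm g 2 volume ^ 2 := by
  obtain ⟨v, δ, hv, hvc, hlim, hδ, hle⟩ := hu.exists_approx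
  refine lintegral_le_of_approx (v := fun k x => ‖v k (x + h) - v k x‖ₑ ^ 2) (by finiteness)
    (fun k => ?_) ?_ hδ fun k => ?_
  · have := (hv k).continuous
    have hc : Continuous fun x => v k (x + h) - v k x := by fun_prop
    exact hc.enorm.aemeasurable.pow_const 2
  · have h2 := (measurePreserving_add_right (volume : Measure (E N)) h).quasiMeasurePreserving.ae hlim
    filter_upwards [hlim, h2] with x hx hx'
    exact ((ENNReal.continuous_pow 2).tendsto _).comp (hx'.sub hx).enorm
  · refine (lintegral_sub_translate_le_of_contDiff (hv k) h).trans ?_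
    rw [lintegral_enorm_sq_eq]
    gcongr
    exact hle k

/-- Mollification at scale `ρ.rOut` moves an `H¹` function by at most `ρ.rOut ‖∇u‖₂` in `L²`. -/
lemma IsH1.lintegral_moll_sub_le {u : E N → ℝ} {g : E N → E N} (hu : IsH1 u g)
    (ρ : ContDiffBump (0 : E N)) :
    ∫⁻ x, ‖moll ρ u x - u x‖ₑ ^ 2 ≤ ENNReal.ofReal ρ.rOut ^ 2 * eLpNorm g 2 volume ^ 2 := by
  have hw : AEMeasurable (fun t => ‖ρ.normed (volume : Measure (E N)) t‖ₑ) :=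
    (continuous_normed ρ).enorm.aemeasurable
  have hum := hu.memLp.1
  have hloc := locallyIntegrable_of_memLp hu.memLp
  have hpt : ∀ x, ‖moll ρ u x - u x‖ₑ ^ 2
      ≤ ∫⁻ t, ‖ρ.normed volume t‖ₑ * ‖u (x - t) - u x‖ₑ ^ 2 := by
    intro x
    have hm : AEMeasurable (fun t => ‖u (x - t) - u x‖ₑ) :=
      ((aestronglyMeasurable_comp_sub hum x).sub aestronglyMeasurable_const).enorm
    refine le_trans ?_ (sq_lintegral_mul_le hw hm (lintegral_normed ρ).le)
    gcongr
    have e : moll ρ u x - u x = ∫ t, ρ.normed volume t • (u (x - t) - u x) := by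
      simp_rw [smul_sub]
      rw [integral_sub, ← moll_apply, integral_smul_const, ρ.integral_normed, one_smul]
      · exact ρ.hasCompactSupport_normed.convolutionExists_left (ContinuousLinearMap.lsmul ℝ ℝ)
          (continuous_normed ρ) hloc x
      · exact (ρ.integrable_normed).smul_const _
    rw [e]
    refine (enorm_integral_le_lintegral_enorm _).trans (le_of_eq ?_)
    exact lintegral_congr fun t => enorm_smul _ _
  calc ∫⁻ x, ‖moll ρ u x - u x‖ₑ ^ 2
      ≤ ∫⁻ x, ∫⁻ t, ‖ρ.normed volume t‖ₑ * ‖u (x - t) - u x‖ₑ ^ 2 := lintegral_mono hpt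
    _ = ∫⁻ t, ∫⁻ x, ‖ρ.normed volume t‖ₑ * ‖u (x - t) - u x‖ₑ ^ 2 := by
        rw [lintegral_lintegral_swap]
        refine AEMeasurable.mul (f := fun q : E N × E N => ‖ρ.normed volume q.2‖ₑ)
          (g := fun q : E N × E N => ‖u (q.1 - q.2) - u q.1‖ₑ ^ 2) ?_ ?_
        · exact ((continuous_normed ρ).enorm.comp continuous_snd).aemeasurable
        · exact (((aestronglyMeasurable_sub_prod hum).comp_measurePreserving
            Measure.measurePreserving_swap).sub hum.comp_fst).enorm.pow_const 2
    _ ≤ ∫⁻ t, ‖ρ.normed volume t‖ₑ * (ENNReal.ofReal ρ.rOut ^ 2 * eLpNorm g 2 volume ^ 2) := by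
        refine lintegral_mono fun t => ?_
        simp only
        rw [lintegral_const_mul' _ _ (by simp)]
        by_cases ht : t ∈ Metric.ball (0 : E N) ρ.rOut
        · gcongr
          have h1 := hu.lintegral_sub_translate_le (-t)
          simp_rw [← sub_eq_add_neg] at h1
          refine h1.trans ?_
          gcongr
          rw [enorm_neg, ← ofReal_norm]
          refine ENNReal.ofReal_le_ofReal ?_
          exact (mem_ball_zero_iff.1 ht).le
        · have : ρ.normed (volume : Measure (E N)) t = 0 := by
            rw [← Function.notMem_support, ρ.support_normed_eq]
            exact ht
          simp [this]
    _ = _ := by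
        rw [lintegral_mul_const'' _ hw, lintegral_normed, one_mul]

/-- The divergence of v² X integrates to zero for X = x/(|x|² + ε), a smooth substitute for x/|x|².
Since |x|² ≤ |x|² + ε, the divergence of X is at least (N-2)/(|x|² + ε), and the cross term 2v ∇v·X
is absorbed by Young's inequality. The constant does not depend on ε. -/
lemma hardy_of_contDiff (hN : 3 ≤ N) {v : E N → ℝ} (hv : ContDiff ℝ 1 v) (hc : HasCompactSupport v)
    {ε : ℝ} (hε : 0 < ε) :
    ∫ x, v x ^ 2 / (‖x‖ ^ 2 + ε) ≤ 4 / ((N : ℝ) - 2) ^ 2 * ∫ x, ‖fderiv ℝ v x‖ ^ 2 := by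
  have hN' : (3 : ℝ) ≤ N := by exact_mod_cast hN
  have hpos : ∀ x : E N, 0 < ‖x‖ ^ 2 + ε := fun x => by positivity
  set w : E N → ℝ := fun x => (‖x‖ ^ 2 + ε)⁻¹ with hw
  have hwd : ContDiff ℝ 1 w := by
    refine ContDiff.inv ?_ fun x => (hpos x).ne'
    exact (contDiff_norm_sq ℝ).add contDiff_const
  have hwpos : ∀ x, 0 < w x := fun x => inv_pos.2 (hpos x)
  have hdv : Continuous (fderiv ℝ v) := hv.continuous_fderiv (by simp)
  have hwf : ∀ x y : E N, fderiv ℝ w x y = -(2 * inner ℝ x y) * w x ^ 2 := by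
    intro x y
    have h1 : HasFDerivAt (fun x : E N => ‖x‖ ^ 2 + ε) (2 • (innerSL ℝ x)) x :=
      (hasStrictFDerivAt_norm_sq x).hasFDerivAt.add_const ε
    have h2 := (hasDerivAt_inv (hpos x).ne').comp_hasFDerivAt x h1
    have h3 : HasFDerivAt w ((-((‖x‖ ^ 2 + ε) ^ 2)⁻¹) • (2 • (innerSL ℝ x))) x := h2
    rw [h3.fderiv]
    simp [hw]
    ring
  let X : Fin N → E N → ℝ := fun i x => x i * w x
  have hcoord : ∀ i : Fin N, ContDiff ℝ 1 fun x : E N => x i := fun i =>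
    (EuclideanSpace.proj (𝕜 := ℝ) i).contDiff
  have hX : ∀ i, ContDiff ℝ 1 (X i) := fun i => (hcoord i).mul hwd
  let e : Fin N → E N := fun i => EuclideanSpace.single i 1
  have hXf : ∀ i x, fderiv ℝ (X i) x (e i) = w x - 2 * x i ^ 2 * w x ^ 2 := by
    intro i x
    have h1 : fderiv ℝ (fun x : E N => x i) x = EuclideanSpace.proj (𝕜 := ℝ) i :=
      (EuclideanSpace.proj (𝕜 := ℝ) i).fderiv
    have h2 : fderiv ℝ (X i) x = x i • fderiv ℝ w x + w x • fderiv ℝ (fun x : E N => x i) x :=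
      fderiv_fun_mul ((hcoord i).differentiable (by simp) x) (hwd.differentiable (by simp) x)
    rw [h2, h1]
    simp only [add_apply, smul_apply, smul_eq_mul, hwf]
    simp [e, EuclideanSpace.inner_single_right]
    ring
  have hv2 : ContDiff ℝ 1 fun x => v x ^ 2 := hv.pow 2
  have hv2c : HasCompactSupport fun x => v x ^ 2 := by
    have := hc.comp_left (g := fun s : ℝ => s ^ 2) (by simp)
    exact this
  have hv2f : ∀ x y, fderiv ℝ (fun x => v x ^ 2) x y = 2 * v x * fderiv ℝ v x y := by
    intro x y
    have : HasFDerivAt (fun x => v x ^ 2) _ x :=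
      ((hv.differentiable (by simp)) x).hasFDerivAt.pow 2
    rw [this.fderiv]
    simp
  have hdX : ∀ i, Continuous fun x => fderiv ℝ (X i) x (e i) := fun i =>
    ((hX i).continuous_fderiv (by simp)).clm_apply continuous_const
  have hdv2 : ∀ i, Continuous fun x => fderiv ℝ (fun x => v x ^ 2) x (e i) := fun i =>
    (hv2.continuous_fderiv (by simp)).clm_apply continuous_const
  have int1 : ∀ i, Integrable fun x => v x ^ 2 * fderiv ℝ (X i) x (e i) := fun i =>
    (hv2.continuous.mul (hdX i)).integrable_of_hasCompactSupport hv2c.mul_right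
  have int2 : ∀ i, Integrable fun x => fderiv ℝ (fun x => v x ^ 2) x (e i) * X i x := fun i =>
    ((hdv2 i).mul (hX i).continuous).integrable_of_hasCompactSupport
      (hv2c.fderiv_apply ℝ (e i)).mul_right
  have parts : ∀ i, ∫ x, v x ^ 2 * fderiv ℝ (X i) x (e i)
      = -∫ x, fderiv ℝ (fun x => v x ^ 2) x (e i) * X i x := fun i =>
    integral_mul_fderiv_eq_neg_fderiv_mul_of_integrable (int2 i) (int1 i)
      ((hv2.continuous.mul (hX i).continuous).integrable_of_hasCompactSupport hv2c.mul_right)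
      (fun x _ => (hv2.differentiable (by simp)) x) fun x _ => ((hX i).differentiable (by simp)) x
  have int12 : ∀ i, Integrable fun x => v x ^ 2 * fderiv ℝ (X i) x (e i)
      + fderiv ℝ (fun x => v x ^ 2) x (e i) * X i x := fun i => (int1 i).add (int2 i)
  have hsum : ∫ x, ∑ i, (v x ^ 2 * fderiv ℝ (X i) x (e i)
      + fderiv ℝ (fun x => v x ^ 2) x (e i) * X i x) = 0 := by
    rw [integral_finsetSum _ fun i _ => int12 i]
    refine Finset.sum_eq_zero fun i _ => ?_
    rw [integral_add (int1 i) (int2 i), parts i]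
    ring
  -- Half of the divergence term survives after the cross term is absorbed; integrating against the
  -- zero total divergence then gives Hardy's constant 4/(N-2)².
  have hpoint : ∀ x, ((N : ℝ) - 2) / 2 * (v x ^ 2 * w x) - 2 / ((N : ℝ) - 2) * ‖fderiv ℝ v x‖ ^ 2
      ≤ ∑ i, (v x ^ 2 * fderiv ℝ (X i) x (e i)
      + fderiv ℝ (fun x => v x ^ 2) x (e i) * X i x) := by
    intro x
    have hx : ∑ i, x i • e i = x := by
      have := (EuclideanSpace.basisFun (Fin N) ℝ).sum_repr x
      simpa [e] using this
    have hn : ∑ i, x i ^ 2 = ‖x‖ ^ 2 := by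
      rw [EuclideanSpace.norm_sq_eq]
      simp
    have e1 : ∑ i, (v x ^ 2 * fderiv ℝ (X i) x (e i)
        + fderiv ℝ (fun x => v x ^ 2) x (e i) * X i x)
        = v x ^ 2 * (N * w x - 2 * ‖x‖ ^ 2 * w x ^ 2) + 2 * v x * w x * fderiv ℝ v x x := by
      have e2 : fderiv ℝ v x x = ∑ i, x i * fderiv ℝ v x (e i) := by
        calc fderiv ℝ v x x = fderiv ℝ v x (∑ i, x i • e i) := by rw [hx]
          _ = _ := by
            rw [map_sum]
            simp only [map_smul, smul_eq_mul]
      have e3 : (N : ℝ) * w x = ∑ _i : Fin N, w x := by simp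
      rw [e2, ← hn, e3, Finset.sum_add_distrib]
      simp_rw [hXf, hv2f]
      rw [← Finset.mul_sum, Finset.sum_sub_distrib, Finset.mul_sum, Finset.sum_mul,
        Finset.mul_sum Finset.univ (fun i => x i * fderiv ℝ v x (e i))]
      congr 1
      refine Finset.sum_congr rfl fun i _ => ?_
      simp only [X]
      ring
    rw [e1]
    have h1 : ‖x‖ ^ 2 * w x ≤ 1 := by
      rw [hw]
      simp only
      rw [← div_eq_mul_inv, div_le_one (hpos x)]
      linarith
    have h2 : |fderiv ℝ v x x| ≤ ‖fderiv ℝ v x‖ * ‖x‖ := (fderiv ℝ v x).le_opNorm x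
    set n := ‖fderiv ℝ v x‖
    set r := ‖x‖
    have hr : 0 ≤ r := norm_nonneg x
    have hwx := hwpos x
    have h3 : -(2 * |v x| * w x * (n * r)) ≤ 2 * v x * w x * fderiv ℝ v x x := by
      have : |2 * v x * w x * fderiv ℝ v x x| ≤ 2 * |v x| * w x * (n * r) := by
        rw [abs_mul, abs_mul, abs_mul, abs_of_pos hwx, abs_two]
        gcongr
      exact (abs_le.1 this).1
    have h4 : 2 * |v x| * w x * (n * r)
        ≤ ((N : ℝ) - 2) / 2 * (v x ^ 2 * w x) + 2 / ((N : ℝ) - 2) * n ^ 2 := by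
      have hs : 0 < (N : ℝ) - 2 := by linarith
      -- This is the square whose expansion contains exactly the cross term, with half of the
      -- divergence term on the other side.
      have h5 : 0 ≤ (((N : ℝ) - 2) / 2 * |v x| * w x * r - n) ^ 2 * (2 / ((N : ℝ) - 2)) := by
        positivity
      have h6 : (((N : ℝ) - 2) / 2 * |v x| * w x * r - n) ^ 2 * (2 / ((N : ℝ) - 2))
          = ((N : ℝ) - 2) / 2 * (v x ^ 2 * w x) * (r ^ 2 * w x) - 2 * |v x| * w x * (n * r)
            + 2 / ((N : ℝ) - 2) * n ^ 2 := by
        have : v x ^ 2 = |v x| ^ 2 := (sq_abs _).symm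
        rw [this]
        field_simp
        ring
      have h7 : ((N : ℝ) - 2) / 2 * (v x ^ 2 * w x) * (r ^ 2 * w x)
          ≤ ((N : ℝ) - 2) / 2 * (v x ^ 2 * w x) * 1 := by
        gcongr
      linarith
    have h8 : v x ^ 2 * (N * w x - 2 * w x) ≤ v x ^ 2 * (N * w x - 2 * r ^ 2 * w x ^ 2) := by
      gcongr ?_ * ?_
      have : r ^ 2 * w x * w x ≤ 1 * w x := by gcongr
      nlinarith
    have h9 : v x ^ 2 * (N * w x - 2 * w x) = ((N : ℝ) - 2) * (v x ^ 2 * w x) := by ring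
    linarith
  have i1 : Integrable fun x => v x ^ 2 * w x :=
    (hv2.continuous.mul hwd.continuous).integrable_of_hasCompactSupport hv2c.mul_right
  have i2 : Integrable fun x => ‖fderiv ℝ v x‖ ^ 2 := by
    have hcs : HasCompactSupport fun x => ‖fderiv ℝ v x‖ ^ 2 :=
      (hc.fderiv ℝ).comp_left (g := fun y => ‖y‖ ^ 2) (by simp)
    exact (hdv.norm.pow 2).integrable_of_hasCompactSupport hcs
  have := integral_mono (μ := volume) ((i1.const_mul (((N : ℝ) - 2) / 2)).sub
    (i2.const_mul (2 / ((N : ℝ) - 2))))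
    (integrable_finsetSum _ fun i _ => int12 i) hpoint
  rw [hsum] at this
  simp only [Pi.sub_apply] at this
  rw [integral_sub (i1.const_mul _) (i2.const_mul _), integral_const_mul, integral_const_mul] at this
  have hs : 0 < (N : ℝ) - 2 := by linarith
  simp_rw [div_eq_mul_inv (v _ ^ 2)]
  have h10 : ((N : ℝ) - 2) / 2 * ∫ x, v x ^ 2 * w x ≤ 2 / ((N : ℝ) - 2) * ∫ x, ‖fderiv ℝ v x‖ ^ 2 := by
    linarith
  calc ∫ x, v x ^ 2 * w x = 2 / ((N : ℝ) - 2) * (((N : ℝ) - 2) / 2 * ∫ x, v x ^ 2 * w x) := by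
        field_simp
    _ ≤ 2 / ((N : ℝ) - 2) * (2 / ((N : ℝ) - 2) * ∫ x, ‖fderiv ℝ v x‖ ^ 2) := by gcongr
    _ = _ := by
        field_simp
        ring

/-- **Hardy's inequality** in `H¹`. -/
lemma MemH1.hardy (hN : 3 ≤ N) {u : E N → ℝ} (hu : MemH1 u) :
    Integrable (fun x => u x ^ 2 / ‖x‖ ^ 2) ∧
      ∫ x, u x ^ 2 / ‖x‖ ^ 2 ≤ 4 / ((N : ℝ) - 2) ^ 2 * gradSq u := by
  have hN' : (3 : ℝ) ≤ N := by exact_mod_cast hN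
  have hH := hu.isH1
  obtain ⟨v, δ, hv, hvc, hlim, hδ, hle⟩ := hH.exists_approx
  set c := 4 / ((N : ℝ) - 2) ^ 2 with hc
  have hc0 : 0 ≤ c := by positivity
  let a : ℕ → ℝ := fun k => 1 / (k + 1 : ℝ)
  have ha : ∀ k, 0 < a k := fun k => by positivity
  have hne : ∀ᵐ x : E N, x ≠ 0 := by
    have : NeZero N := ⟨by omega⟩
    have : Nontrivial (E N) := inferInstance
    exact compl_mem_ae_iff.2 (measure_singleton 0)
  have key : ∫⁻ x, ENNReal.ofReal (u x ^ 2 / ‖x‖ ^ 2)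
      ≤ ENNReal.ofReal c * eLpNorm (weakGradient u) 2 volume ^ 2 := by
    -- The regularisation parameter a_k tends to zero along with the approximation, so a single
    -- application of Fatou removes both.
    refine lintegral_le_of_approx
      (v := fun k x => ENNReal.ofReal (v k x ^ 2 / (‖x‖ ^ 2 + a k))) (by finiteness)
      (fun k => ?_) ?_ hδ fun k => ?_
    · have h1 := (hv k).continuous
      exact ((h1.pow 2).measurable.div (by fun_prop)).ennreal_ofReal.aemeasurable
    · filter_upwards [hlim, hne] with x hx hx0
      refine ENNReal.tendsto_ofReal ?_
      have h1 : Tendsto (fun k => ‖x‖ ^ 2 + a k) atTop (𝓝 (‖x‖ ^ 2 + 0)) :=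
        tendsto_const_nhds.add (tendsto_one_div_add_atTop_nhds_zero_nat (𝕜 := ℝ))
      rw [add_zero] at h1
      exact (hx.pow 2).div h1 (by simpa using hx0)
    · have h1 := hardy_of_contDiff hN (hv k) (hvc k) (ha k)
      have i1 : Integrable fun x => v k x ^ 2 / (‖x‖ ^ 2 + a k) := by
        have hcs : HasCompactSupport fun x => v k x ^ 2 / (‖x‖ ^ 2 + a k) := by
          have : (fun x => v k x ^ 2 / (‖x‖ ^ 2 + a k))
              = fun x => v k x * (v k x / (‖x‖ ^ 2 + a k)) := by
            ext x
            ring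
          rw [this]
          exact (hvc k).mul_right
        refine Continuous.integrable_of_hasCompactSupport ?_ hcs
        refine ((hv k).continuous.pow 2).div (by fun_prop) fun x => ?_
        have := ha k
        positivity
      have i2 : Integrable fun x => ‖fderiv ℝ (v k) x‖ ^ 2 := by
        have hcs : HasCompactSupport fun x => ‖fderiv ℝ (v k) x‖ ^ 2 :=
          ((hvc k).fderiv ℝ).comp_left (g := fun y => ‖y‖ ^ 2) (by simp)
        exact (((hv k).continuous_fderiv (by simp)).norm.pow 2).integrable_of_hasCompactSupport hcs
      rw [← ofReal_integral_eq_lintegral_ofReal i1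
        (Eventually.of_forall fun x => by have := ha k; positivity)]
      refine (ENNReal.ofReal_le_ofReal h1).trans ?_
      rw [ENNReal.ofReal_mul hc0, ofReal_integral_eq_lintegral_ofReal i2
        (Eventually.of_forall fun x => by positivity)]
      gcongr
      have : ∀ x, ENNReal.ofReal (‖fderiv ℝ (v k) x‖ ^ 2) = ‖fderiv ℝ (v k) x‖ₑ ^ 2 := by
        intro x
        rw [ENNReal.ofReal_pow (norm_nonneg _), ofReal_norm]
      simp_rw [this]
      rw [lintegral_enorm_sq_eq]
      gcongr
      exact hle k
  have hgr : eLpNorm (weakGradient u) 2 volume ^ 2 = ENNReal.ofReal (gradSq u) := by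
    rw [← lintegral_enorm_sq_eq, gradSq, ofReal_integral_eq_lintegral_ofReal hu.integrable_grad
      (Eventually.of_forall fun x => by positivity)]
    refine lintegral_congr fun x => ?_
    rw [ENNReal.ofReal_pow (norm_nonneg _), ofReal_norm]
  rw [hgr, ← ENNReal.ofReal_mul hc0] at key
  have hm : AEStronglyMeasurable fun x => u x ^ 2 / ‖x‖ ^ 2 := by
    have h1 := hu.1.1.aemeasurable
    exact ((h1.pow_const 2).div (by fun_prop)).aestronglyMeasurable
  have hi : Integrable fun x => u x ^ 2 / ‖x‖ ^ 2 := by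
    refine ⟨hm, ?_⟩
    rw [hasFiniteIntegral_iff_ofReal (Eventually.of_forall fun x => by positivity)]
    exact key.trans_lt ENNReal.ofReal_lt_top
  refine ⟨hi, ?_⟩
  rw [← ofReal_integral_eq_lintegral_ofReal hi (Eventually.of_forall fun x => by positivity)] at key
  exact (ENNReal.ofReal_le_ofReal_iff (mul_nonneg hc0 (gradSq_nonneg u))).1 key

end Inequalities

/-! ### Weak compactness, almost everywhere convergence, and translates with nonzero limits. -/

section WeakConvergence

variable {N : ℕ}

/-- Sequential Banach–Alaoglu in a separable space, carried back to H by the Riesz isomorphism. -/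
lemma exists_subseq_weak_of_bounded {H : Type*} [NormedAddCommGroup H] [InnerProductSpace ℝ H]
    [CompleteSpace H] [TopologicalSpace.SeparableSpace H] (x : ℕ → H) {C : ℝ}
    (hC : ∀ n, ‖x n‖ ≤ C) :
    ∃ (x₀ : H) (φ : ℕ → ℕ), StrictMono φ ∧
      ∀ y, Tendsto (fun n => inner ℝ (x (φ n)) y) atTop (𝓝 (inner ℝ x₀ y)) := by
  have hs := WeakDual.isSeqCompact_closedBall ℝ H 0 C
  let f : ℕ → WeakDual ℝ H := fun n =>
    WeakDual.toStrongDual.symm (InnerProductSpace.toDual ℝ H (x n))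
  obtain ⟨a, -, φ, hφ, hlim⟩ := hs (x := f) fun n => by
    simp only [mem_preimage, mem_closedBall_zero_iff, f, LinearEquiv.apply_symm_apply]
    rw [LinearIsometryEquiv.norm_map]
    exact hC n
  refine ⟨(InnerProductSpace.toDual ℝ H).symm (WeakDual.toStrongDual a), φ, hφ, fun y => ?_⟩
  have h := (tendsto_iff_forall_eval_tendsto_topDualPairing.1 hlim) y
  rw [InnerProductSpace.toDual_symm_apply]
  exact h

lemma exists_subseq_weak_memLp_two {F : Type*} [NormedAddCommGroup F] [InnerProductSpace ℝ F]
    [CompleteSpace F] [TopologicalSpace.SeparableSpace F] {f : ℕ → E N → F}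
    (hf : ∀ n, MemLp (f n) 2) {C : ℝ} (hC : ∀ n, ∫ x, ‖f n x‖ ^ 2 ≤ C) :
    ∃ (f₀ : E N → F) (φ : ℕ → ℕ), MemLp f₀ 2 ∧ StrictMono φ ∧ ∀ w : E N → F, MemLp w 2 →
      Tendsto (fun n => ∫ x, inner ℝ (f (φ n) x) (w x)) atTop (𝓝 (∫ x, inner ℝ (f₀ x) (w x))) := by
  have : Fact ((2 : ℝ≥0∞) ≠ ⊤) := ⟨by norm_num⟩
  have : SecondCountableTopology (Lp F 2 (volume : Measure (E N))) := Lp.SecondCountableTopology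
  have hin : ∀ (a b : Lp F 2 (volume : Measure (E N))) (a' b' : E N → F), a =ᵐ[volume] a' →
      b =ᵐ[volume] b' → inner ℝ a b = ∫ x, inner ℝ (a' x) (b' x) := by
    intro a b a' b' ha hb
    rw [L2.inner_def]
    refine integral_congr_ae ?_
    filter_upwards [ha, hb] with x h1 h2
    rw [h1, h2]
  obtain ⟨x₀, φ, hφ, hlim⟩ := exists_subseq_weak_of_bounded (fun n => (hf n).toLp)
    (C := Real.sqrt C) fun n => by
      refine Real.le_sqrt_of_sq_le ?_
      rw [← real_inner_self_eq_norm_sq, hin _ _ _ _ (hf n).coeFn_toLp (hf n).coeFn_toLp]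
      simp_rw [real_inner_self_eq_norm_sq]
      exact hC n
  refine ⟨x₀, φ, Lp.memLp x₀, hφ, fun w hw => ?_⟩
  have h := hlim hw.toLp
  rw [hin _ _ _ _ (ae_eq_refl _) hw.coeFn_toLp] at h
  refine h.congr fun n => ?_
  exact hin _ _ _ _ (hf (φ n)).coeFn_toLp hw.coeFn_toLp

/-- Weak convergence in `H¹`. -/
structure WeakTendsto (u : ℕ → E N → ℝ) (u₀ : E N → ℝ) : Prop where
  memH1 : ∀ n, MemH1 (u n)
  memH1_lim : MemH1 u₀
  tendsto : ∀ w : E N → ℝ, MemLp w 2 →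
    Tendsto (fun n => ∫ x, u n x * w x) atTop (𝓝 (∫ x, u₀ x * w x))
  tendsto_grad : ∀ w : E N → E N, MemLp w 2 →
    Tendsto (fun n => ∫ x, inner ℝ (weakGradient (u n) x) (w x)) atTop
      (𝓝 (∫ x, inner ℝ (weakGradient u₀ x) (w x)))

lemma WeakTendsto.comp {u : ℕ → E N → ℝ} {u₀ : E N → ℝ} (h : WeakTendsto u u₀) {φ : ℕ → ℕ}
    (hφ : StrictMono φ) : WeakTendsto (fun n => u (φ n)) u₀ :=
  ⟨fun n => h.memH1 _, h.memH1_lim, fun w hw => (h.tendsto w hw).comp hφ.tendsto_atTop,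
    fun w hw => (h.tendsto_grad w hw).comp hφ.tendsto_atTop⟩

/-- Bounded sequences in `H¹` are weakly sequentially precompact. -/
lemma exists_weakTendsto {u : ℕ → E N → ℝ} (hu : ∀ n, MemH1 (u n)) {C : ℝ}
    (hg : ∀ n, gradSq (u n) ≤ C) (hm : ∀ n, massSq (u n) ≤ C) :
    ∃ (u₀ : E N → ℝ) (φ : ℕ → ℕ), StrictMono φ ∧ WeakTendsto (fun n => u (φ n)) u₀ := by
  obtain ⟨u₀, φ, hu₀, hφ, h1⟩ := exists_subseq_weak_memLp_two (fun n => (hu n).1) (C := C)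
    (fun n => by simpa [massSq] using hm n)
  obtain ⟨g₀, ψ, hg₀, hψ, h2⟩ := exists_subseq_weak_memLp_two
    (fun n => (hu (φ n)).isH1.memLp_grad) (C := C) (fun _ => hg _)
  have h1' : ∀ w : E N → ℝ, MemLp w 2 → Tendsto (fun n => ∫ x, u (φ (ψ n)) x * w x) atTop
      (𝓝 (∫ x, u₀ x * w x)) := by
    intro w hw
    have := (h1 w hw).comp hψ.tendsto_atTop
    simpa [mul_comm, Function.comp_def] using this
  have hH : IsH1 u₀ g₀ := IsH1.of_tendsto (fun n => (hu (φ (ψ n))).isH1) hu₀ hg₀ h1' h2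
  refine ⟨u₀, φ ∘ ψ, hφ.comp hψ, fun n => hu _, hH.memH1, h1', fun w hw => ?_⟩
  have e : ∫ x, inner ℝ (weakGradient u₀ x) (w x) = ∫ x, inner ℝ (g₀ x) (w x) := by
    refine integral_congr_ae ?_
    filter_upwards [hH.weakGradient_ae_eq] with x hx
    rw [hx]
  rw [e]
  exact h2 w hw

lemma memLp_normed_sub (ρ : ContDiffBump (0 : E N)) (x : E N) :
    MemLp (fun y => ρ.normed volume (x - y)) 2 := by
  refine Continuous.memLp_of_hasCompactSupport ?_ ?_
  · exact (continuous_normed ρ).comp (by fun_prop)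
  · exact ρ.hasCompactSupport_normed.comp_homeomorph (Homeomorph.subLeft x)

lemma moll_eq_integral_mul (ρ : ContDiffBump (0 : E N)) (u : E N → ℝ) (x : E N) :
    moll ρ u x = ∫ y, u y * ρ.normed volume (x - y) := by
  rw [moll_apply, ← integral_sub_left_eq_self _ volume x]
  simp [mul_comm]

/-- The value of a mollification at a point is the pairing with a fixed L² function, so weak
convergence becomes pointwise convergence everywhere. -/
lemma WeakTendsto.tendsto_moll {u : ℕ → E N → ℝ} {u₀ : E N → ℝ} (h : WeakTendsto u u₀)
    (ρ : ContDiffBump (0 : E N)) (x : E N) :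
    Tendsto (fun n => moll ρ (u n) x) atTop (𝓝 (moll ρ u₀ x)) := by
  simp_rw [moll_eq_integral_mul]
  exact h.tendsto _ (memLp_normed_sub ρ x)

lemma MemH1.eLpNorm_grad_sq {u : E N → ℝ} (hu : MemH1 u) :
    eLpNorm (weakGradient u) 2 volume ^ 2 = ENNReal.ofReal (gradSq u) := by
  rw [← lintegral_enorm_sq_eq, gradSq, ofReal_integral_eq_lintegral_ofReal hu.integrable_grad
    (Eventually.of_forall fun x => by positivity)]
  refine lintegral_congr fun x => ?_
  rw [ENNReal.ofReal_pow (norm_nonneg _), ofReal_norm]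

/-- The set where an `H¹` function differs from its mollification is small. -/
lemma MemH1.volume_moll_sub_ge {u : E N → ℝ} (hu : MemH1 u) (ρ : ContDiffBump (0 : E N))
    {s : ℝ} (hs : 0 < s) :
    volume {x | s ≤ |moll ρ u x - u x|} ≤ ENNReal.ofReal (ρ.rOut ^ 2 * gradSq u / s ^ 2) := by
  have h1 := hu.isH1.lintegral_moll_sub_le ρ
  rw [hu.eLpNorm_grad_sq, ← ENNReal.ofReal_pow ρ.rOut_pos.le,
    ← ENNReal.ofReal_mul (by positivity)] at h1
  have hm : AEMeasurable fun x => ‖moll ρ u x - u x‖ₑ ^ 2 := by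
    have h2 := (contDiff_moll ρ (locallyIntegrable_of_memLp hu.1)).continuous.aestronglyMeasurable
      (μ := (volume : Measure (E N)))
    exact (h2.sub hu.1.1).enorm.pow_const 2
  have h3 := mul_meas_ge_le_lintegral₀ hm (ENNReal.ofReal (s ^ 2))
  have h4 : {x | s ≤ |moll ρ u x - u x|}
      ⊆ {x | ENNReal.ofReal (s ^ 2) ≤ ‖moll ρ u x - u x‖ₑ ^ 2} := by
    intro x hx
    simp only [mem_ofPred_eq] at hx ⊢
    rw [← ofReal_norm, ← ENNReal.ofReal_pow (norm_nonneg _), Real.norm_eq_abs]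
    exact ENNReal.ofReal_le_ofReal (by gcongr)
  rw [ENNReal.ofReal_div_of_pos (by positivity)]
  rw [ENNReal.le_div_iff_mul_le (Or.inl (by simp [hs.ne'])) (Or.inl (by simp)), mul_comm]
  exact (mul_le_mul_right (measure_mono h4) _).trans (h3.trans h1)

lemma exists_bump_small (G s : ℝ) {δ : ℝ} (hδ : 0 < δ) :
    ∃ ρ : ContDiffBump (0 : E N), ρ.rOut ^ 2 * G / s ^ 2 ≤ δ := by
  have h1 : Tendsto (fun k : ℕ => (2 * (1 / (k + 1 : ℝ))) ^ 2 * G / s ^ 2) atTop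
      (𝓝 ((2 * 0) ^ 2 * G / s ^ 2)) :=
    ((((tendsto_one_div_add_atTop_nhds_zero_nat (𝕜 := ℝ)).const_mul 2).pow 2).mul_const G).div_const _
  simp only [mul_zero, ne_eq, OfNat.ofNat_ne_zero, not_false_eq_true, zero_pow, zero_mul,
    zero_div] at h1
  obtain ⟨k, hk⟩ := (h1.eventually (ge_mem_nhds hδ)).exists
  refine ⟨bumpSeq N k, ?_⟩
  simpa [bumpSeq, div_eq_mul_inv] using hk

/-- A Gaussian density, at most one and everywhere positive. On a finite measure pointwise
convergence implies convergence in measure; domination by Lebesgue measure keeps the mollification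
estimate, and mutual absolute continuity returns almost everywhere statements. -/
lemma exists_finite_measure_le (N : ℕ) :
    ∃ ν : Measure (E N), IsFiniteMeasure ν ∧ ν ≤ volume ∧ (volume : Measure (E N)) ≪ ν := by
  let w : E N → ℝ≥0∞ := fun x => ENNReal.ofReal (Real.exp (-‖x‖ ^ 2))
  have hwm : Measurable w := by fun_prop
  refine ⟨volume.withDensity w, ?_, ?_, ?_⟩
  · have hi : Integrable fun x : E N => Real.exp (-1 * ‖x‖ ^ 2) := by
      have := GaussianFourier.integrable_cexp_neg_mul_sq_norm_add (V := E N) (b := 1) (by simp) 0 0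
      have h2 := this.norm
      refine h2.congr (Eventually.of_forall fun x => ?_)
      simp only [Complex.norm_exp]
      norm_num
      norm_cast
    refine isFiniteMeasure_withDensity ?_
    have := hi.2
    rw [hasFiniteIntegral_iff_ofReal (Eventually.of_forall fun x => (Real.exp_pos _).le)] at this
    simpa [w] using this.ne
  · have h1 : volume.withDensity w ≤ volume.withDensity (1 : E N → ℝ≥0∞) := by
      refine withDensity_mono (Eventually.of_forall fun x => ?_)
      simp only [w, Pi.one_apply]
      rw [ENNReal.ofReal_le_one]
      exact Real.exp_le_one_iff.2 (by simp)
    rwa [withDensity_one] at h1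
  · refine withDensity_absolutelyContinuous' hwm.aemeasurable (Eventually.of_forall fun x => ?_)
    simpa [w] using Real.exp_pos _

lemma WeakTendsto.sub_lim {u : ℕ → E N → ℝ} {u₀ : E N → ℝ} (h : WeakTendsto u u₀) :
    WeakTendsto (fun n x => u n x - u₀ x) 0 := by
  have h0 : MemH1 (0 : E N → ℝ) := by
    have := h.memH1_lim.sub h.memH1_lim
    simp only [sub_self] at this
    exact this
  have hg0 : weakGradient (0 : E N → ℝ) =ᵐ[volume] 0 := by
    have := (h.memH1_lim.isH1.sub h.memH1_lim.isH1).weakGradient_ae_eq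
    simp only [sub_self] at this
    exact this
  refine ⟨fun n => (h.memH1 n).sub h.memH1_lim, h0, fun w hw => ?_, fun w hw => ?_⟩
  · have := (h.tendsto w hw).sub_const (∫ x, u₀ x * w x)
    simp only [sub_self] at this
    simp only [Pi.zero_apply, zero_mul, integral_zero]
    refine this.congr fun n => ?_
    rw [← integral_sub (integrable_mul_of_memLp_two (h.memH1 n).1 hw)
      (integrable_mul_of_memLp_two h.memH1_lim.1 hw)]
    simp_rw [sub_mul]
  · have := (h.tendsto_grad w hw).sub_const (∫ x, inner ℝ (weakGradient u₀ x) (w x))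
    simp only [sub_self] at this
    have e : ∫ x, inner ℝ (weakGradient (0 : E N → ℝ) x) (w x) = 0 := by
      have : (fun x => inner ℝ (weakGradient (0 : E N → ℝ) x) (w x)) =ᵐ[volume] 0 := by
        filter_upwards [hg0] with x hx
        rw [hx]
        simp
      rw [integral_congr_ae this]
      simp
    rw [e]
    refine this.congr fun n => ?_
    rw [← integral_sub (integrable_inner_of_memLp_two (h.memH1 n).isH1.memLp_grad hw)
      (integrable_inner_of_memLp_two h.memH1_lim.isH1.memLp_grad hw)]
    refine integral_congr_ae ?_
    filter_upwards [((h.memH1 n).isH1.sub h.memH1_lim.isH1).weakGradient_ae_eq] with x hx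
    rw [hx, inner_sub_left]

lemma MemH1.gradSq_sub_le {u w : E N → ℝ} (hu : MemH1 u) (hw : MemH1 w) :
    gradSq (fun x => u x - w x) ≤ 2 * gradSq u + 2 * gradSq w := by
  rw [(hu.isH1.sub hw.isH1).gradSq_eq, gradSq, gradSq, ← integral_const_mul, ← integral_const_mul,
    ← integral_add (hu.integrable_grad.const_mul 2) (hw.integrable_grad.const_mul 2)]
  refine integral_mono (integrable_normSq_of_memLp_two (hu.isH1.sub hw.isH1).memLp_grad)
    ((hu.integrable_grad.const_mul 2).add (hw.integrable_grad.const_mul 2)) fun x => ?_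
  have h1 := parallelogram_law_with_norm ℝ (weakGradient u x) (weakGradient w x)
  simp only
  nlinarith [norm_nonneg (weakGradient u x + weakGradient w x)]

lemma MemH1.massSq_sub_le {u w : E N → ℝ} (hu : MemH1 u) (hw : MemH1 w) :
    massSq (fun x => u x - w x) ≤ 2 * massSq u + 2 * massSq w := by
  rw [massSq, massSq, massSq, ← integral_const_mul, ← integral_const_mul,
    ← integral_add (hu.integrable_sq.const_mul 2) (hw.integrable_sq.const_mul 2)]
  refine integral_mono (hu.sub hw).integrable_sq
    ((hu.integrable_sq.const_mul 2).add (hw.integrable_sq.const_mul 2)) fun x => ?_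
  simp only
  nlinarith [sq_nonneg (u x + w x)]

lemma setOf_le_abs_subset {w m : E N → ℝ} {s : ℝ} :
    {x | s ≤ |w x|} ⊆ {x | s / 2 ≤ |m x|} ∪ {x | s / 2 ≤ |m x - w x|} := by
  intro x hx
  simp only [mem_ofPred_eq, mem_union] at hx ⊢
  by_contra! hcon
  have : |w x| ≤ |m x| + |m x - w x| := by
    have := abs_sub (m x) (m x - w x)
    simpa using this
  linarith

/-- **Rellich**: a bounded weakly convergent sequence in `H¹` has a subsequence converging almost
everywhere. -/
lemma WeakTendsto.exists_subseq_ae {u : ℕ → E N → ℝ} {u₀ : E N → ℝ} (h : WeakTendsto u u₀) {C : ℝ}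
    (hg : ∀ n, gradSq (u n) ≤ C) :
    ∃ φ : ℕ → ℕ, StrictMono φ ∧ ∀ᵐ x, Tendsto (fun n => u (φ n) x) atTop (𝓝 (u₀ x)) := by
  obtain ⟨ν, hν, hνle, hac⟩ := exists_finite_measure_le N
  set w : ℕ → E N → ℝ := fun n x => u n x - u₀ x with hw
  have hw0 : WeakTendsto w 0 := h.sub_lim
  set G := 2 * C + 2 * gradSq u₀ with hG
  have hwG : ∀ n, gradSq (w n) ≤ G := fun n =>
    ((h.memH1 n).gradSq_sub_le h.memH1_lim).trans (by have := hg n; linarith)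
  have hG0 : 0 ≤ G := (gradSq_nonneg _).trans (hwG 0)
  -- If w_n is large, then either its mollification is large, which has small ν-measure since
  -- mollifications tend to zero pointwise, or it differs from its mollification. The latter set is
  -- small uniformly in n by the gradient bound, so the bump can be fixed before n.
  have key : ∀ s : ℝ, 0 < s → Tendsto (fun n => ν {x | s ≤ |w n x|}) atTop (𝓝 0) := by
    intro s hs
    rw [ENNReal.tendsto_nhds_zero]
    intro ε hε
    obtain ⟨d, hd0, hd⟩ : ∃ d : ℝ, 0 < d ∧ ENNReal.ofReal d ≤ ε / 2 := by
      rcases eq_or_ne ε ⊤ with rfl | hε'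
      · exact ⟨1, one_pos, by simp [ENNReal.top_div]⟩
      · refine ⟨(ε / 2).toReal, ENNReal.toReal_pos (ENNReal.half_pos hε.ne').ne' ?_, ?_⟩
        · exact (ENNReal.div_lt_top hε' (by norm_num)).ne
        · exact ENNReal.ofReal_toReal_le
    obtain ⟨ρ, hρ⟩ := exists_bump_small (N := N) G (s / 2) hd0
    have hm : TendstoInMeasure ν (fun n => moll ρ (w n)) atTop 0 := by
      refine tendstoInMeasure_of_tendsto_ae (fun n => ?_) (Eventually.of_forall fun x => ?_)
      · exact (contDiff_moll ρ (locallyIntegrable_of_memLp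
          (hw0.memH1 n).1)).continuous.aestronglyMeasurable
      · have := hw0.tendsto_moll ρ x
        simpa [moll_apply] using this
    have h2 := (ENNReal.tendsto_nhds_zero.1 (hm (ENNReal.ofReal (s / 2))
      (by simpa using hs))) (ε / 2) (ENNReal.half_pos hε.ne')
    filter_upwards [h2] with n hn
    calc ν {x | s ≤ |w n x|}
        ≤ ν {x | s / 2 ≤ |moll ρ (w n) x|} + ν {x | s / 2 ≤ |moll ρ (w n) x - w n x|} :=
          (measure_mono setOf_le_abs_subset).trans (measure_union_le _ _)
      _ ≤ ε / 2 + ε / 2 := by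
          refine add_le_add ?_ ?_
          · refine le_trans (measure_mono fun x hx => ?_) hn
            simp only [mem_ofPred_eq] at hx ⊢
            rw [edist_dist, dist_eq_norm]
            exact ENNReal.ofReal_le_ofReal (by simpa using hx)
          · refine (hνle _).trans (((hw0.memH1 n).volume_moll_sub_ge ρ (half_pos hs)).trans
              (le_trans (ENNReal.ofReal_le_ofReal ?_) hd))
            refine le_trans ?_ hρ
            gcongr
            exact hwG n
      _ = ε := ENNReal.add_halves ε
  have hmeas : TendstoInMeasure ν u atTop u₀ := by
    intro ε hε
    rcases eq_or_ne ε ⊤ with rfl | hε'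
    · simp [edist_ne_top]
    · have := key ε.toReal (ENNReal.toReal_pos hε.ne' hε')
      refine this.congr fun n => ?_
      congr 1
      ext x
      simp only [mem_ofPred_eq]
      rw [edist_dist, dist_eq_norm, ENNReal.le_ofReal_iff_toReal_le hε' (norm_nonneg _)]
      rfl
  obtain ⟨φ, hφ, hae⟩ := hmeas.exists_seq_tendsto_ae
  exact ⟨φ, hφ, hac.ae_le hae⟩

lemma moll_comp_add (ρ : ContDiffBump (0 : E N)) (u : E N → ℝ) (y x : E N) :
    moll ρ (fun z => u (z + y)) x = moll ρ u (x + y) := by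
  rw [moll_apply, moll_apply]
  simp_rw [sub_add_eq_add_sub]

/-- A bounded weakly null sequence in `H¹` which does not vanish in measure has translates, by
vectors tending to infinity, with a nonzero weak limit. -/
lemma WeakTendsto.exists_translate {u : ℕ → E N → ℝ} {u₀ : E N → ℝ} (h : WeakTendsto u u₀)
    (h0 : u₀ =ᵐ[volume] 0) {C : ℝ} (hg : ∀ n, gradSq (u n) ≤ C) (hm : ∀ n, massSq (u n) ≤ C)
    {s δ : ℝ} (hs : 0 < s) (hδ : 0 < δ)
    (hvol : ∀ n, ENNReal.ofReal δ ≤ volume {x | s ≤ |u n x|}) :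
    ∃ (v : E N → ℝ) (y : ℕ → E N) (φ : ℕ → ℕ), StrictMono φ ∧ Tendsto (fun n => ‖y n‖) atTop atTop ∧
      WeakTendsto (fun n x => u (φ n) (x + y n)) v ∧ ¬ v =ᵐ[volume] 0 := by
  have hC0 : 0 ≤ C := (gradSq_nonneg _).trans (hg 0)
  obtain ⟨ρ, hρ⟩ := exists_bump_small (N := N) C (s / 2) (half_pos (half_pos hδ))
  -- far away points where the mollification is not small
  have hfar : ∀ R : ℕ, ∀ᶠ n in atTop, ∃ y : E N, (R : ℝ) ≤ ‖y‖ ∧ s / 2 ≤ |moll ρ (u n) y| := by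
    intro R
    have hm0 : TendstoInMeasure (volume.restrict (Metric.ball (0 : E N) R))
        (fun n => moll ρ (u n)) atTop 0 := by
      have : IsFiniteMeasure (volume.restrict (Metric.ball (0 : E N) R)) :=
        ⟨by simpa using measure_ball_lt_top⟩
      refine tendstoInMeasure_of_tendsto_ae (fun n => ?_) (Eventually.of_forall fun x => ?_)
      · exact (contDiff_moll ρ (locallyIntegrable_of_memLp
          (h.memH1 n).1)).continuous.aestronglyMeasurable
      · have := h.tendsto_moll ρ x
        have e : moll ρ u₀ x = 0 := by
          rw [moll_eq_integral_mul]
          have : (fun y => u₀ y * ρ.normed volume (x - y)) =ᵐ[volume] 0 := by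
            filter_upwards [h0] with y hy
            rw [hy]
            simp
          rw [integral_congr_ae this]
          simp
        rwa [e] at this
    have h2 := (ENNReal.tendsto_nhds_zero.1 (hm0 (ENNReal.ofReal (s / 2))
      (by simpa using hs))) (ENNReal.ofReal (δ / 2 / 2)) (by simpa using hδ)
    filter_upwards [h2] with n hn
    by_contra! hcon
    -- If the mollification were below s/2 at every point outside the ball, the level set would be
    -- covered by two sets of measure at most δ/4 each, contradicting its lower bound δ.
    have hsub : {x | s ≤ |u n x|} ⊆ ({x | ENNReal.ofReal (s / 2) ≤ edist (moll ρ (u n) x) 0}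
        ∩ Metric.ball 0 R) ∪ {x | s / 2 ≤ |moll ρ (u n) x - u n x|} := by
      intro x hx
      rcases setOf_le_abs_subset (m := moll ρ (u n)) hx with h3 | h3
      · refine Or.inl ⟨?_, ?_⟩
        · simp only [mem_ofPred_eq] at h3 ⊢
          rw [edist_dist, dist_eq_norm]
          exact ENNReal.ofReal_le_ofReal (by simpa using h3)
        · rw [mem_ball_zero_iff]
          by_contra! hR
          exact absurd (hcon x hR) (not_lt.2 h3)
      · exact Or.inr h3
    have h3 := (hvol n).trans ((measure_mono hsub).trans (measure_union_le _ _))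
    rw [Measure.restrict_apply' measurableSet_ball] at hn
    have h4 := (h.memH1 n).volume_moll_sub_ge ρ (half_pos hs)
    have h5 : ENNReal.ofReal (ρ.rOut ^ 2 * gradSq (u n) / (s / 2) ^ 2)
        ≤ ENNReal.ofReal (δ / 2 / 2) := by
      refine ENNReal.ofReal_le_ofReal (le_trans ?_ hρ)
      gcongr
      exact hg n
    have h6 := h3.trans (add_le_add hn (h4.trans h5))
    rw [← ENNReal.ofReal_add (by positivity) (by positivity),
      ENNReal.ofReal_le_ofReal_iff (by positivity)] at h6
    linarith
  obtain ⟨φ, hφ, hy⟩ := extraction_forall_of_eventually hfar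
  choose y hyR hys using hy
  have hU : ∀ n, MemH1 fun x => u (φ n) (x + y n) := fun n => (h.memH1 _).comp_add _
  obtain ⟨v, ψ, hψ, hv⟩ := exists_weakTendsto hU (C := C)
    (fun n => by rw [(h.memH1 _).gradSq_comp_add]; exact hg _)
    (fun n => by rw [massSq_comp_add]; exact hm _)
  refine ⟨v, y ∘ ψ, φ ∘ ψ, hφ.comp hψ, ?_, hv, fun hv0 => ?_⟩
  · exact (tendsto_atTop_mono hyR tendsto_natCast_atTop_atTop).comp hψ.tendsto_atTop
  -- The translations place the points with |mollification| ≥ s/2 at the origin. This bound passes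
  -- to the weak limit, whose mollification at 0 is therefore nonzero.
  · have h1 := hv.tendsto_moll ρ 0
    simp_rw [moll_comp_add, zero_add] at h1
    have e : moll ρ v 0 = 0 := by
      rw [moll_eq_integral_mul]
      have : (fun y => v y * ρ.normed volume (0 - y)) =ᵐ[volume] 0 := by
        filter_upwards [hv0] with y hy
        rw [hy]
        simp
      rw [integral_congr_ae this]
      simp
    rw [e] at h1
    have h2 := ge_of_tendsto' h1.abs fun n => hys (ψ n)
    simp at h2
    linarith

end WeakConvergence

/-! ### Pointwise estimates for f and F in terms of t² + |t|^(2*). -/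

section Growth

/-- The function `t² + |t|^{2*}` controlling all the nonlinear terms. -/
def growth (N : ℕ) (t : ℝ) : ℝ := t ^ 2 + |t| ^ sobExp N

variable {N : ℕ} {α : ℝ} {f : ℝ → ℝ}

lemma two_le_sobExp (hN : 3 ≤ N) : 2 ≤ sobExp N := by
  have hN' : (3 : ℝ) ≤ N := by exact_mod_cast hN
  unfold sobExp
  rw [le_div_iff₀ (by linarith)]
  linarith

lemma growth_nonneg (t : ℝ) : 0 ≤ growth N t := by
  unfold growth
  positivity

lemma growth_abs (t : ℝ) : growth N |t| = growth N t := by simp [growth]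

lemma growth_mono (hN : 3 ≤ N) {s t : ℝ} (h : |s| ≤ |t|) : growth N s ≤ growth N t := by
  have := sobExp_pos hN
  unfold growth
  rw [← sq_abs s, ← sq_abs t]
  gcongr

lemma continuous_growth (hN : 3 ≤ N) : Continuous (growth N) := by
  unfold growth
  have := sobExp_pos hN
  exact (continuous_id.pow 2).add (continuous_abs.rpow_const fun _ => Or.inr this.le)

lemma growth_zero (hN : 3 ≤ N) : growth N 0 = 0 := by
  simp [growth, (sobExp_pos hN).ne']

lemma growth_mul_le (hN : 3 ≤ N) {L : ℝ} (hL : 1 ≤ L) (t : ℝ) :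
    growth N (L * t) ≤ L ^ sobExp N * growth N t := by
  have h2 := two_le_sobExp hN
  unfold growth
  rw [abs_mul, abs_of_pos (by linarith), Real.mul_rpow (by linarith) (abs_nonneg t), mul_pow,
    mul_add]
  gcongr
  rw [← Real.rpow_natCast]
  exact Real.rpow_le_rpow_of_exponent_le hL (by exact_mod_cast h2)

lemma growth_add_le (hN : 3 ≤ N) (s t : ℝ) :
    growth N (|s| + |t|) ≤ 2 ^ sobExp N * (growth N s + growth N t) := by
  wlog h : |s| ≤ |t| generalizing s t
  · rw [add_comm, add_comm (growth N s)]
    exact this t s (le_of_not_ge h)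
  calc growth N (|s| + |t|) ≤ growth N (2 * t) := by
        refine growth_mono hN ?_
        rw [abs_mul, abs_two, abs_of_nonneg (by positivity)]
        linarith
    _ ≤ 2 ^ sobExp N * growth N t := growth_mul_le hN (by norm_num) t
    _ ≤ _ := by
        gcongr
        have := growth_nonneg (N := N) s
        linarith

lemma add_rpow_le_two_mul {a b p : ℝ} (ha : 0 ≤ a) (hb : 0 ≤ b) (hp : 1 ≤ p) :
    (a + b) ^ p ≤ 2 ^ (p - 1) * (a ^ p + b ^ p) := by
  have := NNReal.rpow_add_le_mul_rpow_add_rpow ⟨a, ha⟩ ⟨b, hb⟩ hp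
  exact_mod_cast this

@[simp] lemma primitive_zero : primitive f 0 = 0 := by simp [primitive]

/-- The standing assumptions on the dimension, on `α` and on the nonlinearity. -/
structure NonlinearityHyp (N : ℕ) (α : ℝ) (f : ℝ → ℝ) : Prop where
  three_le : 3 ≤ N
  pos : 0 < α
  lt : α < N
  f1 : CondF1 N α f
  f2 : CondF2 N α f

namespace NonlinearityHyp

lemma N_pos (H : NonlinearityHyp N α f) : 0 < N := by have := H.three_le; omega

lemma three_le' (H : NonlinearityHyp N α f) : (3 : ℝ) ≤ N := by exact_mod_cast H.three_le

lemma hasDerivAt_primitive (H : NonlinearityHyp N α f) (t : ℝ) : HasDerivAt (primitive f) (f t) t :=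
  intervalIntegral.integral_hasDerivAt_right (H.f1.1.intervalIntegrable _ _)
    (H.f1.1.stronglyMeasurableAtFilter _ _) H.f1.1.continuousAt

lemma continuous_primitive (H : NonlinearityHyp N α f) : Continuous (primitive f) :=
  continuous_iff_continuousAt.2 fun t => (H.hasDerivAt_primitive t).continuousAt

/-- Together with `hls_mul_high`, this explains the exponents in (F1): raised to the power 2N/(N+α),
the two growth rates of F become t² and |t|^(2*), the powers that H¹ controls. -/
lemma hls_mul_low (H : NonlinearityHyp N α f) : hlsExp N α * ((N + α) / N) = 2 := by
  have h1 := H.three_le'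
  have h2 := H.pos
  unfold hlsExp
  field_simp

lemma hls_mul_high (H : NonlinearityHyp N α f) : hlsExp N α * ((N + α) / (N - 2)) = sobExp N := by
  have h1 := H.three_le'
  have h2 := H.pos
  have h3 : (N : ℝ) - 2 ≠ 0 := by linarith
  unfold hlsExp sobExp
  field_simp

/-- Away from t = 0, divide (F1) by |t|. Both resulting exponents are positive, so both sides are
continuous and the inequality extends to t = 0 by density. -/
lemma exists_abs_f_le (H : NonlinearityHyp N α f) : ∃ C : ℝ, 0 < C ∧ ∀ t, |f t|
    ≤ C * (|t| ^ (((N : ℝ) + α) / N - 1) + |t| ^ (((N : ℝ) + α) / (N - 2) - 1)) := by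
  have h1 := H.three_le'
  have h2 := H.pos
  obtain ⟨C, hC, hf⟩ := H.f1.2
  refine ⟨C, hC, ?_⟩
  have e1 : 0 < ((N : ℝ) + α) / N - 1 := by
    rw [sub_pos, lt_div_iff₀ (by linarith)]
    linarith
  have e2 : 0 < ((N : ℝ) + α) / (N - 2) - 1 := by
    rw [sub_pos, lt_div_iff₀ (by linarith)]
    linarith
  have hcl : IsClosed {t : ℝ | |f t|
      ≤ C * (|t| ^ (((N : ℝ) + α) / N - 1) + |t| ^ (((N : ℝ) + α) / (N - 2) - 1))} := by
    refine isClosed_le H.f1.1.abs (continuous_const.mul ?_)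
    exact (continuous_abs.rpow_const fun _ => Or.inr e1.le).add
      (continuous_abs.rpow_const fun _ => Or.inr e2.le)
  have hsub : ({0}ᶜ : Set ℝ) ⊆ {t : ℝ | |f t|
      ≤ C * (|t| ^ (((N : ℝ) + α) / N - 1) + |t| ^ (((N : ℝ) + α) / (N - 2) - 1))} := by
    intro t ht
    have ht' : 0 < |t| := abs_pos.2 ht
    have := hf t
    rw [abs_mul] at this
    simp only [mem_ofPred_eq]
    rw [Real.rpow_sub_one ht'.ne', Real.rpow_sub_one ht'.ne', ← add_div, mul_div_assoc',
      le_div_iff₀ ht']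
    exact this
  intro t
  have := closure_minimal hsub hcl
  rw [(dense_compl_singleton (0 : ℝ)).closure_eq] at this
  exact this (mem_univ t)

/-- Lipschitz-type estimate for the primitive. -/
lemma exists_primitive_sub_le (H : NonlinearityHyp N α f) : ∃ C : ℝ, 0 < C ∧ ∀ a b m d : ℝ, 0 ≤ d → |a| ≤ m → |b| ≤ m →
    |a - b| ≤ d * m →
    |primitive f a - primitive f b| ^ hlsExp N α ≤ C * d ^ hlsExp N α * growth N m := by
  have h1 := H.three_le'
  have h2 := H.pos
  have hp := hlsExp_pos H.N_pos H.pos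
  have hp1 := one_lt_hlsExp H.pos H.lt
  obtain ⟨C, hC, hf⟩ := H.exists_abs_f_le
  set q₁ := ((N : ℝ) + α) / N
  set q₂ := ((N : ℝ) + α) / (N - 2)
  have e1 : 0 < q₁ - 1 := by
    simp only [q₁]
    rw [sub_pos, lt_div_iff₀ (by linarith)]
    linarith
  have e2 : 0 < q₂ - 1 := by
    simp only [q₂]
    rw [sub_pos, lt_div_iff₀ (by linarith)]
    linarith
  refine ⟨C ^ hlsExp N α * 2 ^ (hlsExp N α - 1), by positivity, fun a b m d hd ha hb hab => ?_⟩
  have hm : 0 ≤ m := (abs_nonneg a).trans ha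
  have hF : primitive f a - primitive f b = ∫ s in b..a, f s :=
    intervalIntegral.integral_interval_sub_left (H.f1.1.intervalIntegrable _ _)
      (H.f1.1.intervalIntegrable _ _)
  -- The interval has length at most d m, which restores the power of m lost in passing from F to f.
  -- Later d is 1 for the growth bound, a small ratio for the splitting, and the step of a
  -- difference quotient.
  have hle : |primitive f a - primitive f b| ≤ C * d * (m ^ q₁ + m ^ q₂) := by
    rw [hF, ← Real.norm_eq_abs]
    have h3 : ∀ s ∈ uIoc b a, ‖f s‖ ≤ C * (m ^ (q₁ - 1) + m ^ (q₂ - 1)) := by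
      intro s hs
      have hsm : |s| ≤ m := by
        rw [abs_le] at ha hb ⊢
        rcases le_total b a with hba | hba
        · rw [uIoc_of_le hba] at hs
          exact ⟨by linarith [hs.1], by linarith [hs.2]⟩
        · rw [uIoc_of_ge hba] at hs
          exact ⟨by linarith [hs.1], by linarith [hs.2]⟩
      refine (hf s).trans ?_
      gcongr
    refine (intervalIntegral.norm_integral_le_of_norm_le_const h3).trans ?_
    have hmul : ∀ q : ℝ, 0 < q - 1 → m ^ (q - 1) * m = m ^ q := by
      intro q hq
      rcases hm.eq_or_lt with h | h
      · rw [← h, mul_zero, Real.zero_rpow (by linarith)]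
      · rw [Real.rpow_sub_one h.ne', div_mul_cancel₀ _ h.ne']
    calc C * (m ^ (q₁ - 1) + m ^ (q₂ - 1)) * |a - b|
        ≤ C * (m ^ (q₁ - 1) + m ^ (q₂ - 1)) * (d * m) := by gcongr
      _ = C * d * (m ^ (q₁ - 1) * m + m ^ (q₂ - 1) * m) := by ring
      _ = _ := by rw [hmul q₁ e1, hmul q₂ e2]
  calc |primitive f a - primitive f b| ^ hlsExp N α
      ≤ (C * d * (m ^ q₁ + m ^ q₂)) ^ hlsExp N α := by gcongr
    _ = C ^ hlsExp N α * d ^ hlsExp N α * (m ^ q₁ + m ^ q₂) ^ hlsExp N α := by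
        rw [Real.mul_rpow (by positivity) (by positivity), Real.mul_rpow hC.le hd]
    _ ≤ C ^ hlsExp N α * d ^ hlsExp N α *
        (2 ^ (hlsExp N α - 1) * ((m ^ q₁) ^ hlsExp N α + (m ^ q₂) ^ hlsExp N α)) := by
        gcongr
        exact add_rpow_le_two_mul (by positivity) (by positivity) hp1.le
    _ = _ := by
        rw [← Real.rpow_mul hm, ← Real.rpow_mul hm, mul_comm q₁, mul_comm q₂, H.hls_mul_low,
          H.hls_mul_high]
        unfold growth
        rw [abs_of_nonneg hm, Real.rpow_two]
        ring

lemma exists_primitive_le (H : NonlinearityHyp N α f) : ∃ C : ℝ, 0 < C ∧ ∀ t : ℝ,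
    |primitive f t| ^ hlsExp N α ≤ C * growth N t := by
  obtain ⟨C, hC, h⟩ := H.exists_primitive_sub_le
  refine ⟨C, hC, fun t => ?_⟩
  have := h t 0 |t| 1 zero_le_one le_rfl (by simp) (by simp)
  simpa [primitive_zero, growth_abs] using this

/-- The pointwise Brezis–Lieb inequality. -/
lemma exists_brezisLieb_pointwise (H : NonlinearityHyp N α f) {ε : ℝ} (hε : 0 < ε) : ∃ C : ℝ, 0 < C ∧ ∀ a b : ℝ,
    |primitive f (a + b) - primitive f a - primitive f b| ^ hlsExp N α
      ≤ ε * growth N a + C * growth N b := by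
  have hp := hlsExp_pos H.N_pos H.pos
  have hp1 := one_lt_hlsExp H.pos H.lt
  have hN := H.three_le
  obtain ⟨C, hC, hL⟩ := H.exists_primitive_sub_le
  obtain ⟨C', hC', hF⟩ := H.exists_primitive_le
  set p := hlsExp N α
  set A := 2 ^ (p - 1) * C * 2 ^ sobExp N with hA
  have hA0 : 0 < A := by positivity
  obtain ⟨δ, hδ0, hδ1, hδ⟩ : ∃ δ : ℝ, 0 < δ ∧ δ ≤ 1 ∧ A * δ ^ p ≤ ε := by
    refine ⟨min 1 ((ε / A) ^ (1 / p)), by positivity, min_le_left _ _, ?_⟩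
    calc A * (min 1 ((ε / A) ^ (1 / p))) ^ p ≤ A * ((ε / A) ^ (1 / p)) ^ p := by
          gcongr
          exact min_le_right _ _
      _ = ε := by
          rw [← Real.rpow_mul (by positivity), one_div_mul_cancel hp.ne', Real.rpow_one]
          field_simp
  set L := 1 + 1 / δ with hLdef
  have hL1 : 1 ≤ L := by
    rw [hLdef]
    have : 0 < 1 / δ := by positivity
    linarith
  refine ⟨2 ^ (p - 1) * C' + 3 ^ p * (C' * L ^ sobExp N), by positivity, fun a b => ?_⟩
  have ga := growth_nonneg (N := N) a
  have gb := growth_nonneg (N := N) b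
  -- When b is small relative to a, the Lipschitz-type estimate charges F(a+b) - F(a) to a with the
  -- small factor δ^p. Otherwise |a| and |a+b| are at most L|b|, and all three terms are charged to
  -- b.
  rcases le_or_gt |b| (δ * |a|) with hab | hab
  · have h1 : |primitive f (a + b) - primitive f a| ^ p ≤ C * δ ^ p * growth N (2 * |a|) := by
      refine hL (a + b) a (2 * |a|) δ hδ0.le ?_ ?_ ?_
      · have := abs_add_le a b
        nlinarith [abs_nonneg a]
      · linarith [abs_nonneg a]
      · rw [add_sub_cancel_left]
        nlinarith [abs_nonneg a]
    have h2 : growth N (2 * |a|) ≤ 2 ^ sobExp N * growth N a := by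
      have := growth_mul_le hN (by norm_num : (1 : ℝ) ≤ 2) |a|
      rwa [growth_abs] at this
    calc |primitive f (a + b) - primitive f a - primitive f b| ^ p
        ≤ (|primitive f (a + b) - primitive f a| + |primitive f b|) ^ p := by
          gcongr
          exact abs_sub _ _
      _ ≤ 2 ^ (p - 1) * (|primitive f (a + b) - primitive f a| ^ p + |primitive f b| ^ p) :=
          add_rpow_le_two_mul (abs_nonneg _) (abs_nonneg _) hp1.le
      _ ≤ 2 ^ (p - 1) * (C * δ ^ p * (2 ^ sobExp N * growth N a) + C' * growth N b) := by
          gcongr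
          · exact h1.trans (by gcongr)
          · exact hF b
      _ = A * δ ^ p * growth N a + 2 ^ (p - 1) * C' * growth N b := by
          rw [hA]
          ring
      _ ≤ ε * growth N a + (2 ^ (p - 1) * C' + 3 ^ p * (C' * L ^ sobExp N)) * growth N b := by
          gcongr
          have : 0 ≤ 3 ^ p * (C' * L ^ sobExp N) := by positivity
          linarith
  · have hal : |a| ≤ 1 / δ * |b| := by
      rw [one_div_mul_eq_div, le_div_iff₀ hδ0]
      linarith
    have hbound : ∀ t : ℝ, |t| ≤ L * |b| →
        |primitive f t| ≤ (C' * L ^ sobExp N * growth N b) ^ (1 / p) := by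
      intro t ht
      have h1 : |primitive f t| ^ p ≤ C' * L ^ sobExp N * growth N b := by
        calc |primitive f t| ^ p ≤ C' * growth N t := hF t
          _ ≤ C' * growth N (L * |b|) := by
              gcongr
              refine growth_mono hN ?_
              rwa [abs_of_nonneg (a := L * |b|) (by positivity)]
          _ ≤ C' * (L ^ sobExp N * growth N |b|) := by
              gcongr
              exact growth_mul_le hN hL1 _
          _ = _ := by
              rw [growth_abs]
              ring
      calc |primitive f t| = (|primitive f t| ^ p) ^ (1 / p) := by
            rw [← Real.rpow_mul (abs_nonneg _), mul_one_div_cancel hp.ne', Real.rpow_one]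
        _ ≤ _ := by gcongr
    have b0 := abs_nonneg b
    have h1 := hbound (a + b) (by
      have := abs_add_le a b
      rw [hLdef]
      linarith)
    have h2 := hbound a (by rw [hLdef]; linarith)
    have h3 := hbound b (by nlinarith)
    set B := (C' * L ^ sobExp N * growth N b) ^ (1 / p) with hB
    have hBp : B ^ p = C' * L ^ sobExp N * growth N b := by
      rw [hB, ← Real.rpow_mul (by positivity), one_div_mul_cancel hp.ne', Real.rpow_one]
    have h4 : |primitive f (a + b) - primitive f a - primitive f b| ≤ 3 * B := by
      have h5 := abs_sub (primitive f (a + b) - primitive f a) (primitive f b)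
      have h6 := abs_sub (primitive f (a + b)) (primitive f a)
      linarith
    calc |primitive f (a + b) - primitive f a - primitive f b| ^ p ≤ (3 * B) ^ p := by gcongr
      _ = 3 ^ p * (C' * L ^ sobExp N) * growth N b := by
          rw [Real.mul_rpow (by norm_num) (by positivity), hBp]
          ring
      _ ≤ _ := by
          have h5 : 0 ≤ 2 ^ (p - 1) * C' * growth N b := by positivity
          have h6 : 0 ≤ ε * growth N a := by positivity
          linarith

/-- Subcriticality of the primitive at both ends. -/
lemma exists_primitive_small (H : NonlinearityHyp N α f) {ε : ℝ} (hε : 0 < ε) : ∃ δ M : ℝ, 0 < δ ∧ 0 < M ∧ ∀ t : ℝ,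
    |primitive f t| ^ hlsExp N α ≤ ε * growth N t + (if δ ≤ |t| then M else 0) := by
  have hp := hlsExp_pos H.N_pos H.pos
  have hN := H.three_le
  obtain ⟨C, hC, hF⟩ := H.exists_primitive_le
  have hlow := H.hls_mul_low
  have hhigh := H.hls_mul_high
  set p := hlsExp N α
  set η := ε ^ (1 / p) with hη
  have hη0 : 0 < η := by positivity
  have hηp : η ^ p = ε := by
    rw [hη, ← Real.rpow_mul hε.le, one_div_mul_cancel hp.ne', Real.rpow_one]
  obtain ⟨h0, hinf⟩ := H.f2
  have h0' := h0.bound hη0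
  have hinf' := hinf.bound hη0
  rw [Metric.eventually_nhds_iff] at h0'
  obtain ⟨δ, hδ, h0'⟩ := h0'
  obtain ⟨T, hT⟩ : ∃ T : ℝ, ∀ t : ℝ, T < |t| → ‖primitive f t‖
      ≤ η * ‖|t| ^ (((N : ℝ) + α) / ((N : ℝ) - 2))‖ := by
    rw [← Metric.cobounded_eq_cocompact] at hinf'
    rw [Metric.hasBasis_cobounded_compl_closedBall (0 : ℝ) |>.eventually_iff] at hinf'
    obtain ⟨T, -, hT⟩ := hinf'
    refine ⟨T, fun t ht => hT ?_⟩
    simpa using ht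
  have e1 : ∀ q t : ℝ, ‖primitive f t‖ ≤ η * ‖|t| ^ q‖ →
      |primitive f t| ^ p ≤ ε * |t| ^ (p * q) := by
    intro q t h
    rw [Real.norm_eq_abs, Real.norm_of_nonneg (by positivity)] at h
    calc |primitive f t| ^ p ≤ (η * |t| ^ q) ^ p := by gcongr
      _ = _ := by
        rw [Real.mul_rpow hη0.le (by positivity), hηp, ← Real.rpow_mul (abs_nonneg t), mul_comm q]
  -- The little-o conditions cover |t| < δ and |t| > T. In between, the growth bound at T is enough;
  -- the summand 1 only makes M positive.
  refine ⟨δ, C * growth N T + 1, hδ, ?_, fun t => ?_⟩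
  · have := growth_nonneg (N := N) T
    positivity
  · have gt := growth_nonneg (N := N) T
    have gt' := growth_nonneg (N := N) t
    split_ifs with h
    · rcases lt_or_ge T |t| with hTt | hTt
      · have h1 := e1 _ t (hT t hTt)
        rw [hhigh] at h1
        have h2 : |t| ^ sobExp N ≤ growth N t := by
          unfold growth
          have := sq_nonneg t
          linarith
        have h3 : 0 ≤ C * growth N T + 1 := by positivity
        have h4 := mul_le_mul_of_nonneg_left h2 hε.le
        linarith
      · have h1 := hF t
        have h2 : growth N t ≤ growth N T := growth_mono hN (hTt.trans (le_abs_self T))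
        have h3 := mul_le_mul_of_nonneg_left h2 hC.le
        have h4 : 0 ≤ ε * growth N t := by positivity
        linarith
    · have h1 := e1 _ t (h0' (by simpa using h))
      rw [hlow] at h1
      have h2 : |t| ^ (2 : ℝ) ≤ growth N t := by
        unfold growth
        rw [Real.rpow_two, sq_abs]
        have := Real.rpow_nonneg (abs_nonneg t) (sobExp N)
        linarith
      have h4 := mul_le_mul_of_nonneg_left h2 hε.le
      linarith

end NonlinearityHyp

end Growth

/-! ### Integrability and bounds for the nonlocal term on H¹. -/

section NonlocalTerm

variable {N : ℕ} {α : ℝ} {f : ℝ → ℝ}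

lemma MemH1.integrable_rpow (hN : 3 ≤ N) {u : E N → ℝ} (hu : MemH1 u) :
    Integrable fun x => |u x| ^ sobExp N := by
  obtain ⟨C, hC, h⟩ := exists_sobolev hN
  have hs := sobExp_pos hN
  have h1 : MemLp u (ENNReal.ofReal (sobExp N)) :=
    ⟨hu.1.1, (h u _ hu.isH1).trans_lt (ENNReal.mul_lt_top hC.lt_top hu.isH1.memLp_grad.2)⟩
  have := h1.integrable_norm_rpow (by simpa using hs) ENNReal.ofReal_ne_top
  rwa [ENNReal.toReal_ofReal hs.le] at this

lemma MemH1.integrable_growth (hN : 3 ≤ N) {u : E N → ℝ} (hu : MemH1 u) :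
    Integrable fun x => growth N (u x) :=
  hu.integrable_sq.add (hu.integrable_rpow hN)

lemma MemH1.eLpNorm_grad {u : E N → ℝ} (hu : MemH1 u) :
    eLpNorm (weakGradient u) 2 volume = ENNReal.ofReal (gradSq u ^ (1 / 2 : ℝ)) := by
  have h := hu.eLpNorm_grad_sq
  rw [← ENNReal.ofReal_rpow_of_nonneg (gradSq_nonneg u) (by norm_num), ← h, ← ENNReal.rpow_two,
    ← ENNReal.rpow_mul]
  norm_num

/-- The Sobolev inequality raised to the power 2*; the halved exponent appears because `gradSq` is
already a square. -/
lemma exists_integral_growth_le (hN : 3 ≤ N) : ∃ C : ℝ, 0 < C ∧ ∀ u : E N → ℝ, MemH1 u →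
    ∫ x, growth N (u x) ≤ massSq u + C * gradSq u ^ (sobExp N / 2) := by
  obtain ⟨C, hC, h⟩ := exists_sobolev hN
  have hs := sobExp_pos hN
  refine ⟨C.toReal ^ sobExp N + 1, by positivity, fun u hu => ?_⟩
  have h1 : ∫ x, |u x| ^ sobExp N ≤ C.toReal ^ sobExp N * gradSq u ^ (sobExp N / 2) := by
    have h2 := h u _ hu.isH1
    rw [hu.eLpNorm_grad, eLpNorm_eq_lintegral_rpow_enorm_toReal (by simpa using hs)
      ENNReal.ofReal_ne_top, ENNReal.toReal_ofReal hs.le] at h2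
    have h3 := ENNReal.rpow_le_rpow h2 hs.le
    rw [← ENNReal.rpow_mul, one_div_mul_cancel hs.ne', ENNReal.rpow_one] at h3
    rw [integral_eq_lintegral_of_nonneg_ae (ae_of_all _ fun x => by positivity)
      (hu.integrable_rpow hN).1]
    have e1 : ∀ x, ENNReal.ofReal (|u x| ^ sobExp N) = ‖u x‖ₑ ^ sobExp N := by
      intro x
      rw [← ENNReal.ofReal_rpow_of_nonneg (abs_nonneg _) hs.le, ← Real.norm_eq_abs, ofReal_norm]
    simp_rw [e1]
    have e2 : (C * ENNReal.ofReal (gradSq u ^ (1 / 2 : ℝ))) ^ sobExp N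
        = ENNReal.ofReal (C.toReal ^ sobExp N * gradSq u ^ (sobExp N / 2)) := by
      have g0 := gradSq_nonneg u
      conv_lhs => rw [← ENNReal.ofReal_toReal hC]
      rw [← ENNReal.ofReal_mul (by positivity), ENNReal.ofReal_rpow_of_nonneg (by positivity) hs.le,
        Real.mul_rpow (by positivity) (by positivity), ← Real.rpow_mul g0]
      congr 3
      ring
    rw [e2] at h3
    exact ENNReal.toReal_le_of_le_ofReal (mul_nonneg (by positivity)
      (Real.rpow_nonneg (gradSq_nonneg u) _)) h3
  unfold growth
  rw [integral_add hu.integrable_sq (hu.integrable_rpow hN)]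
  have := Real.rpow_nonneg (gradSq_nonneg u) (sobExp N / 2)
  unfold massSq
  linarith

lemma enorm_rpow_eq {p : ℝ} (hp : 0 ≤ p) (r : ℝ) : ‖r‖ₑ ^ p = ENNReal.ofReal (|r| ^ p) := by
  rw [← ENNReal.ofReal_rpow_of_nonneg (abs_nonneg _) hp, ← Real.norm_eq_abs, ofReal_norm]

lemma lintegral_enorm_rpow_le {p : ℝ} (hp : 0 ≤ p) {h G : E N → ℝ} (hG : Integrable G)
    (hle : ∀ᵐ x, |h x| ^ p ≤ G x) : ∫⁻ x, ‖h x‖ₑ ^ p ≤ ENNReal.ofReal (∫ x, G x) := by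
  rw [ofReal_integral_eq_lintegral_ofReal hG
    (hle.mono fun x hx => (Real.rpow_nonneg (abs_nonneg _) _).trans hx)]
  refine lintegral_mono_ae (hle.mono fun x hx => ?_)
  rw [enorm_rpow_eq hp]
  exact ENNReal.ofReal_le_ofReal hx

lemma memLp_of_rpow_le (hN : 0 < N) (hα0 : 0 < α) {h G : E N → ℝ} (hh : AEStronglyMeasurable h)
    (hG : Integrable G) (hle : ∀ᵐ x, |h x| ^ hlsExp N α ≤ G x) : MemLp h (hlsExpE N α) := by
  have hp := hlsExp_pos hN hα0
  refine ⟨hh, ?_⟩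
  rw [eLpNorm_hlsExpE hN hα0]
  exact ENNReal.rpow_lt_top_of_nonneg (by positivity)
    ((lintegral_enorm_rpow_le hp.le hG hle).trans_lt ENNReal.ofReal_lt_top).ne

/-- Dominated convergence in `L^p`. -/
lemma tendsto_eLpNorm_zero_of_dominated (hN : 0 < N) (hα0 : 0 < α) {ι : Type*} {l : Filter ι}
    [l.IsCountablyGenerated] {h : ι → E N → ℝ} {G : E N → ℝ} (hh : ∀ i, AEStronglyMeasurable (h i))
    (hG : Integrable G) (hle : ∀ᶠ i in l, ∀ᵐ x, |h i x| ^ hlsExp N α ≤ G x)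
    (hlim : ∀ᵐ x, Tendsto (fun i => h i x) l (𝓝 0)) :
    Tendsto (fun i => eLpNorm (h i) (hlsExpE N α) volume) l (𝓝 0) := by
  have hp := hlsExp_pos hN hα0
  simp_rw [eLpNorm_hlsExpE hN hα0]
  have hcont : Continuous fun t : ℝ => |t| ^ hlsExp N α :=
    continuous_abs.rpow_const fun _ => Or.inr hp.le
  have hm : ∀ i, AEStronglyMeasurable fun x => |h i x| ^ hlsExp N α := fun i =>
    hcont.comp_aestronglyMeasurable (hh i)
  have hint : Tendsto (fun i => ∫ x, |h i x| ^ hlsExp N α) l (𝓝 (∫ _ : E N, (0 : ℝ))) := by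
    refine tendsto_integral_filter_of_dominated_convergence G (Eventually.of_forall hm) ?_ hG ?_
    · filter_upwards [hle] with i hi
      filter_upwards [hi] with x hx
      rwa [Real.norm_of_nonneg (by positivity)]
    · filter_upwards [hlim] with x hx
      have := (hcont.tendsto 0).comp hx
      simpa [Function.comp_def, hp.ne'] using this
  rw [integral_zero] at hint
  have key : Tendsto (fun i => ∫⁻ x, ‖h i x‖ₑ ^ hlsExp N α) l (𝓝 0) := by
    have h1 := ENNReal.tendsto_ofReal hint
    rw [ENNReal.ofReal_zero] at h1
    refine tendsto_of_tendsto_of_tendsto_of_le_of_le' tendsto_const_nhds h1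
      (Eventually.of_forall fun _ => zero_le) ?_
    filter_upwards [hle] with i hi
    refine lintegral_enorm_rpow_le hp.le (hG.mono' (hm i) ?_) (ae_of_all _ fun x => le_rfl)
    filter_upwards [hi] with x hx
    rwa [Real.norm_of_nonneg (by positivity)]
  have := ((ENNReal.continuous_rpow_const (y := 1 / hlsExp N α)).tendsto _).comp key
  simpa [Function.comp_def, hp] using this

/-- If `e_i → 0` in `L^p` and `a_i` is bounded in `L^p`, then `∬ e_i a_i → 0`. -/
lemma tendsto_rieszForm_zero (hN : 0 < N) (hα0 : 0 < α) (hαN : α < N) {ι : Type*} {l : Filter ι}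
    {e a : ι → E N → ℝ} (he : ∀ i, AEStronglyMeasurable (e i)) (ha : ∀ i, AEStronglyMeasurable (a i))
    (elim : Tendsto (fun i => eLpNorm (e i) (hlsExpE N α) volume) l (𝓝 0)) {M : ℝ≥0∞} (hM : M ≠ ⊤)
    (haM : ∀ i, eLpNorm (a i) (hlsExpE N α) volume ≤ M) :
    Tendsto (fun i => rieszForm α (e i) (a i)) l (𝓝 0) := by
  obtain ⟨C, hC, hH⟩ := exists_enorm_rieszForm_le hN hα0 hαN
  rw [tendsto_zero_iff_enorm_tendsto_zero]
  have h1 : Tendsto (fun i => C * eLpNorm (e i) (hlsExpE N α) volume * M) l (𝓝 0) := by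
    have := ENNReal.Tendsto.mul_const (ENNReal.Tendsto.const_mul elim (Or.inr hC)) (Or.inr hM)
    simpa using this
  refine tendsto_of_tendsto_of_tendsto_of_le_of_le tendsto_const_nhds h1 (fun _ => zero_le)
    fun i => (hH _ _ (he i) (ha i)).trans ?_
  gcongr
  exact haM i

lemma nonlocalTerm_eq (u : E N → ℝ) : nonlocalTerm α f u
    = rieszForm α (fun x => primitive f (u x)) (fun x => primitive f (u x)) := rfl

lemma nonlocalTerm_dilate {t : ℝ} (ht : 0 < t) (u : E N → ℝ) :
    nonlocalTerm α f (dilate t u) = t ^ ((N : ℝ) + α) * nonlocalTerm α f u :=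
  rieszForm_comp_smul ht (fun x => primitive f (u x)) (fun x => primitive f (u x))

lemma nonlocalTerm_comp_add (y : E N) (u : E N → ℝ) :
    nonlocalTerm α f (fun x => u (x + y)) = nonlocalTerm α f u :=
  rieszForm_comp_add y (fun x => primitive f (u x)) (fun x => primitive f (u x))

lemma nonlocalTerm_congr {u w : E N → ℝ} (h : u =ᵐ[volume] w) :
    nonlocalTerm α f u = nonlocalTerm α f w :=
  rieszForm_congr (h.fun_comp (primitive f)) (h.fun_comp (primitive f))

/-- A uniform bound for `∫ growth (u_n)` along bounded sequences. -/
lemma exists_growth_bound (hN : 3 ≤ N) (C : ℝ) : ∃ K : ℝ, 0 < K ∧ ∀ u : E N → ℝ, MemH1 u →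
    gradSq u ≤ C → massSq u ≤ C → ∫ x, growth N (u x) ≤ K := by
  obtain ⟨A, hA, h⟩ := exists_integral_growth_le hN
  have hs := sobExp_pos hN
  refine ⟨|C| + A * |C| ^ (sobExp N / 2) + 1, by positivity, fun u hu h1 h2 => (h u hu).trans ?_⟩
  have h3 : gradSq u ^ (sobExp N / 2) ≤ |C| ^ (sobExp N / 2) :=
    Real.rpow_le_rpow (gradSq_nonneg u) (h1.trans (le_abs_self C)) (by positivity)
  have h4 := mul_le_mul_of_nonneg_left h3 hA.le
  linarith [le_abs_self C]

namespace NonlinearityHyp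

lemma aestronglyMeasurable_primitive (H : NonlinearityHyp N α f) {u : E N → ℝ}
    (hu : AEStronglyMeasurable u) : AEStronglyMeasurable fun x => primitive f (u x) :=
  H.continuous_primitive.comp_aestronglyMeasurable hu

lemma memLp_primitive (H : NonlinearityHyp N α f) {u : E N → ℝ} (hu : MemH1 u) :
    MemLp (fun x => primitive f (u x)) (hlsExpE N α) := by
  obtain ⟨C, -, h⟩ := H.exists_primitive_le
  exact memLp_of_rpow_le H.N_pos H.pos (H.aestronglyMeasurable_primitive hu.1.1)
    ((hu.integrable_growth H.three_le).const_mul C) (ae_of_all _ fun x => h (u x))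

lemma exists_lintegral_primitive_le (H : NonlinearityHyp N α f) :
    ∃ C : ℝ, 0 < C ∧ ∀ u : E N → ℝ, MemH1 u →
      ∫⁻ x, ‖primitive f (u x)‖ₑ ^ hlsExp N α ≤ ENNReal.ofReal (C * ∫ x, growth N (u x)) := by
  obtain ⟨C, hC, h⟩ := H.exists_primitive_le
  refine ⟨C, hC, fun u hu => ?_⟩
  rw [← integral_const_mul]
  exact lintegral_enorm_rpow_le (hlsExp_pos H.N_pos H.pos).le
    ((hu.integrable_growth H.three_le).const_mul C) (ae_of_all _ fun x => h (u x))

/-- Hardy–Littlewood–Sobolev applied to F(u) twice, whence the exponent 2/p = (N+α)/N. That this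
exceeds 1 makes the nonlocal term negligible against the squared norm near zero. -/
lemma exists_abs_nonlocalTerm_le (H : NonlinearityHyp N α f) :
    ∃ C : ℝ, 0 < C ∧ ∀ u : E N → ℝ, MemH1 u →
      |nonlocalTerm α f u| ≤ C * (∫ x, growth N (u x)) ^ (((N : ℝ) + α) / N) := by
  obtain ⟨C, hC, hH⟩ := exists_enorm_rieszForm_le (N := N) H.N_pos H.pos H.lt
  obtain ⟨C', hC', hF⟩ := H.exists_lintegral_primitive_le
  have hp := hlsExp_pos H.N_pos H.pos
  have hN0 : (0 : ℝ) < N := by exact_mod_cast H.N_pos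
  have hα := H.pos
  refine ⟨(C.toReal + 1) * C' ^ (((N : ℝ) + α) / N), by positivity, fun u hu => ?_⟩
  have g0 : 0 ≤ ∫ x, growth N (u x) := integral_nonneg fun x => growth_nonneg _
  have h1 := hH _ _ (H.memLp_primitive hu).1 (H.memLp_primitive hu).1
  have e1 : (1 / hlsExp N α) * 2 = ((N : ℝ) + α) / N := by
    unfold hlsExp
    field_simp
  rw [mul_assoc, ← pow_two, eLpNorm_hlsExpE H.N_pos H.pos, ← ENNReal.rpow_two, ← ENNReal.rpow_mul, e1]
    at h1
  have h2 : ‖nonlocalTerm α f u‖ₑ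
      ≤ C * ENNReal.ofReal (C' * ∫ x, growth N (u x)) ^ (((N : ℝ) + α) / N) :=
    h1.trans (by gcongr; exact hF u hu)
  rw [ENNReal.ofReal_rpow_of_nonneg (by positivity) (by positivity), ← ENNReal.ofReal_toReal hC,
    ← ENNReal.ofReal_mul (by positivity), ← ofReal_norm,
    ENNReal.ofReal_le_ofReal_iff (by positivity), Real.norm_eq_abs,
    Real.mul_rpow (by positivity) (by positivity)] at h2
  have h3 : 0 ≤ C' ^ (((N : ℝ) + α) / N) * (∫ x, growth N (u x)) ^ (((N : ℝ) + α) / N) := by positivity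
  nlinarith

end NonlinearityHyp

end NonlocalTerm

/-! ### Brezis–Lieb splitting and vanishing for the nonlocal term. -/

section NonlocalLimits

variable {N : ℕ} {α : ℝ} {f : ℝ → ℝ}

namespace NonlinearityHyp

lemma exists_eLpNorm_primitive_le (H : NonlinearityHyp N α f) (K : ℝ) :
    ∃ M : ℝ≥0∞, M ≠ ⊤ ∧ ∀ u : E N → ℝ, MemH1 u → ∫ x, growth N (u x) ≤ K →
      eLpNorm (fun x => primitive f (u x)) (hlsExpE N α) volume ≤ M := by
  obtain ⟨C, hC, hF⟩ := H.exists_lintegral_primitive_le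
  have hp := hlsExp_pos H.N_pos H.pos
  refine ⟨ENNReal.ofReal (C * K) ^ (1 / hlsExp N α),
    ENNReal.rpow_ne_top_of_nonneg (by positivity) ENNReal.ofReal_ne_top, fun u hu hK => ?_⟩
  rw [eLpNorm_hlsExpE H.N_pos H.pos]
  refine ENNReal.rpow_le_rpow ((hF u hu).trans ?_) (by positivity)
  exact ENNReal.ofReal_le_ofReal (by gcongr)

/-- If `∫⁻ |e_n|^p` is eventually below every positive number then `e_n → 0` in `L^p`. -/
lemma tendsto_eLpNorm_zero_of_eventually_le (H : NonlinearityHyp N α f) {ι : Type*} {l : Filter ι}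
    {e : ι → E N → ℝ}
    (h : ∀ ε : ℝ, 0 < ε → ∀ᶠ i in l, ∫⁻ x, ‖e i x‖ₑ ^ hlsExp N α ≤ ENNReal.ofReal ε) :
    Tendsto (fun i => eLpNorm (e i) (hlsExpE N α) volume) l (𝓝 0) := by
  have hp := hlsExp_pos H.N_pos H.pos
  have key : Tendsto (fun i => ∫⁻ x, ‖e i x‖ₑ ^ hlsExp N α) l (𝓝 0) := by
    rw [ENNReal.tendsto_nhds_zero]
    intro ε hε
    rcases eq_or_ne ε ⊤ with rfl | hε'
    · exact Eventually.of_forall fun _ => le_top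
    · have := h ε.toReal (ENNReal.toReal_pos hε.ne' hε')
      rwa [ENNReal.ofReal_toReal hε'] at this
  simp_rw [eLpNorm_hlsExpE H.N_pos H.pos]
  have := ((ENNReal.continuous_rpow_const (y := 1 / hlsExp N α)).tendsto _).comp key
  simpa [Function.comp_def, hp] using this

/-- The remainder in the Brezis–Lieb decomposition tends to zero in `L^p`. -/
lemma tendsto_brezisLieb_remainder (H : NonlinearityHyp N α f) {w : ℕ → E N → ℝ} {u₀ : E N → ℝ}
    (hw : ∀ n, MemH1 (w n)) (hu₀ : MemH1 u₀) {K : ℝ} (hK : ∀ n, ∫ x, growth N (w n x) ≤ K)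
    (hae : ∀ᵐ x, Tendsto (fun n => w n x) atTop (𝓝 0)) :
    Tendsto (fun n => eLpNorm (fun x => primitive f (w n x + u₀ x) - primitive f (w n x)
      - primitive f (u₀ x)) (hlsExpE N α) volume) atTop (𝓝 0) := by
  have hp := hlsExp_pos H.N_pos H.pos
  have hN := H.three_le
  refine H.tendsto_eLpNorm_zero_of_eventually_le fun η hη => ?_
  set e : ℕ → E N → ℝ := fun n x => primitive f (w n x + u₀ x) - primitive f (w n x)
      - primitive f (u₀ x) with he
  have hem : ∀ n, AEStronglyMeasurable (e n) := fun n =>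
    ((H.aestronglyMeasurable_primitive ((hw n).1.1.add hu₀.1.1)).sub
      (H.aestronglyMeasurable_primitive (hw n).1.1)).sub
      (H.aestronglyMeasurable_primitive hu₀.1.1)
  set ε := η / (2 * (|K| + 1)) with hε
  have hε0 : 0 < ε := by positivity
  obtain ⟨C, hC, hBL⟩ := H.exists_brezisLieb_pointwise hε0
  have heae : ∀ᵐ x, Tendsto (fun n => e n x) atTop (𝓝 0) := by
    filter_upwards [hae] with x hx
    have h1 : Tendsto (fun n => primitive f (w n x + u₀ x)) atTop (𝓝 (primitive f (0 + u₀ x))) :=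
      (H.continuous_primitive.tendsto _).comp (hx.add_const _)
    have h2 : Tendsto (fun n => primitive f (w n x)) atTop (𝓝 (primitive f 0)) :=
      (H.continuous_primitive.tendsto _).comp hx
    have := (h1.sub h2).sub_const (primitive f (u₀ x))
    simpa [he] using this
  -- After subtracting ε growth(w_n), the positive part of the remainder is dominated by the fixed
  -- function C growth(u₀), so dominated convergence applies. The subtracted part integrates to at
  -- most η/2 by the choice of ε.
  have hr : Tendsto (fun n => ∫ x, max (|e n x| ^ hlsExp N α - ε * growth N (w n x)) 0) atTop
      (𝓝 (∫ _ : E N, (0 : ℝ))) := by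
    refine tendsto_integral_of_dominated_convergence (fun x => C * growth N (u₀ x)) (fun n => ?_)
      ((hu₀.integrable_growth hN).const_mul C) (fun n => ae_of_all _ fun x => ?_) ?_
    · have h1 : AEStronglyMeasurable fun x => |e n x| ^ hlsExp N α :=
        (continuous_abs.rpow_const fun _ => Or.inr hp.le).comp_aestronglyMeasurable (hem n)
      have h2 : AEStronglyMeasurable fun x => growth N (w n x) := ((hw n).integrable_growth hN).1
      exact (h1.sub (h2.const_mul ε)).sup aestronglyMeasurable_const
    · rw [Real.norm_of_nonneg (le_max_right _ _)]
      have := hBL (w n x) (u₀ x)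
      exact max_le (by simp only [he]; linarith) (mul_nonneg hC.le (growth_nonneg _))
    · filter_upwards [heae, hae] with x hx hx'
      have h1 : Tendsto (fun n => |e n x| ^ hlsExp N α) atTop (𝓝 0) := by
        have := ((continuous_abs.rpow_const fun _ => Or.inr hp.le : Continuous
          fun t : ℝ => |t| ^ hlsExp N α).tendsto 0).comp hx
        simpa [Function.comp_def, hp.ne'] using this
      have h2 : Tendsto (fun n => growth N (w n x)) atTop (𝓝 0) := by
        have := ((continuous_growth hN).tendsto 0).comp hx'
        rwa [growth_zero hN] at this
      have := (h1.sub (h2.const_mul ε)).max (tendsto_const_nhds (x := (0 : ℝ)))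
      simpa using this
  rw [integral_zero] at hr
  filter_upwards [hr.eventually_lt_const (half_pos hη)] with n hn
  have hri : Integrable fun x => max (|e n x| ^ hlsExp N α - ε * growth N (w n x)) 0 := by
    refine ((hu₀.integrable_growth hN).const_mul C).mono' ?_ (ae_of_all _ fun x => ?_)
    · have h1 : AEStronglyMeasurable fun x => |e n x| ^ hlsExp N α :=
        (continuous_abs.rpow_const fun _ => Or.inr hp.le).comp_aestronglyMeasurable (hem n)
      have h2 : AEStronglyMeasurable fun x => growth N (w n x) := ((hw n).integrable_growth hN).1
      exact (h1.sub (h2.const_mul ε)).sup aestronglyMeasurable_const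
    · rw [Real.norm_of_nonneg (le_max_right _ _)]
      have := hBL (w n x) (u₀ x)
      exact max_le (by simp only [he]; linarith) (mul_nonneg hC.le (growth_nonneg _))
  have hgi := ((hw n).integrable_growth hN).const_mul ε
  refine (lintegral_enorm_rpow_le hp.le (hgi.add hri) (ae_of_all _ fun x => ?_)).trans
    (ENNReal.ofReal_le_ofReal ?_)
  · have := le_max_left (|e n x| ^ hlsExp N α - ε * growth N (w n x)) 0
    simp only [Pi.add_apply]
    linarith
  · simp only [Pi.add_apply]
    rw [integral_add hgi hri, integral_const_mul]
    have h1 : ε * ∫ x, growth N (w n x) ≤ ε * (|K| + 1) := by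
      gcongr
      linarith [hK n, le_abs_self K]
    have h2 : ε * (|K| + 1) = η / 2 := by
      rw [hε]
      field_simp
    linarith

/-- Brezis–Lieb splitting of the nonlocal term. -/
lemma tendsto_nonlocalTerm_sub (H : NonlinearityHyp N α f) {u : ℕ → E N → ℝ} {u₀ : E N → ℝ}
    (hu : ∀ n, MemH1 (u n)) (hu₀ : MemH1 u₀) {C : ℝ} (hg : ∀ n, gradSq (u n) ≤ C)
    (hm : ∀ n, massSq (u n) ≤ C) (hae : ∀ᵐ x, Tendsto (fun n => u n x) atTop (𝓝 (u₀ x))) :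
    Tendsto (fun n => nonlocalTerm α f (u n) - nonlocalTerm α f fun x => u n x - u₀ x) atTop
      (𝓝 (nonlocalTerm α f u₀)) := by
  have hN := H.three_le
  have hw : ∀ n, MemH1 fun x => u n x - u₀ x := fun n => (hu n).sub hu₀
  obtain ⟨K, -, hK⟩ := exists_growth_bound hN (2 * |C| + 2 * gradSq u₀ + 2 * massSq u₀)
  have g0 := gradSq_nonneg u₀
  have m0 := massSq_nonneg u₀
  have hC := le_abs_self C
  have hwK : ∀ n, ∫ x, growth N (u n x - u₀ x) ≤ K := fun n => hK _ (hw n)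
    (by linarith [(hu n).gradSq_sub_le hu₀, hg n]) (by linarith [(hu n).massSq_sub_le hu₀, hm n])
  have huK : ∀ n, ∫ x, growth N (u n x) ≤ K := fun n => hK _ (hu n)
    (by linarith [hg n, abs_nonneg C]) (by linarith [hm n, abs_nonneg C])
  have hwae : ∀ᵐ x, Tendsto (fun n => u n x - u₀ x) atTop (𝓝 0) := by
    filter_upwards [hae] with x hx
    simpa using hx.sub_const (u₀ x)
  have hrem := H.tendsto_brezisLieb_remainder hw hu₀ hwK hwae
  simp only [sub_add_cancel] at hrem
  obtain ⟨M, hM, hMb⟩ := H.exists_eLpNorm_primitive_le (N := N) K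
  have hb := fun n => H.memLp_primitive (hw n)
  have ha := fun n => H.memLp_primitive (hu n)
  have hc := H.memLp_primitive hu₀
  have he : ∀ n, MemLp (fun x => primitive f (u n x) - primitive f (u n x - u₀ x)
      - primitive f (u₀ x)) (hlsExpE N α) := fun n => ((ha n).sub (hb n)).sub hc
  have hbc : ∀ n, MemLp (fun x => primitive f (u n x - u₀ x) + primitive f (u₀ x)) (hlsExpE N α) :=
    fun n => (hb n).add hc
  have t1 := tendsto_rieszForm_zero H.N_pos H.pos H.lt (fun n => (he n).1) (fun n => (ha n).1)
    hrem hM (fun n => hMb _ (hu n) (huK n))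
  have t2 := tendsto_rieszForm_zero H.N_pos H.pos H.lt (fun n => (he n).1) (fun n => (hbc n).1)
    hrem (ENNReal.add_ne_top.2 ⟨hM, hc.2.ne⟩) (fun n =>
      (eLpNorm_add_le (hb n).1 hc.1 (one_le_hlsExpE H.pos H.lt)).trans
        (add_le_add_left (hMb _ (hw n) (hwK n)) _))
  obtain ⟨C', hC', hF⟩ := H.exists_lintegral_primitive_le
  have t3 := tendsto_rieszForm_of_ae_tendsto_zero H.N_pos H.pos H.lt hb hc
    (M := ENNReal.ofReal (C' * K)) ENNReal.ofReal_ne_top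
    (fun n => (hF _ (hw n)).trans (ENNReal.ofReal_le_ofReal (by gcongr; exact hwK n)))
    (by
      filter_upwards [hwae] with x hx
      have := (H.continuous_primitive.tendsto 0).comp hx
      rwa [primitive_zero] at this)
  -- Write a = F(u_n), b = F(u_n - u₀), c = F(u₀) and e = a - b - c. Then ⟨a,a⟩ - ⟨b,b⟩ = ⟨e,a⟩ +
  -- ⟨e,b+c⟩ + 2⟨b,c⟩ + ⟨c,c⟩. The terms with e vanish because e → 0 in L^p. The term ⟨b,c⟩ vanishes
  -- because b is bounded in L^p and tends to 0 almost everywhere.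
  have key : ∀ n, nonlocalTerm α f (u n) - nonlocalTerm α f (fun x => u n x - u₀ x)
      = rieszForm α (fun x => primitive f (u n x) - primitive f (u n x - u₀ x) - primitive f (u₀ x))
          (fun x => primitive f (u n x))
        + rieszForm α (fun x => primitive f (u n x) - primitive f (u n x - u₀ x) - primitive f (u₀ x))
          (fun x => primitive f (u n x - u₀ x) + primitive f (u₀ x))
        + 2 * rieszForm α (fun x => primitive f (u n x - u₀ x)) (fun x => primitive f (u₀ x))
        + nonlocalTerm α f u₀ := by
    intro n
    rw [nonlocalTerm_eq, nonlocalTerm_eq, nonlocalTerm_eq]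
    set a := fun x => primitive f (u n x)
    set b := fun x => primitive f (u n x - u₀ x)
    set c := fun x => primitive f (u₀ x)
    have ea : a = fun x => (a x - b x - c x) + (b x + c x) := by
      ext x
      ring
    have h1 : rieszForm α a a = rieszForm α (fun x => a x - b x - c x) a
        + rieszForm α (fun x => b x + c x) a := by
      rw [← rieszForm_add_left H.N_pos H.pos H.lt (he n) (hbc n) (ha n), ← ea]
    have h2 : rieszForm α (fun x => b x + c x) a
        = rieszForm α (fun x => a x - b x - c x) (fun x => b x + c x)
        + rieszForm α (fun x => b x + c x) (fun x => b x + c x) := by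
      rw [rieszForm_comm H.N_pos H.pos H.lt (hbc n) (ha n),
        ← rieszForm_add_left H.N_pos H.pos H.lt (he n) (hbc n) (hbc n), ← ea]
    have h3 : rieszForm α (fun x => b x + c x) (fun x => b x + c x)
        = rieszForm α b b + 2 * rieszForm α b c + rieszForm α c c := by
      rw [rieszForm_add_left H.N_pos H.pos H.lt (hb n) hc (hbc n),
        rieszForm_add_right H.N_pos H.pos H.lt (hb n) hc (hb n),
        rieszForm_add_right H.N_pos H.pos H.lt (hb n) hc hc,
        rieszForm_comm H.N_pos H.pos H.lt hc (hb n)]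
      ring
    change rieszForm α a a - rieszForm α b b = _
    rw [h1, h2, h3]
    ring
  simp_rw [key]
  simpa using ((t1.add t2).add (t3.const_mul 2)).add_const (nonlocalTerm α f u₀)

/-- The nonlocal term vanishes along vanishing sequences. -/
lemma tendsto_nonlocalTerm_zero_of_vanishing (H : NonlinearityHyp N α f) {u : ℕ → E N → ℝ}
    (hu : ∀ n, MemH1 (u n)) {C : ℝ} (hg : ∀ n, gradSq (u n) ≤ C) (hm : ∀ n, massSq (u n) ≤ C)
    (hv : ∀ s : ℝ, 0 < s → Tendsto (fun n => volume {x | s ≤ |u n x|}) atTop (𝓝 0)) :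
    Tendsto (fun n => nonlocalTerm α f (u n)) atTop (𝓝 0) := by
  have hp := hlsExp_pos H.N_pos H.pos
  have hN := H.three_le
  obtain ⟨K, hK0, hK⟩ := exists_growth_bound hN C
  obtain ⟨M', hM', hMb⟩ := H.exists_eLpNorm_primitive_le (N := N) K
  have ha := fun n => H.memLp_primitive (hu n)
  refine tendsto_rieszForm_zero H.N_pos H.pos H.lt (fun n => (ha n).1) (fun n => (ha n).1) ?_ hM'
    (fun n => hMb _ (hu n) (hK _ (hu n) (hg n) (hm n)))
  refine H.tendsto_eLpNorm_zero_of_eventually_le fun η hη => ?_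
  -- Subcriticality at both ends leaves a part proportional to the growth integral, at most η/2, and
  -- a bounded part living on the level set {|u_n| ≥ δ}, whose measure tends to zero.
  obtain ⟨δ, M, hδ, hM, hF⟩ := H.exists_primitive_small (ε := η / (2 * K)) (by positivity)
  have h1 := ENNReal.Tendsto.const_mul (a := ENNReal.ofReal M) (hv δ hδ) (Or.inr ENNReal.ofReal_ne_top)
  rw [mul_zero] at h1
  filter_upwards [h1.eventually_lt_const (ENNReal.ofReal_pos.2 (half_pos hη))] with n hn
  have hnm : NullMeasurableSet {x | δ ≤ |u n x|} :=
    nullMeasurableSet_le aemeasurable_const (hu n).1.1.norm.aemeasurable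
  have hgi := ((hu n).integrable_growth hN).const_mul (η / (2 * K))
  calc ∫⁻ x, ‖primitive f (u n x)‖ₑ ^ hlsExp N α
      ≤ ∫⁻ x, (ENNReal.ofReal (η / (2 * K) * growth N (u n x))
          + {x | δ ≤ |u n x|}.indicator (fun _ => ENNReal.ofReal M) x) := by
        refine lintegral_mono fun x => ?_
        rw [enorm_rpow_eq hp.le]
        refine (ENNReal.ofReal_le_ofReal (hF (u n x))).trans (ENNReal.ofReal_add_le.trans ?_)
        gcongr
        by_cases hx : δ ≤ |u n x|
        · simp [hx]
        · simp [hx]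
    _ = ENNReal.ofReal (η / (2 * K) * ∫ x, growth N (u n x))
          + ENNReal.ofReal M * volume {x | δ ≤ |u n x|} := by
        rw [lintegral_add_left' hgi.1.aemeasurable.ennreal_ofReal, lintegral_indicator_const₀ hnm,
          ← integral_const_mul, ofReal_integral_eq_lintegral_ofReal hgi
            (ae_of_all _ fun x => mul_nonneg (by positivity) (growth_nonneg _))]
    _ ≤ ENNReal.ofReal (η / 2) + ENNReal.ofReal (η / 2) := by
        refine add_le_add (ENNReal.ofReal_le_ofReal ?_) hn.le
        calc η / (2 * K) * ∫ x, growth N (u n x) ≤ η / (2 * K) * K := by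
              gcongr
              exact hK _ (hu n) (hg n) (hm n)
          _ = η / 2 := by field_simp
    _ = ENNReal.ofReal η := by
        rw [← ENNReal.ofReal_add (by positivity) (by positivity), add_halves]

end NonlinearityHyp

end NonlocalLimits

/-! ### Directional derivatives of the nonlocal term. -/

section NonlocalDerivative

variable {N : ℕ} {α : ℝ} {f : ℝ → ℝ}

lemma MemH1.integrable_growth_add {u w : E N → ℝ} (hN : 3 ≤ N) (hu : MemH1 u) (hw : MemH1 w) :
    Integrable fun x => growth N (|u x| + |w x|) := by
  refine (((hu.integrable_growth hN).add (hw.integrable_growth hN)).const_mul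
    (2 ^ sobExp N)).mono' ?_ (ae_of_all _ fun x => ?_)
  · exact (continuous_growth hN).comp_aestronglyMeasurable (hu.1.1.norm.add hw.1.1.norm)
  · rw [Real.norm_of_nonneg (growth_nonneg _)]
    exact growth_add_le hN _ _

namespace NonlinearityHyp

/-- The Lipschitz-type estimate with d = |s| and m = |a| + |b|: the factor |s|^p cancels, leaving an
s-independent majorant for dominated convergence. -/
lemma exists_slope_le (H : NonlinearityHyp N α f) : ∃ C : ℝ, 0 < C ∧ ∀ a b s : ℝ, |s| ≤ 1 → s ≠ 0 →
    |s⁻¹ * (primitive f (a + s * b) - primitive f a)| ^ hlsExp N α ≤ C * growth N (|a| + |b|) := by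
  have hp := hlsExp_pos H.N_pos H.pos
  obtain ⟨C, hC, h⟩ := H.exists_primitive_sub_le
  refine ⟨C, hC, fun a b s hs hs0 => ?_⟩
  have h1 := h (a + s * b) a (|a| + |b|) |s| (abs_nonneg s)
    ((abs_add_le _ _).trans (by
      rw [abs_mul]
      nlinarith [abs_nonneg b]))
    (by linarith [abs_nonneg b])
    (by
      rw [add_sub_cancel_left, abs_mul]
      nlinarith [abs_nonneg a, abs_nonneg s])
  have hs1 : 0 < |s| ^ hlsExp N α := by positivity
  rw [abs_mul, Real.mul_rpow (abs_nonneg _) (abs_nonneg _), abs_inv, Real.inv_rpow (abs_nonneg _),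
    inv_mul_le_iff₀ hs1]
  linarith

lemma tendsto_slope_primitive (H : NonlinearityHyp N α f) (a b : ℝ) :
    Tendsto (fun s => s⁻¹ * (primitive f (a + s * b) - primitive f a)) (𝓝[≠] 0) (𝓝 (f a * b)) := by
  have h1 : HasDerivAt (fun s : ℝ => a + s * b) b 0 := by
    simpa using ((hasDerivAt_id (0 : ℝ)).mul_const b).const_add a
  have h2 : HasDerivAt (fun s => primitive f (a + s * b)) (f a * b) 0 := by
    have := H.hasDerivAt_primitive (a + 0 * b)
    have h3 := HasDerivAt.comp (0 : ℝ) this h1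
    simpa [Function.comp_def] using h3
  have := hasDerivAt_iff_tendsto_slope_zero.1 h2
  simpa using this

/-- The uniform slope bound passes to the limit s → 0. -/
lemma exists_abs_f_mul_le (H : NonlinearityHyp N α f) : ∃ C : ℝ, 0 < C ∧ ∀ a b : ℝ,
    |f a * b| ^ hlsExp N α ≤ C * growth N (|a| + |b|) := by
  have hp := hlsExp_pos H.N_pos H.pos
  obtain ⟨C, hC, h⟩ := H.exists_slope_le
  refine ⟨C, hC, fun a b => ?_⟩
  have hcont : Continuous fun t : ℝ => |t| ^ hlsExp N α :=
    continuous_abs.rpow_const fun _ => Or.inr hp.le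
  refine le_of_tendsto ((hcont.tendsto _).comp (H.tendsto_slope_primitive a b)) ?_
  have : ∀ᶠ s : ℝ in 𝓝[≠] 0, |s| ≤ 1 := by
    refine nhdsWithin_le_nhds ?_
    filter_upwards [Metric.closedBall_mem_nhds (0 : ℝ) one_pos] with s hs
    simpa using hs
  filter_upwards [this, self_mem_nhdsWithin] with s hs hs0
  exact h a b s hs hs0

lemma memLp_f_mul (H : NonlinearityHyp N α f) {u φ : E N → ℝ} (hu : MemH1 u) (hφ : MemH1 φ) :
    MemLp (fun x => f (u x) * φ x) (hlsExpE N α) := by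
  obtain ⟨C, hC, h⟩ := H.exists_abs_f_mul_le
  exact memLp_of_rpow_le H.N_pos H.pos ((H.f1.1.comp_aestronglyMeasurable hu.1.1).mul hφ.1.1)
    ((hu.integrable_growth_add H.three_le hφ).const_mul C) (ae_of_all _ fun x => h (u x) (φ x))

/-- The derivative of the nonlocal term. -/
lemma hasDerivAt_nonlocalTerm (H : NonlinearityHyp N α f) {u φ : E N → ℝ} (hu : MemH1 u)
    (hφ : MemH1 φ) :
    HasDerivAt (fun s : ℝ => nonlocalTerm α f fun x => u x + s * φ x)
      (2 * rieszForm α (fun x => f (u x) * φ x) fun x => primitive f (u x)) 0 := by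
  have hN := H.three_le
  have hp := hlsExp_pos H.N_pos H.pos
  have hp1 := one_lt_hlsExp H.pos H.lt
  rw [hasDerivAt_iff_tendsto_slope_zero]
  -- With h_s the difference quotient, F(u + sφ) = F(u) + s h_s exactly when s ≠ 0.
  -- Differentiability thus reduces to h_s → f(u)φ in L^p.
  set h : ℝ → E N → ℝ := fun s x => s⁻¹ * (primitive f (u x + s * φ x) - primitive f (u x)) with hh
  set h₀ : E N → ℝ := fun x => f (u x) * φ x with hh₀
  set a : E N → ℝ := fun x => primitive f (u x)
  have ha : MemLp a (hlsExpE N α) := H.memLp_primitive hu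
  have hus : ∀ s : ℝ, MemH1 fun x => u x + s * φ x := fun s => hu.add (hφ.const_mul s)
  have hmem : ∀ s, MemLp (h s) (hlsExpE N α) := fun s =>
    ((H.memLp_primitive (hus s)).sub ha).const_mul s⁻¹
  have hmem₀ : MemLp h₀ (hlsExpE N α) := H.memLp_f_mul hu hφ
  obtain ⟨C, hC, hb⟩ := H.exists_slope_le
  obtain ⟨C', hC', hb'⟩ := H.exists_abs_f_mul_le
  have hsmall : ∀ᶠ s : ℝ in 𝓝[≠] 0, |s| ≤ 1 := by
    refine nhdsWithin_le_nhds ?_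
    filter_upwards [Metric.closedBall_mem_nhds (0 : ℝ) one_pos] with s hs
    simpa using hs
  have hlim : Tendsto (fun s => eLpNorm (fun x => h s x - h₀ x) (hlsExpE N α) volume)
      (𝓝[≠] 0) (𝓝 0) := by
    refine tendsto_eLpNorm_zero_of_dominated H.N_pos H.pos
      (G := fun x => 2 ^ (hlsExp N α - 1) * (C + C') * growth N (|u x| + |φ x|))
      (fun s => ((hmem s).sub hmem₀).1) ((hu.integrable_growth_add hN hφ).const_mul _) ?_ (ae_of_all _ fun x => ?_)
    · filter_upwards [hsmall, self_mem_nhdsWithin] with s hs hs0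
      refine ae_of_all _ fun x => ?_
      calc |h s x - h₀ x| ^ hlsExp N α ≤ (|h s x| + |h₀ x|) ^ hlsExp N α := by
            gcongr
            exact abs_sub _ _
        _ ≤ 2 ^ (hlsExp N α - 1) * (|h s x| ^ hlsExp N α + |h₀ x| ^ hlsExp N α) :=
            add_rpow_le_two_mul (abs_nonneg _) (abs_nonneg _) hp1.le
        _ ≤ 2 ^ (hlsExp N α - 1) * (C * growth N (|u x| + |φ x|)
              + C' * growth N (|u x| + |φ x|)) := by
            gcongr
            · exact hb _ _ _ hs hs0
            · exact hb' _ _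
        _ = _ := by ring
    · have := (H.tendsto_slope_primitive (u x) (φ x)).sub_const (h₀ x)
      rwa [show f (u x) * φ x - h₀ x = 0 from sub_self _] at this
  have t1 := tendsto_rieszForm H.N_pos H.pos H.lt (l := 𝓝[≠] (0 : ℝ)) (k := fun _ => a) hmem
    (fun _ => ha) hmem₀ ha hlim (by simp)
  have t2 := tendsto_rieszForm H.N_pos H.pos H.lt hmem hmem hmem₀ hmem₀ hlim hlim
  have t3 : Tendsto (fun s : ℝ => s) (𝓝[≠] 0) (𝓝 0) := nhdsWithin_le_nhds
  have t4 := (t1.const_mul 2).add (t3.mul t2)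
  rw [zero_mul, add_zero] at t4
  refine t4.congr' ?_
  filter_upwards [self_mem_nhdsWithin] with s hs
  have hs' : s ≠ 0 := hs
  have hsh : MemLp (fun x => s * h s x) (hlsExpE N α) := (hmem s).const_mul s
  have e1 : (fun x => primitive f (u x + s * φ x)) = fun x => a x + s * h s x := by
    ext x
    simp only [hh, a]
    field_simp
    ring
  -- Bilinearity gives a quadratic expansion in s; the slope is 2⟨h_s, a⟩ + s⟨h_s, h_s⟩, and the
  -- second term disappears in the limit.
  have e2 : nonlocalTerm α f (fun x => u x + s * φ x)
      = rieszForm α a a + 2 * s * rieszForm α (h s) a + s ^ 2 * rieszForm α (h s) (h s) := by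
    have := nonlocalTerm_eq (α := α) (f := f) fun x => u x + s * φ x
    simp only [e1] at this
    have hash : MemLp (fun x => a x + s * h s x) (hlsExpE N α) := ha.add hsh
    rw [this, rieszForm_add_left H.N_pos H.pos H.lt ha hsh hash,
      rieszForm_add_right H.N_pos H.pos H.lt ha hsh ha,
      rieszForm_add_right H.N_pos H.pos H.lt ha hsh hsh,
      rieszForm_comm H.N_pos H.pos H.lt ha hsh, rieszForm_smul_left s (h s) a,
      rieszForm_smul_left s (h s) fun x => s * h s x,
      rieszForm_comm H.N_pos H.pos H.lt (hmem s) hsh, rieszForm_smul_left s (h s) (h s)]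
    ring
  have e3 : nonlocalTerm α f (fun x => u x + 0 * φ x) = rieszForm α a a := by
    simp only [zero_mul, add_zero]
    rfl
  rw [zero_add, e2, e3, smul_eq_mul]
  field_simp
  ring

end NonlinearityHyp

end NonlocalDerivative

/-! ### The set Λ is not empty. -/

section LamNonempty

variable {N : ℕ} {α : ℝ} {f : ℝ → ℝ}

/-- The integrand is nonnegative and strictly positive on a nonempty open set. The diagonal has to
be removed, since the kernel takes the default value zero at the origin. -/
lemma rieszForm_indicator_ball_pos (hN : 3 ≤ N) (hα0 : 0 < α) (hαN : α < N) :
    0 < rieszForm α ((Metric.closedBall (0 : E N) 1).indicator fun _ => (1 : ℝ))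
      ((Metric.closedBall (0 : E N) 1).indicator fun _ => (1 : ℝ)) := by
  have hN0 : 0 < N := by omega
  have : Nonempty (Fin N) := ⟨⟨0, hN0⟩⟩
  set B := Metric.closedBall (0 : E N) 1
  have hmem : MemLp (B.indicator fun _ => (1 : ℝ)) (hlsExpE N α) :=
    memLp_indicator_const _ Metric.isClosed_closedBall.measurableSet _
      (Or.inr measure_closedBall_lt_top.ne)
  rw [rieszForm_eq hN0 hα0 hαN hmem hmem, integral_pos_iff_support_of_nonneg ?_
    (integrable_rieszProd hN0 hα0 hαN hmem hmem)]
  · set U : Set (E N × E N) := Metric.ball 0 1 ×ˢ Metric.ball 0 1 ∩ {q | q.1 ≠ q.2} with hU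
    have hUo : IsOpen U := (Metric.isOpen_ball.prod Metric.isOpen_ball).inter
      (isOpen_ne_fun continuous_fst continuous_snd)
    have hUn : U.Nonempty := by
      have h1 : Metric.ball (0 : E N) 1 ∩ {0}ᶜ ∈ 𝓝[≠] (0 : E N) :=
        inter_mem (nhdsWithin_le_nhds (Metric.ball_mem_nhds _ one_pos)) self_mem_nhdsWithin
      obtain ⟨x, hx, hx0⟩ := Filter.nonempty_of_mem h1
      exact ⟨(x, 0), ⟨hx, Metric.mem_ball_self one_pos⟩, hx0⟩
    refine (hUo.measure_pos (volume.prod volume) hUn).trans_le (measure_mono fun q hq => ?_)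
    obtain ⟨⟨h1, h2⟩, h3⟩ := hq
    have h1' : q.1 ∈ B := Metric.ball_subset_closedBall h1
    have h2' : q.2 ∈ B := Metric.ball_subset_closedBall h2
    have h4 : 0 < ‖q.1 - q.2‖ := norm_pos_iff.2 (sub_ne_zero.2 h3)
    have h5 : 0 < rieszKernel α (q.1 - q.2) := by
      unfold rieszKernel
      have g1 := Real.Gamma_pos_of_pos (s := ((N : ℝ) - α) / 2) (by linarith)
      have g2 := Real.Gamma_pos_of_pos (s := α / 2) (by linarith)
      have := Real.pi_pos
      positivity
    simp only [Function.mem_support, rieszProd, indicator_of_mem h1', indicator_of_mem h2', mul_one]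
    exact h5.ne'
  · intro q
    simp only [rieszProd, Pi.zero_apply]
    have h1 : 0 ≤ rieszKernel α (q.1 - q.2) := rieszKernel_nonneg hα0 hαN _
    have h2 : ∀ x, 0 ≤ B.indicator (fun _ => (1 : ℝ)) x := fun x =>
      indicator_nonneg (fun _ _ => zero_le_one) x
    exact mul_nonneg (mul_nonneg h1 (h2 _)) (h2 _)

/-- Plateaus of height s₀ approximate s₀ times the indicator of the unit ball, so their nonlocal
terms tend to F(s₀)² times the self-interaction of the ball. The sign of F(s₀) is irrelevant because
it enters squared. -/
lemma NonlinearityHyp.exists_mem_Lam (H : NonlinearityHyp N α f) (h3 : CondF3 f) :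
    ∃ u, u ∈ Lam N α f := by
  obtain ⟨s₀, hs₀, hFs⟩ := h3
  have hN := H.three_le
  set B := Metric.closedBall (0 : E N) 1 with hB
  have hr : ∀ k : ℕ, (1 : ℝ) < 1 + 1 / ((k : ℝ) + 1) := fun k => by
    have : 0 < 1 / ((k : ℝ) + 1) := by positivity
    linarith
  let ρ : ℕ → ContDiffBump (0 : E N) := fun k => ⟨1, 1 + 1 / ((k : ℝ) + 1), one_pos, hr k⟩
  let u : ℕ → E N → ℝ := fun k x => s₀ * ρ k x
  have hu : ∀ k, MemH1 (u k) := fun k =>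
    ((IsH1.of_contDiff (ρ k).contDiff (ρ k).hasCompactSupport).memH1).const_mul s₀
  set c : E N → ℝ := fun x => primitive f s₀ * B.indicator (fun _ => (1 : ℝ)) x with hc
  have hBm : MemLp (B.indicator fun _ => (1 : ℝ)) (hlsExpE N α) :=
    memLp_indicator_const _ Metric.isClosed_closedBall.measurableSet _
      (Or.inr measure_closedBall_lt_top.ne)
  have hcm : MemLp c (hlsExpE N α) := hBm.const_mul _
  have hin : ∀ k, ∀ x ∈ B, u k x = s₀ := by
    intro k x hx
    simp only [u]
    rw [(ρ k).one_of_mem_closedBall hx, mul_one]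
  have hpt : ∀ x, Tendsto (fun k => primitive f (u k x) - c x) atTop (𝓝 0) := by
    intro x
    by_cases hx : x ∈ B
    · have : ∀ k, primitive f (u k x) - c x = 0 := fun k => by
        simp [hin k x hx, hc, hx]
      simp [this]
    · have hx1 : 1 < ‖x‖ := by simpa [hB] using hx
      have hev : ∀ᶠ k : ℕ in atTop, primitive f (u k x) - c x = 0 := by
        have h1 : Tendsto (fun k : ℕ => 1 + 1 / ((k : ℝ) + 1)) atTop (𝓝 (1 + 0)) :=
          tendsto_one_div_add_atTop_nhds_zero_nat.const_add 1
        rw [add_zero] at h1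
        filter_upwards [h1.eventually_lt_const hx1] with k hk
        have : ρ k x = 0 := (ρ k).zero_of_le_dist (by
          rw [dist_zero_right]
          exact hk.le)
        simp [u, this, hc, hx]
      exact tendsto_const_nhds.congr' (hev.mono fun k hk => hk.symm)
  obtain ⟨C, hC, hF⟩ := H.exists_primitive_le
  have hp := hlsExp_pos H.N_pos H.pos
  have hlim : Tendsto (fun k => eLpNorm (fun x => primitive f (u k x) - c x) (hlsExpE N α) volume)
      atTop (𝓝 0) := by
    -- The outer radii 1 + 1/(k+1) never exceed 2, so a constant on the ball of radius 2 dominates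
    -- all the differences.
    refine tendsto_eLpNorm_zero_of_dominated H.N_pos H.pos
      (G := (Metric.closedBall (0 : E N) 2).indicator fun _ => C * growth N s₀)
      (fun k => ((H.memLp_primitive (hu k)).sub hcm).1) ?_ ?_ (ae_of_all _ hpt)
    · exact (integrable_indicator_iff Metric.isClosed_closedBall.measurableSet).2
        (integrableOn_const measure_closedBall_lt_top.ne)
    · refine Eventually.of_forall fun k => ae_of_all _ fun x => ?_
      have hg0 : 0 ≤ C * growth N s₀ := mul_nonneg hC.le (growth_nonneg _)
      have hind : 0 ≤ (Metric.closedBall (0 : E N) 2).indicator (fun _ => C * growth N s₀) x :=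
        indicator_nonneg (fun _ _ => hg0) x
      by_cases hx : x ∈ B
      · have : primitive f (u k x) - c x = 0 := by simp [hin k x hx, hc, hx]
        rw [this, abs_zero, Real.zero_rpow hp.ne']
        exact hind
      · by_cases hx2 : x ∈ Metric.closedBall (0 : E N) 2
        · rw [indicator_of_mem hx2]
          simp only [hc, indicator_of_notMem hx, mul_zero, sub_zero]
          refine (hF _).trans ?_
          gcongr
          refine growth_mono hN ?_
          simp only [u]
          rw [abs_mul, abs_of_nonneg ((ρ k).nonneg : 0 ≤ ρ k x)]
          exact mul_le_of_le_one_right (abs_nonneg _) (ρ k).le_one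
        · have h2 : 2 < ‖x‖ := by simpa using hx2
          have : ρ k x = 0 := (ρ k).zero_of_le_dist (by
            have h4 : 1 / ((k : ℝ) + 1) ≤ 1 := by
              rw [div_le_one (by positivity)]
              linarith [(Nat.cast_nonneg k : (0 : ℝ) ≤ k)]
            simp only [ρ, dist_zero_right]
            linarith)
          have h0 : primitive f (u k x) - c x = 0 := by simp [u, this, hc, hx]
          rw [h0, abs_zero, Real.zero_rpow hp.ne']
          exact hind
  have hD := tendsto_rieszForm H.N_pos H.pos H.lt (fun k => H.memLp_primitive (hu k))
    (fun k => H.memLp_primitive (hu k)) hcm hcm hlim hlim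
  have hpos : 0 < rieszForm α c c := by
    rw [hc, rieszForm_smul_left, rieszForm_comm H.N_pos H.pos H.lt hBm (hBm.const_mul _),
      rieszForm_smul_left, ← mul_assoc]
    exact mul_pos (mul_self_pos.2 hFs) (rieszForm_indicator_ball_pos hN H.pos H.lt)
  obtain ⟨k, hk⟩ := (hD.eventually_const_lt hpos).exists
  exact ⟨u k, hu k, hk⟩

end LamNonempty

/-! ### Consequences of (V3) for V and for NV + ∇V·x. -/

section Potential

variable {N : ℕ} {α : ℝ} {V : E N → ℝ} {Vinf θ : ℝ}

/-- `N V(x) + ∇V(x) · x`. -/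
def virial (V : E N → ℝ) (x : E N) : ℝ := (N : ℝ) * V x + fderiv ℝ V x x

/-- The function `(1 - t^{N-2}) / (N-2) - (1 - t^{N+α}) / (N+α)`. -/
def dilationGap (N : ℕ) (α t : ℝ) : ℝ :=
  (1 - t ^ ((N : ℝ) - 2)) / ((N : ℝ) - 2) - (1 - t ^ ((N : ℝ) + α)) / ((N : ℝ) + α)

/-- Bernoulli's inequality for t^a with exponent b/a > 1. It gives the strict positivity of
`dilationGap` away from t = 1. -/
lemma one_sub_rpow_div_lt {a b t : ℝ} (ha : 0 < a) (hab : a < b) (ht : 0 < t) (ht1 : t ≠ 1) :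
    (1 - t ^ b) / b < (1 - t ^ a) / a := by
  have hb : 0 < b := ha.trans hab
  have h1 : t ^ a - 1 ≠ 0 := by
    rw [sub_ne_zero]
    intro h
    exact ht1 ((Real.rpow_left_inj ht.le zero_le_one ha.ne').1 (h.trans (Real.one_rpow a).symm))
  have h2 := one_add_mul_self_lt_rpow_one_add (s := t ^ a - 1) (p := b / a)
    (by linarith [Real.rpow_pos_of_pos ht a]) h1 ((one_lt_div ha).2 hab)
  rw [add_sub_cancel, ← Real.rpow_mul ht.le, mul_div_cancel₀ _ ha.ne'] at h2
  rw [div_lt_div_iff₀ hb ha]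
  have h3 : a * (1 + b / a * (t ^ a - 1)) = a + b * (t ^ a - 1) := by
    field_simp
  have h4 := mul_lt_mul_of_pos_left h2 ha
  linarith

/-- The standing assumptions on the potential, with the constant `θ` of (V3) made explicit. -/
structure PotentialHyp (N : ℕ) (α : ℝ) (V : E N → ℝ) (Vinf θ : ℝ) : Prop where
  three_le : 3 ≤ N
  pos : 0 < α
  v1 : CondV1 V Vinf
  v2 : CondV2 V Vinf
  contDiff : ContDiff ℝ 1 V
  nonneg : 0 ≤ θ
  lt_one : θ < 1
  antitone : ∀ x : E N, x ≠ 0 → AntitoneOn (fun t : ℝ =>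
      ((N : ℝ) * V (t • x) + fderiv ℝ V (t • x) (t • x)) / t ^ α
        + ((N : ℝ) - 2) ^ 3 * θ / (4 * t ^ (α + 2) * ‖x‖ ^ 2)) (Ioi 0)

/-- The constant potential satisfies all the assumptions with θ = 0, so every result below also
applies to the problem at infinity. -/
lemma PotentialHyp.const (hN : 3 ≤ N) (hα0 : 0 < α) (hV : 0 < Vinf) :
    PotentialHyp N α (fun _ => Vinf) Vinf 0 where
  three_le := hN
  pos := hα0
  v1 := ⟨continuous_const, fun _ => hV.le, tendsto_const_nhds, hV⟩
  v2 := fun _ => le_rfl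
  contDiff := contDiff_const
  nonneg := le_rfl
  lt_one := one_pos
  antitone := by
    intro x _ s hs t _ hst
    have hs' : 0 < s := hs
    simp only [mul_zero, zero_div, add_zero, fderiv_fun_const, Pi.zero_apply,
      _root_.zero_apply]
    gcongr

namespace PotentialHyp

lemma three_le' (P : PotentialHyp N α V Vinf θ) : (3 : ℝ) ≤ N := by exact_mod_cast P.three_le

lemma continuous_virial (P : PotentialHyp N α V Vinf θ) : Continuous (virial V) := by
  unfold virial
  exact (P.v1.1.const_mul _).add ((P.contDiff.continuous_fderiv (by simp)).clm_apply continuous_id)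

lemma dilationGap_nonneg (P : PotentialHyp N α V Vinf θ) {t : ℝ} (ht : 0 < t) :
    0 ≤ dilationGap N α t := by
  have h1 := P.three_le'
  have h2 := P.pos
  rcases eq_or_ne t 1 with rfl | h
  · simp [dilationGap]
  · have := one_sub_rpow_div_lt (a := (N : ℝ) - 2) (b := (N : ℝ) + α) (by linarith) (by linarith) ht h
    unfold dilationGap
    linarith

lemma dilationGap_pos (P : PotentialHyp N α V Vinf θ) {t : ℝ} (ht : 0 < t) (h : t ≠ 1) :
    0 < dilationGap N α t := by
  have h1 := P.three_le'
  have h2 := P.pos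
  have := one_sub_rpow_div_lt (a := (N : ℝ) - 2) (b := (N : ℝ) + α) (by linarith) (by linarith) ht h
  unfold dilationGap
  linarith

/-- The integrated form of (V3). -/
lemma sub_dilate_ge (P : PotentialHyp N α V Vinf θ) {x : E N} (hx : x ≠ 0) {t : ℝ} (ht : 0 < t) :
    (1 - t ^ ((N : ℝ) + α)) / ((N : ℝ) + α) * virial V x
        - ((N : ℝ) - 2) ^ 3 * θ / 4 / ‖x‖ ^ 2 * dilationGap N α t
      ≤ V x - t ^ (N : ℝ) * V (t • x) := by
  have hN := P.three_le'
  have hα := P.pos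
  have hx0 : 0 < ‖x‖ := norm_pos_iff.2 hx
  set c := ((N : ℝ) - 2) ^ 3 * θ / 4 / ‖x‖ ^ 2 with hc
  set φ₁ := virial V x + c with hφ₁
  have hanti := P.antitone x hx
  have hN2 : (N : ℝ) - 2 ≠ 0 := by linarith
  have hNα : (N : ℝ) + α ≠ 0 := by linarith
  -- Its derivative at τ is τ^(N+α-1)(Φ(τ) - Φ(1)), where Φ is the nonincreasing function of (V3)
  -- and φ₁ = Φ(1). Hence g increases up to τ = 1 and decreases afterwards; g(t) ≤ g(1) is the
  -- claim.
  set g : ℝ → ℝ := fun τ => τ ^ (N : ℝ) * V (τ • x) - φ₁ * (τ ^ ((N : ℝ) + α) / ((N : ℝ) + α))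
    + c * (τ ^ ((N : ℝ) - 2) / ((N : ℝ) - 2)) with hg
  set g' : ℝ → ℝ := fun τ => τ ^ ((N : ℝ) + α - 1) * ((virial V (τ • x) / τ ^ α
    + ((N : ℝ) - 2) ^ 3 * θ / (4 * τ ^ (α + 2) * ‖x‖ ^ 2)) - φ₁) with hg'
  have hderiv : ∀ τ : ℝ, 0 < τ → HasDerivAt g (g' τ) τ := by
    intro τ hτ
    have d1 : HasDerivAt (fun τ : ℝ => V (τ • x)) (fderiv ℝ V (τ • x) x) τ := by
      have e1 : HasDerivAt (fun τ : ℝ => τ • x) x τ := by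
        simpa using (hasDerivAt_id τ).smul_const x
      exact ((P.contDiff.differentiable (by simp)).differentiableAt.hasFDerivAt).comp_hasDerivAt τ e1
    have d2 := (Real.hasDerivAt_rpow_const (x := τ) (p := (N : ℝ)) (Or.inl hτ.ne')).mul d1
    have d3 := ((Real.hasDerivAt_rpow_const (x := τ) (p := (N : ℝ) + α)
      (Or.inl hτ.ne')).div_const ((N : ℝ) + α)).const_mul φ₁
    have d4 := ((Real.hasDerivAt_rpow_const (x := τ) (p := (N : ℝ) - 2)
      (Or.inl hτ.ne')).div_const ((N : ℝ) - 2)).const_mul c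
    refine ((d2.sub d3).add d4).congr_deriv ?_
    simp only [hg', virial, map_smul, smul_eq_mul]
    have r1 : τ ^ ((N : ℝ) + α - 1) = τ ^ ((N : ℝ) - 1) * τ ^ α := by
      rw [← Real.rpow_add hτ]
      congr 1
      ring
    have r2 : τ ^ (α + 2) = τ ^ α * τ ^ 2 := by
      rw [Real.rpow_add hτ, Real.rpow_two]
    have r3 : τ ^ (N : ℝ) = τ ^ ((N : ℝ) - 1) * τ := by
      rw [Real.rpow_sub_one hτ.ne', div_mul_cancel₀ _ hτ.ne']
    have r4 : τ ^ ((N : ℝ) - 2 - 1) = τ ^ ((N : ℝ) - 1) / τ ^ 2 := by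
      rw [← Real.rpow_two, ← Real.rpow_sub hτ]
      congr 1
      ring
    have hτα : 0 < τ ^ α := Real.rpow_pos_of_pos hτ α
    rw [r1, r2, r3, r4]
    simp only [hc]
    field_simp
    ring
  have hφ1 : virial V ((1 : ℝ) • x) / (1 : ℝ) ^ α
      + ((N : ℝ) - 2) ^ 3 * θ / (4 * (1 : ℝ) ^ (α + 2) * ‖x‖ ^ 2) = φ₁ := by
    simp only [one_smul, Real.one_rpow, div_one, hφ₁, hc, mul_one]
    rw [div_div]
  have hgt : g t ≤ g 1 := by
    rcases le_total t 1 with h | h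
    · refine monotoneOn_of_deriv_nonneg (convex_Icc t 1) (fun τ hτ =>
        (hderiv τ (ht.trans_le hτ.1)).continuousAt.continuousWithinAt) (fun τ hτ => ?_)
        (fun τ hτ => ?_) (left_mem_Icc.2 h) (right_mem_Icc.2 h) h
      · rw [interior_Icc] at hτ
        exact (hderiv τ (ht.trans hτ.1)).differentiableAt.differentiableWithinAt
      · rw [interior_Icc] at hτ
        have hτ0 : 0 < τ := ht.trans hτ.1
        rw [(hderiv τ hτ0).deriv]
        have := hanti (mem_Ioi.2 hτ0) (mem_Ioi.2 one_pos) hτ.2.le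
        refine mul_nonneg (by positivity) (sub_nonneg.2 ?_)
        rw [← hφ1]
        exact this
    · refine antitoneOn_of_deriv_nonpos (convex_Icc 1 t) (fun τ hτ =>
        (hderiv τ (one_pos.trans_le hτ.1)).continuousAt.continuousWithinAt) (fun τ hτ => ?_)
        (fun τ hτ => ?_) (left_mem_Icc.2 h) (right_mem_Icc.2 h) h
      · rw [interior_Icc] at hτ
        exact (hderiv τ (one_pos.trans hτ.1)).differentiableAt.differentiableWithinAt
      · rw [interior_Icc] at hτ
        have hτ0 : 0 < τ := one_pos.trans hτ.1
        rw [(hderiv τ hτ0).deriv]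
        have := hanti (mem_Ioi.2 one_pos) (mem_Ioi.2 hτ0) hτ.1.le
        refine mul_nonpos_of_nonneg_of_nonpos (by positivity) (sub_nonpos.2 ?_)
        rw [← hφ1]
        exact this
  simp only [hg, Real.one_rpow, one_smul, one_mul] at hgt
  have e : (1 - t ^ ((N : ℝ) + α)) / ((N : ℝ) + α) * virial V x - c * dilationGap N α t
      = φ₁ * ((1 - t ^ ((N : ℝ) + α)) / ((N : ℝ) + α)) - c * ((1 - t ^ ((N : ℝ) - 2)) / ((N : ℝ) - 2)) := by
    rw [hφ₁]
    unfold dilationGap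
    ring
  rw [e, sub_div, sub_div]
  linarith

/-- Drop t^N V(tx) ≥ 0 in the integrated inequality, divide by t^(N+α) and let t → ∞. This is the
lower bound behind the coercivity of the quadratic part of 𝓟. -/
lemma virial_ge (P : PotentialHyp N α V Vinf θ) {x : E N} (hx : x ≠ 0) :
    -(((N : ℝ) - 2) ^ 3 * θ / 4 / ‖x‖ ^ 2) ≤ virial V x := by
  have hN := P.three_le'
  have hα := P.pos
  set c := ((N : ℝ) - 2) ^ 3 * θ / 4 / ‖x‖ ^ 2
  set b := (N : ℝ) + α with hb
  have hb0 : 0 < b := by linarith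
  have hneg : ∀ r : ℝ, 0 < r → Tendsto (fun t : ℝ => t ^ (-r)) atTop (𝓝 0) :=
    fun r hr => tendsto_rpow_neg_atTop hr
  have h1 : Tendsto (fun t : ℝ => t ^ (-b) * V x
      - ((t ^ (-b) - 1) / b * virial V x
        - c * ((t ^ (-b) - t ^ (-(α + 2))) / ((N : ℝ) - 2) - (t ^ (-b) - 1) / b)))
      atTop (𝓝 (0 * V x - ((0 - 1) / b * virial V x - c * ((0 - 0) / ((N : ℝ) - 2) - (0 - 1) / b)))) := by
    have t1 := hneg b hb0
    have t2 := hneg (α + 2) (by linarith)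
    exact (t1.mul_const _).sub ((((t1.sub_const 1).div_const b).mul_const _).sub
      ((((t1.sub t2).div_const _).sub ((t1.sub_const 1).div_const b)).const_mul c))
  have h2 : 0 ≤ 0 * V x - ((0 - 1) / b * virial V x - c * ((0 - 0) / ((N : ℝ) - 2) - (0 - 1) / b)) := by
    refine ge_of_tendsto h1 ?_
    filter_upwards [eventually_gt_atTop 0] with t ht
    have h3 := P.sub_dilate_ge hx ht
    have h4 : 0 ≤ t ^ (N : ℝ) * V (t • x) := mul_nonneg (by positivity) (P.v1.2.1 _)
    have hpos : 0 < t ^ (-b) := by positivity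
    have h5 := mul_le_mul_of_nonneg_left (h3.trans (sub_le_self _ h4)) hpos.le
    have r1 : t ^ (-b) * t ^ b = 1 := by
      rw [← Real.rpow_add ht]
      simp
    have r2 : t ^ (-b) * t ^ ((N : ℝ) - 2) = t ^ (-(α + 2)) := by
      rw [← Real.rpow_add ht, hb]
      congr 1
      ring
    rw [sub_nonneg]
    refine le_trans (le_of_eq ?_) h5
    unfold dilationGap
    rw [← r2, ← hb]
    have : t ^ (-b) * ((1 - t ^ b) / b * virial V x
        - c * ((1 - t ^ ((N : ℝ) - 2)) / ((N : ℝ) - 2) - (1 - t ^ b) / b))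
      = (t ^ (-b) - t ^ (-b) * t ^ b) / b * virial V x
        - c * ((t ^ (-b) - t ^ (-b) * t ^ ((N : ℝ) - 2)) / ((N : ℝ) - 2)
          - (t ^ (-b) - t ^ (-b) * t ^ b) / b) := by ring
    rw [r1] at this
    rw [← this]
  have h6 : 0 * V x - ((0 - 1) / b * virial V x - c * ((0 - 0) / ((N : ℝ) - 2) - (0 - 1) / b))
      = (virial V x + c) / b := by
    field_simp
    ring
  rw [h6] at h2
  have h7 := mul_nonneg h2 hb0.le
  rw [div_mul_cancel₀ _ hb0.ne'] at h7
  linarith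

/-- The opposite limit t → 0 of the same inequality; it bounds the potential of the reduced energy
from below. -/
lemma virial_le (P : PotentialHyp N α V Vinf θ) {x : E N} (hx : x ≠ 0) :
    virial V x / ((N : ℝ) + α)
      - ((N : ℝ) - 2) ^ 3 * θ / 4 / ‖x‖ ^ 2 * (1 / ((N : ℝ) - 2) - 1 / ((N : ℝ) + α)) ≤ V x := by
  have hN := P.three_le'
  have hα := P.pos
  set c := ((N : ℝ) - 2) ^ 3 * θ / 4 / ‖x‖ ^ 2
  have hz : ∀ r : ℝ, 0 < r → Tendsto (fun t : ℝ => t ^ r) (𝓝[>] 0) (𝓝 0) := by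
    intro r hr
    have := (Real.continuousAt_rpow_const 0 r (Or.inr hr.le)).tendsto
    rw [Real.zero_rpow hr.ne'] at this
    exact this.mono_left nhdsWithin_le_nhds
  have t1 := hz ((N : ℝ) + α) (by linarith)
  have t2 := hz ((N : ℝ) - 2) (by linarith)
  have h1 : Tendsto (fun t : ℝ => (1 - t ^ ((N : ℝ) + α)) / ((N : ℝ) + α) * virial V x
      - c * dilationGap N α t) (𝓝[>] 0) (𝓝 ((1 - 0) / ((N : ℝ) + α) * virial V x
        - c * ((1 - 0) / ((N : ℝ) - 2) - (1 - 0) / ((N : ℝ) + α)))) := by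
    unfold dilationGap
    exact (((t1.const_sub 1).div_const _).mul_const _).sub
      ((((t2.const_sub 1).div_const _).sub ((t1.const_sub 1).div_const _)).const_mul c)
  have h2 := le_of_tendsto (b := V x) h1 (by
    filter_upwards [self_mem_nhdsWithin] with t ht
    have ht' : 0 < t := ht
    have h4 : 0 ≤ t ^ (N : ℝ) * V (t • x) := mul_nonneg (by positivity) (P.v1.2.1 _)
    exact (P.sub_dilate_ge hx ht').trans (sub_le_self _ h4))
  refine le_trans (le_of_eq ?_) h2
  ring

/-- Convergence of V alone says nothing about ∇V, but the integrated inequality bounds NV + ∇V·x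
from both sides, according to whether t > 1 or t < 1. Letting |x| → ∞ with t fixed kills the |x|⁻²
error; letting t → 1 afterwards gives N V∞. -/
lemma tendsto_virial (P : PotentialHyp N α V Vinf θ) :
    Tendsto (virial V) (cocompact (E N)) (𝓝 ((N : ℝ) * Vinf)) := by
  have hN := P.three_le'
  have hα := P.pos
  have hNα : 0 < (N : ℝ) + α := by linarith
  set c := ((N : ℝ) - 2) ^ 3 * θ / 4 with hc
  have hcx : Tendsto (fun x : E N => c / ‖x‖ ^ 2) (cocompact (E N)) (𝓝 0) := by
    have h1 : Tendsto (fun x : E N => ‖x‖ ^ 2) (cocompact (E N)) atTop :=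
      (tendsto_pow_atTop two_ne_zero).comp (tendsto_norm_cocompact_atTop (E := E N))
    exact h1.const_div_atTop c
  have hVt : ∀ t : ℝ, 0 < t → Tendsto (fun x : E N => V (t • x)) (cocompact (E N)) (𝓝 Vinf) := by
    intro t ht
    exact P.v1.2.2.1.comp (Homeomorph.smulOfNeZero t ht.ne').isClosedEmbedding.tendsto_cocompact
  have hne : ∀ᶠ x : E N in cocompact (E N), x ≠ 0 := by
    have := (isCompact_singleton (x := (0 : E N))).compl_mem_cocompact
    exact this
  -- the auxiliary quotient
  set q : ℝ → ℝ := fun t => (1 - t ^ (N : ℝ)) * Vinf / ((1 - t ^ ((N : ℝ) + α)) / ((N : ℝ) + α)) with hq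
  have hlim : ∀ t : ℝ, 0 < t → Tendsto (fun x : E N => V x - t ^ (N : ℝ) * V (t • x)
      + c / ‖x‖ ^ 2 * dilationGap N α t) (cocompact (E N)) (𝓝 ((1 - t ^ (N : ℝ)) * Vinf)) := by
    intro t ht
    have := ((P.v1.2.2.1.sub ((hVt t ht).const_mul (t ^ (N : ℝ)))).add
      (hcx.mul_const (dilationGap N α t)))
    convert this using 2
    ring
  have hqlim : Tendsto q (𝓝[≠] 1) (𝓝 ((N : ℝ) * Vinf)) := by
    have e1 : ∀ r : ℝ, HasDerivAt (fun t : ℝ => t ^ r) r 1 := fun r => by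
      simpa using Real.hasDerivAt_rpow_const (x := 1) (p := r) (Or.inl one_ne_zero)
    have e2 := hasDerivAt_iff_tendsto_slope.1 (e1 (N : ℝ))
    have e3 := hasDerivAt_iff_tendsto_slope.1 (e1 ((N : ℝ) + α))
    have e4 := ((e2.mul_const Vinf).div (e3.div_const ((N : ℝ) + α)) (by
      rw [div_self hNα.ne']
      exact one_ne_zero))
    rw [div_self hNα.ne', div_one] at e4
    refine e4.congr' ?_
    filter_upwards [self_mem_nhdsWithin] with t ht
    have ht' : t - 1 ≠ 0 := sub_ne_zero.2 ht
    simp only [hq, slope_def_field, Pi.div_apply, Real.one_rpow]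
    rw [show (t ^ (N : ℝ) - 1) / (t - 1) * Vinf = ((1 - t ^ (N : ℝ)) * Vinf) * (-(t - 1)⁻¹) by
        rw [div_eq_mul_inv]; ring,
      show (t ^ ((N : ℝ) + α) - 1) / (t - 1) / ((N : ℝ) + α)
        = (1 - t ^ ((N : ℝ) + α)) / ((N : ℝ) + α) * (-(t - 1)⁻¹) by
        rw [div_eq_mul_inv, div_eq_mul_inv, div_eq_mul_inv]; ring]
    exact mul_div_mul_right _ _ (neg_ne_zero.2 (inv_ne_zero ht'))
  rw [tendsto_order]
  constructor
  · intro a ha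
    -- For t > 1 the factor 1 - t^(N+α) is negative, so the inequality reverses into a lower bound
    -- for NV + ∇V·x.
    have h1 : ∀ᶠ t in 𝓝[>] (1 : ℝ), a < q t :=
      (hqlim.mono_left (nhdsWithin_mono _ fun t (ht : 1 < t) => ht.ne')).eventually_const_lt ha
    obtain ⟨t, hat, ht⟩ := (h1.and self_mem_nhdsWithin).exists
    have ht1 : 1 < t := ht
    have ht0 : 0 < t := one_pos.trans ht1
    have hs : (1 - t ^ ((N : ℝ) + α)) / ((N : ℝ) + α) < 0 :=
      div_neg_of_neg_of_pos (sub_neg.2 (Real.one_lt_rpow ht1 hNα)) hNα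
    have h2 : (1 - t ^ (N : ℝ)) * Vinf < a * ((1 - t ^ ((N : ℝ) + α)) / ((N : ℝ) + α)) :=
      (lt_div_iff_of_neg hs).1 hat
    filter_upwards [(hlim t ht0).eventually_lt_const h2, hne] with x hx hx0
    have h3 := P.sub_dilate_ge hx0 ht0
    rw [← hc] at h3
    have h4 : (1 - t ^ ((N : ℝ) + α)) / ((N : ℝ) + α) * virial V x
        < (1 - t ^ ((N : ℝ) + α)) / ((N : ℝ) + α) * a := by linarith
    exact lt_of_mul_lt_mul_of_nonpos_left h4 hs.le
  · intro a ha
    have h1 : ∀ᶠ t in 𝓝[<] (1 : ℝ), q t < a :=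
      (hqlim.mono_left (nhdsWithin_mono _ fun t (ht : t < 1) => ht.ne)).eventually_lt_const ha
    have h0 : ∀ᶠ t in 𝓝[<] (1 : ℝ), 0 < t :=
      nhdsWithin_le_nhds (lt_mem_nhds one_pos)
    obtain ⟨t, ⟨hat, ht0⟩, ht⟩ := ((h1.and h0).and self_mem_nhdsWithin).exists
    have ht1 : t < 1 := ht
    have hs : 0 < (1 - t ^ ((N : ℝ) + α)) / ((N : ℝ) + α) :=
      div_pos (sub_pos.2 (Real.rpow_lt_one ht0.le ht1 hNα)) hNα
    have h2 : (1 - t ^ (N : ℝ)) * Vinf < a * ((1 - t ^ ((N : ℝ) + α)) / ((N : ℝ) + α)) :=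
      (div_lt_iff₀ hs).1 hat
    filter_upwards [(hlim t ht0).eventually_lt_const h2, hne] with x hx hx0
    have h3 := P.sub_dilate_ge hx0 ht0
    rw [← hc] at h3
    have h4 : (1 - t ^ ((N : ℝ) + α)) / ((N : ℝ) + α) * virial V x
        < (1 - t ^ ((N : ℝ) + α)) / ((N : ℝ) + α) * a := by linarith
    exact lt_of_mul_lt_mul_of_nonneg_left h4 hs.le

end PotentialHyp

lemma exists_bound_of_tendsto_cocompact {Q : E N → ℝ} (hQ : Continuous Q) {q : ℝ}
    (hq : Tendsto Q (cocompact (E N)) (𝓝 q)) : ∃ M : ℝ, 0 < M ∧ ∀ x, |Q x| ≤ M := by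
  have h1 : ∀ᶠ x in cocompact (E N), |Q x| < |q| + 1 :=
    hq.abs.eventually_lt_const (by linarith)
  obtain ⟨K, hK, hKs⟩ := mem_cocompact.1 h1
  obtain ⟨B, hB⟩ := hK.exists_bound_of_continuousOn hQ.continuousOn
  refine ⟨max B (|q| + 1), lt_max_of_lt_right (by positivity), fun x => ?_⟩
  by_cases hx : x ∈ K
  · exact (hB x hx).trans (le_max_left _ _)
  · exact (le_of_lt (hKs hx)).trans (le_max_right _ _)

end Potential

/-! ### Quadratic forms on H¹: splitting, coercivity and compactness. -/

section QuadraticForms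

variable {N : ℕ}

lemma MemH1.integrable_mul_sq {u Q : E N → ℝ} (hu : MemH1 u) (hQ : Continuous Q) {M : ℝ}
    (hM : ∀ x, |Q x| ≤ M) : Integrable fun x => Q x * u x ^ 2 :=
  hu.integrable_sq.bdd_mul hQ.aestronglyMeasurable (ae_of_all _ hM)

lemma memLp_bdd_mul {u Q : E N → ℝ} (hu : MemLp u 2) (hQ : Continuous Q) {M : ℝ}
    (hM : ∀ x, |Q x| ≤ M) : MemLp (fun x => Q x * u x) 2 := by
  refine (hu.norm.const_mul M).mono (hQ.aestronglyMeasurable.mul hu.1) (ae_of_all _ fun x => ?_)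
  have hM0 : 0 ≤ M := (abs_nonneg _).trans (hM x)
  rw [norm_mul, norm_mul, norm_norm, Real.norm_eq_abs, Real.norm_of_nonneg hM0]
  exact mul_le_mul_of_nonneg_right (hM x) (norm_nonneg _)

/-- The difference u_n² - (u_n - u₀)² = 2u_n u₀ - u₀² is affine in u_n, so weak convergence
suffices. -/
lemma WeakTendsto.tendsto_integral_mul_sq_sub {u : ℕ → E N → ℝ} {u₀ : E N → ℝ}
    (h : WeakTendsto u u₀) {Q : E N → ℝ} (hQ : Continuous Q) {M : ℝ} (hM : ∀ x, |Q x| ≤ M) :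
    Tendsto (fun n => (∫ x, Q x * u n x ^ 2) - ∫ x, Q x * (u n x - u₀ x) ^ 2) atTop
      (𝓝 (∫ x, Q x * u₀ x ^ 2)) := by
  have h0 := h.memH1_lim
  have hQ0 := memLp_bdd_mul h0.1 hQ hM
  have key : ∀ n, (∫ x, Q x * u n x ^ 2) - ∫ x, Q x * (u n x - u₀ x) ^ 2
      = 2 * (∫ x, u n x * (Q x * u₀ x)) - ∫ x, Q x * u₀ x ^ 2 := by
    intro n
    have i1 := (h.memH1 n).integrable_mul_sq hQ hM
    have i2 := ((h.memH1 n).sub h0).integrable_mul_sq hQ hM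
    have i3 := integrable_mul_of_memLp_two (h.memH1 n).1 hQ0
    rw [← integral_sub i1 i2, ← integral_const_mul, ← integral_sub (i3.const_mul 2)
      (h0.integrable_mul_sq hQ hM)]
    congr 1
    ext x
    ring
  simp_rw [key]
  have := ((h.tendsto _ hQ0).const_mul 2).sub_const (∫ x, Q x * u₀ x ^ 2)
  convert this using 2
  have : ∫ x, u₀ x * (Q x * u₀ x) = ∫ x, Q x * u₀ x ^ 2 := by
    congr 1
    ext x
    ring
  rw [this]
  ring

lemma WeakTendsto.tendsto_gradSq_sub {u : ℕ → E N → ℝ} {u₀ : E N → ℝ} (h : WeakTendsto u u₀) :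
    Tendsto (fun n => gradSq (u n) - gradSq fun x => u n x - u₀ x) atTop (𝓝 (gradSq u₀)) := by
  have h0 := h.memH1_lim
  have key : ∀ n, gradSq (u n) - gradSq (fun x => u n x - u₀ x)
      = 2 * (∫ x, inner ℝ (weakGradient (u n) x) (weakGradient u₀ x)) - gradSq u₀ := by
    intro n
    have hn := h.memH1 n
    rw [(hn.isH1.sub h0.isH1).gradSq_eq]
    unfold gradSq
    have i1 := hn.integrable_grad
    have i2 := h0.integrable_grad
    have i3 := integrable_inner_of_memLp_two hn.isH1.memLp_grad h0.isH1.memLp_grad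
    have : ∀ x, ‖weakGradient (u n) x - weakGradient u₀ x‖ ^ 2
        = ‖weakGradient (u n) x‖ ^ 2 - 2 * inner ℝ (weakGradient (u n) x) (weakGradient u₀ x)
          + ‖weakGradient u₀ x‖ ^ 2 := fun x => norm_sub_sq_real _ _
    simp_rw [this]
    have i4 : Integrable fun x => ‖weakGradient (u n) x‖ ^ 2
        - 2 * inner ℝ (weakGradient (u n) x) (weakGradient u₀ x) := i1.sub (i3.const_mul 2)
    rw [integral_add i4 i2, integral_sub i1 (i3.const_mul 2),
      integral_const_mul]
    ring
  simp_rw [key]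
  have := ((h.tendsto_grad _ h0.isH1.memLp_grad).const_mul 2).sub_const (gradSq u₀)
  convert this using 2
  unfold gradSq
  simp_rw [real_inner_self_eq_norm_sq]
  ring

/-- A lower bound for quadratic forms through the Hardy inequality. -/
lemma MemH1.integral_mul_sq_ge {u Q : E N → ℝ} (hN : 3 ≤ N) (hu : MemH1 u) (hQ : Continuous Q)
    {M c : ℝ} (hM : ∀ x, |Q x| ≤ M) (hc : 0 ≤ c) (h : ∀ x, x ≠ 0 → -(c / ‖x‖ ^ 2) ≤ Q x) :
    -(c * (4 / ((N : ℝ) - 2) ^ 2 * gradSq u)) ≤ ∫ x, Q x * u x ^ 2 := by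
  obtain ⟨h1, h2⟩ := hu.hardy hN
  have hN0 : 0 < N := by omega
  have : Nonempty (Fin N) := ⟨⟨0, hN0⟩⟩
  have h3 : ∫ x, -(c * (u x ^ 2 / ‖x‖ ^ 2)) ≤ ∫ x, Q x * u x ^ 2 := by
    refine integral_mono_ae (h1.const_mul c).neg (hu.integrable_mul_sq hQ hM) ?_
    have : ∀ᵐ x : E N, x ≠ 0 := by simp [ae_iff]
    filter_upwards [this] with x hx
    have := mul_le_mul_of_nonneg_right (h x hx) (sq_nonneg (u x))
    refine le_trans (le_of_eq ?_) this
    ring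
  rw [integral_neg, integral_const_mul] at h3
  have := mul_le_mul_of_nonneg_left h2 hc
  linarith

/-- Control of the gradient is upgraded to control of the full norm. Outside a ball of radius R one
has Q > q/2. Inside, the deficit q/2 - Q is at most (M + q/2) R²/|x|², which Hardy's inequality
bounds by the gradient already controlled. -/
lemma exists_coercive (hN : 3 ≤ N) {Q : E N → ℝ} (hQ : Continuous Q) {q a b : ℝ} (hq : 0 < q)
    (hlim : Tendsto Q (cocompact (E N)) (𝓝 q)) (hb : 0 < b)
    (h : ∀ u : E N → ℝ, MemH1 u → b * gradSq u ≤ a * gradSq u + ∫ x, Q x * u x ^ 2) :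
    ∃ κ : ℝ, 0 < κ ∧ ∀ u : E N → ℝ, MemH1 u →
      κ * (gradSq u + massSq u) ≤ a * gradSq u + ∫ x, Q x * u x ^ 2 := by
  obtain ⟨M, hM0, hM⟩ := exists_bound_of_tendsto_cocompact hQ hlim
  obtain ⟨R, hR⟩ : ∃ R : ℝ, ∀ x : E N, R < ‖x‖ → q / 2 < Q x := by
    have h1 := hlim.eventually_const_lt (half_lt_self hq)
    rw [← Metric.cobounded_eq_cocompact,
      (Metric.hasBasis_cobounded_compl_closedBall (0 : E N)).eventually_iff] at h1
    obtain ⟨R, -, hR⟩ := h1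
    exact ⟨R, fun x hx => hR (by simpa using hx)⟩
  have hN' : (3 : ℝ) ≤ N := by exact_mod_cast hN
  set K := (M + q / 2) * R ^ 2 * (4 / ((N : ℝ) - 2) ^ 2) with hK
  have hK0 : 0 ≤ K := by positivity
  have hmass : ∀ u : E N → ℝ, MemH1 u → q / 2 * massSq u ≤ (∫ x, Q x * u x ^ 2) + K * gradSq u := by
    intro u hu
    have h1 := hu.integral_mul_sq_ge (Q := fun x => Q x - q / 2) hN (hQ.sub continuous_const)
      (M := M + q / 2) (c := (M + q / 2) * R ^ 2)
      (fun x => (abs_sub _ _).trans (by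
        rw [abs_of_pos (half_pos hq)]
        linarith [hM x])) (by positivity) (fun x hx => by
        rcases le_or_gt ‖x‖ R with hxR | hxR
        · have hx0 : 0 < ‖x‖ := norm_pos_iff.2 hx
          have h2 : 1 ≤ R ^ 2 / ‖x‖ ^ 2 := by
            rw [one_le_div (by positivity)]
            gcongr
          have h3 := mul_le_mul_of_nonneg_left h2 (by positivity : 0 ≤ M + q / 2)
          rw [mul_div_assoc]
          linarith [neg_abs_le (Q x), hM x]
        · have := hR x hxR
          have h3 : 0 ≤ (M + q / 2) * R ^ 2 / ‖x‖ ^ 2 := by positivity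
          linarith)
    have h2 : ∫ x, (Q x - q / 2) * u x ^ 2 = (∫ x, Q x * u x ^ 2) - q / 2 * massSq u := by
      unfold massSq
      rw [← integral_const_mul, ← integral_sub (hu.integrable_mul_sq hQ hM)
        (hu.integrable_sq.const_mul _)]
      congr 1
      ext x
      ring
    rw [h2, ← mul_assoc, ← hK] at h1
    linarith
  set L := 1 / b + (1 + (|a| + K) / b) * (2 / q) with hL
  have hL0 : 0 < L := by positivity
  refine ⟨1 / L, by positivity, fun u hu => ?_⟩
  have h1 := h u hu
  have h2 := hmass u hu
  have g0 := gradSq_nonneg u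
  set T := a * gradSq u + ∫ x, Q x * u x ^ 2
  have hA : gradSq u ≤ T / b := by
    rw [le_div_iff₀ hb]
    linarith
  have hmm : massSq u ≤ (1 + (|a| + K) / b) * T * (2 / q) := by
    have h3 : q / 2 * massSq u ≤ T + (|a| + K) * (T / b) := by
      have h4 : (|a| + K) * gradSq u ≤ (|a| + K) * (T / b) := by gcongr
      have h5 := mul_le_mul_of_nonneg_right (neg_abs_le a) g0
      simp only [T] at h4 ⊢
      linarith
    calc massSq u = (q / 2 * massSq u) * (2 / q) := by field_simp
      _ ≤ (T + (|a| + K) * (T / b)) * (2 / q) := by gcongr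
      _ = _ := by ring
  rw [one_div, inv_mul_le_iff₀ hL0]
  calc gradSq u + massSq u ≤ T / b + (1 + (|a| + K) / b) * T * (2 / q) := add_le_add hA hmm
    _ = L * T := by
        rw [hL]
        ring

/-- Quadratic forms with coefficients vanishing at infinity are compact. -/
lemma tendsto_integral_mul_sq_zero (hN : 3 ≤ N) {Q : E N → ℝ} (hQ : Continuous Q)
    (hlim : Tendsto Q (cocompact (E N)) (𝓝 0)) {u : ℕ → E N → ℝ} (hu : ∀ n, MemH1 (u n)) {C : ℝ}
    (hg : ∀ n, gradSq (u n) ≤ C) (hm : ∀ n, massSq (u n) ≤ C)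
    (hae : ∀ᵐ x, Tendsto (fun n => u n x) atTop (𝓝 0)) :
    Tendsto (fun n => ∫ x, Q x * u n x ^ 2) atTop (𝓝 0) := by
  obtain ⟨M, hM0, hM⟩ := exists_bound_of_tendsto_cocompact hQ hlim
  obtain ⟨K, hK0, hK⟩ := exists_growth_bound hN C
  have hC0 : 0 ≤ C := (gradSq_nonneg _).trans (hg 0)
  have hN' : (3 : ℝ) ≤ N := by exact_mod_cast hN
  have hs2 : 2 < sobExp N := by
    unfold sobExp
    rw [lt_div_iff₀ (by linarith)]
    linarith
  rw [Metric.tendsto_atTop]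
  intro ε hε
  set η := ε / (3 * (C + 1)) with hη
  have hη0 : 0 < η := by positivity
  obtain ⟨R, hR⟩ : ∃ R : ℝ, ∀ x : E N, R < ‖x‖ → |Q x| < η := by
    have h1 := hlim.abs.eventually_lt_const (u := η) (by simpa using hη0)
    rw [← Metric.cobounded_eq_cocompact,
      (Metric.hasBasis_cobounded_compl_closedBall (0 : E N)).eventually_iff] at h1
    obtain ⟨R, -, hR⟩ := h1
    exact ⟨R, fun x hx => hR (by simpa using hx)⟩
  obtain ⟨T, hT0, hT⟩ : ∃ T : ℝ, 0 < T ∧ M * T ^ (-(sobExp N - 2)) * K < ε / 3 := by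
    have h1 : Tendsto (fun T : ℝ => M * T ^ (-(sobExp N - 2)) * K) atTop (𝓝 (M * 0 * K)) :=
      ((tendsto_rpow_neg_atTop (by linarith)).const_mul M).mul_const K
    rw [mul_zero, zero_mul] at h1
    obtain ⟨T, hT, hT0⟩ := ((h1.eventually_lt_const (by positivity : (0 : ℝ) < ε / 3)).and
      (eventually_gt_atTop 0)).exists
    exact ⟨T, hT0, hT⟩
  set B := Metric.closedBall (0 : E N) R with hB
  have hcont : Continuous fun t : ℝ => min (t ^ 2) (T ^ 2) := by fun_prop
  have htrunc : Tendsto (fun n => ∫ x in B, min (u n x ^ 2) (T ^ 2)) atTop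
      (𝓝 (∫ _ in B, (0 : ℝ))) := by
    have hfin : IntegrableOn (fun _ : E N => T ^ 2) B := integrableOn_const measure_closedBall_lt_top.ne
    refine tendsto_integral_of_dominated_convergence (fun _ => T ^ 2)
      (fun n => (hcont.comp_aestronglyMeasurable (hu n).1.1).restrict) hfin
      (fun n => ae_of_all _ fun x => ?_) (ae_restrict_of_ae ?_)
    · rw [Real.norm_of_nonneg (by positivity)]
      exact min_le_right _ _
    · filter_upwards [hae] with x hx
      have := (hcont.tendsto 0).comp hx
      simpa [Function.comp_def, sq_nonneg] using this
  rw [integral_zero] at htrunc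
  have h1 := htrunc.const_mul M
  rw [mul_zero] at h1
  obtain ⟨n₀, hn₀⟩ := eventually_atTop.1 (h1.eventually_lt_const (by positivity : (0 : ℝ) < ε / 3))
  refine ⟨n₀, fun n hn => ?_⟩
  rw [dist_zero_right]
  have hti : Integrable (B.indicator fun x => min (u n x ^ 2) (T ^ 2)) := by
    rw [integrable_indicator_iff Metric.isClosed_closedBall.measurableSet]
    refine ((hu n).integrable_sq.mono' (hcont.comp_aestronglyMeasurable (hu n).1.1)
      (ae_of_all _ fun x => ?_)).integrableOn
    rw [Real.norm_of_nonneg (by positivity)]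
    exact min_le_left _ _
  have hgi := (hu n).integrable_growth hN
  -- Outside the ball |Q| < η. Inside, values up to T are handled by dominated convergence of the
  -- truncation, and larger values satisfy u² ≤ T^(-(2*-2)) |u|^(2*), which is small because 2* > 2.
  have hpt : ∀ x, ‖Q x * u n x ^ 2‖ ≤ η * u n x ^ 2
      + M * B.indicator (fun x => min (u n x ^ 2) (T ^ 2)) x
      + M * T ^ (-(sobExp N - 2)) * growth N (u n x) := by
    intro x
    have hg0 := growth_nonneg (N := N) (u n x)
    have hT' : 0 ≤ M * T ^ (-(sobExp N - 2)) * growth N (u n x) := by positivity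
    have hu2 := sq_nonneg (u n x)
    rw [norm_mul, Real.norm_eq_abs, Real.norm_of_nonneg hu2]
    by_cases hx : x ∈ B
    · rw [indicator_of_mem hx]
      have h3 : 0 ≤ η * u n x ^ 2 := by positivity
      have h4 := mul_le_mul_of_nonneg_right (hM x) hu2
      rcases le_total (u n x ^ 2) (T ^ 2) with h5 | h5
      · rw [min_eq_left h5]
        linarith
      · have h6 : T ≤ |u n x| := by
          rw [← abs_of_pos hT0]
          exact sq_le_sq.1 h5
        have h7 : 0 < |u n x| := hT0.trans_le h6
        have h8 : u n x ^ 2 ≤ T ^ (-(sobExp N - 2)) * growth N (u n x) := by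
          calc u n x ^ 2 = |u n x| ^ (2 : ℝ) := by rw [Real.rpow_two, sq_abs]
            _ = |u n x| ^ (-(sobExp N - 2)) * |u n x| ^ sobExp N := by
                rw [← Real.rpow_add h7]
                congr 1
                ring
            _ ≤ T ^ (-(sobExp N - 2)) * growth N (u n x) := by
                refine mul_le_mul ?_ ?_ (by positivity) (by positivity)
                · exact Real.rpow_le_rpow_of_nonpos hT0 h6 (by linarith)
                · unfold growth
                  linarith
        have h9 := mul_le_mul_of_nonneg_left h8 hM0.le
        have h10 : 0 ≤ M * min (u n x ^ 2) (T ^ 2) := by positivity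
        linarith
    · rw [indicator_of_notMem hx, mul_zero, add_zero]
      have hxR : R < ‖x‖ := by simpa [hB] using hx
      have := mul_le_mul_of_nonneg_right (hR x hxR).le hu2
      linarith
  have hbound : ‖∫ x, Q x * u n x ^ 2‖ ≤ ∫ x, (η * u n x ^ 2
      + M * B.indicator (fun x => min (u n x ^ 2) (T ^ 2)) x
      + M * T ^ (-(sobExp N - 2)) * growth N (u n x)) :=
    norm_integral_le_of_norm_le ((((hu n).integrable_sq.const_mul η).add (hti.const_mul M)).add
      (hgi.const_mul _)) (ae_of_all _ hpt)
  refine hbound.trans_lt ?_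
  have e1 : ∫ x, (η * u n x ^ 2 + M * B.indicator (fun x => min (u n x ^ 2) (T ^ 2)) x
      + M * T ^ (-(sobExp N - 2)) * growth N (u n x))
      = η * massSq (u n) + M * (∫ x in B, min (u n x ^ 2) (T ^ 2))
        + M * T ^ (-(sobExp N - 2)) * ∫ x, growth N (u n x) := by
    have i1 : Integrable fun x => η * u n x ^ 2
        + M * B.indicator (fun x => min (u n x ^ 2) (T ^ 2)) x :=
      ((hu n).integrable_sq.const_mul η).add (hti.const_mul M)
    rw [integral_add i1 (hgi.const_mul _),
      integral_add ((hu n).integrable_sq.const_mul η) (hti.const_mul M), integral_const_mul,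
      integral_const_mul, integral_const_mul,
      integral_indicator Metric.isClosed_closedBall.measurableSet]
    rfl
  rw [e1]
  have h2 : η * massSq (u n) ≤ ε / 3 := by
    calc η * massSq (u n) ≤ η * (C + 1) := by
          gcongr
          linarith [hm n]
      _ = ε / 3 := by
          rw [hη]
          field_simp
  have h3 : M * T ^ (-(sobExp N - 2)) * ∫ x, growth N (u n x) < ε / 3 := by
    refine lt_of_le_of_lt ?_ hT
    gcongr
    exact hK _ (hu n) (hg n) (hm n)
  linarith [hn₀ n hn]

end QuadraticForms

/-! ### The reduced energy, coercivity, and the dilation inequality. -/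

section Functionals

variable {N : ℕ} {α : ℝ} {V : E N → ℝ} {Vinf θ : ℝ} {f : ℝ → ℝ}

/-- The coefficient of `u²` in `𝓘 - 𝓟 / (N+α)`. -/
def reducedPotential (α : ℝ) (V : E N → ℝ) (x : E N) : ℝ :=
  1 / 2 * (V x - virial V x / ((N : ℝ) + α))

/-- The functional `𝓘 - 𝓟 / (N+α)`, which does not see the nonlinearity. -/
def reducedEnergy (α : ℝ) (V u : E N → ℝ) : ℝ :=
  (2 + α) / (2 * ((N : ℝ) + α)) * gradSq u + ∫ x, reducedPotential α V x * u x ^ 2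

/-- The quadratic part of `𝓟`. -/
def virialForm (V u : E N → ℝ) : ℝ :=
  ((N : ℝ) - 2) / 2 * gradSq u + ∫ x, (1 / 2 * virial V x) * u x ^ 2

lemma pohozaev_eq (u : E N → ℝ) : pohozaev α V f u
    = virialForm V u - ((N : ℝ) + α) / 2 * nonlocalTerm α f u := by
  unfold pohozaev virialForm gradSq virial
  simp_rw [mul_assoc, integral_const_mul]

lemma dilate_one (u : E N → ℝ) : dilate 1 u = u := by
  ext x
  simp [dilate]

lemma dilate_dilate (s t : ℝ) (u : E N → ℝ) : dilate s (dilate t u) = dilate (s * t) u := by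
  ext x
  simp [dilate, smul_smul, mul_comm]

lemma ae_eq_zero_of_dilate {t : ℝ} (ht : 0 < t) {u : E N → ℝ} (h : dilate t u =ᵐ[volume] 0) :
    u =ᵐ[volume] 0 := by
  have h1 : dilate t⁻¹ (dilate t u) =ᵐ[volume] dilate t⁻¹ 0 := by
    have hq : Measure.QuasiMeasurePreserving (fun x : E N => (t⁻¹)⁻¹ • x) volume volume := by
      rw [inv_inv]
      refine ⟨measurable_const_smul t, ?_⟩
      rw [Measure.map_addHaar_smul _ ht.ne']
      exact Measure.smul_absolutelyContinuous
    exact hq.ae_eq_comp h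
  rwa [dilate_dilate, inv_mul_cancel₀ ht.ne', dilate_one] at h1

namespace PotentialHyp

lemma exists_bound (P : PotentialHyp N α V Vinf θ) : ∃ M : ℝ, 0 < M ∧ ∀ x, |V x| ≤ M :=
  exists_bound_of_tendsto_cocompact P.v1.1 P.v1.2.2.1

lemma exists_virial_bound (P : PotentialHyp N α V Vinf θ) :
    ∃ M : ℝ, 0 < M ∧ ∀ x, |virial V x| ≤ M :=
  exists_bound_of_tendsto_cocompact P.continuous_virial P.tendsto_virial

lemma integrable_mul_sq (P : PotentialHyp N α V Vinf θ) {u : E N → ℝ} (hu : MemH1 u) :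
    Integrable fun x => V x * u x ^ 2 := by
  obtain ⟨M, -, hM⟩ := P.exists_bound
  exact hu.integrable_mul_sq P.v1.1 hM

lemma integrable_virial_mul_sq (P : PotentialHyp N α V Vinf θ) {u : E N → ℝ} (hu : MemH1 u) :
    Integrable fun x => virial V x * u x ^ 2 := by
  obtain ⟨M, -, hM⟩ := P.exists_virial_bound
  exact hu.integrable_mul_sq P.continuous_virial hM

lemma energy_eq (P : PotentialHyp N α V Vinf θ) {u : E N → ℝ} (hu : MemH1 u) : energy α V f u
    = 1 / 2 * gradSq u + 1 / 2 * (∫ x, V x * u x ^ 2) - 1 / 2 * nonlocalTerm α f u := by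
  unfold energy gradSq
  rw [integral_add hu.integrable_grad (P.integrable_mul_sq hu), mul_add]

lemma reducedEnergy_eq (P : PotentialHyp N α V Vinf θ) {u : E N → ℝ} (hu : MemH1 u) :
    reducedEnergy α V u = energy α V f u - pohozaev α V f u / ((N : ℝ) + α) := by
  have hN := P.three_le'
  have hα := P.pos
  have h1 : ∫ x, reducedPotential α V x * u x ^ 2 = 1 / 2 * (∫ x, V x * u x ^ 2)
      - 1 / (2 * ((N : ℝ) + α)) * ∫ x, virial V x * u x ^ 2 := by
    rw [← integral_const_mul, ← integral_const_mul, ← integral_sub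
      ((P.integrable_mul_sq hu).const_mul _) ((P.integrable_virial_mul_sq hu).const_mul _)]
    congr 1
    ext x
    unfold reducedPotential
    field_simp
  have h2 : ∫ x, (1 / 2 * virial V x) * u x ^ 2 = 1 / 2 * ∫ x, virial V x * u x ^ 2 := by
    rw [← integral_const_mul]
    simp_rw [mul_assoc]
  rw [P.energy_eq hu, pohozaev_eq]
  unfold reducedEnergy virialForm
  rw [h1, h2]
  field_simp
  ring

lemma continuous_reducedPotential (P : PotentialHyp N α V Vinf θ) :
    Continuous (reducedPotential α V) :=
  (P.v1.1.sub (P.continuous_virial.div_const _)).const_mul _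

lemma tendsto_reducedPotential (P : PotentialHyp N α V Vinf θ) :
    Tendsto (reducedPotential α V) (cocompact (E N))
      (𝓝 (1 / 2 * (Vinf - (N : ℝ) * Vinf / ((N : ℝ) + α)))) :=
  (P.v1.2.2.1.sub (P.tendsto_virial.div_const _)).const_mul _

/-- Hardy's inequality converts the singular lower bound from `virial_le` into exactly the fraction
θ of the gradient term. This is why (N-2)³/4 is the natural constant in (V3); the fraction 1 - θ
remains. -/
lemma exists_reducedEnergy_ge (P : PotentialHyp N α V Vinf θ) : ∃ κ : ℝ, 0 < κ ∧
    ∀ u : E N → ℝ, MemH1 u → κ * (gradSq u + massSq u) ≤ reducedEnergy α V u := by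
  have hN := P.three_le'
  have hα := P.pos
  have hθ := P.nonneg
  have hθ1 := P.lt_one
  have hV := P.v1.2.2.2
  obtain ⟨M, -, hM⟩ := exists_bound_of_tendsto_cocompact P.continuous_reducedPotential
    P.tendsto_reducedPotential
  refine exists_coercive P.three_le P.continuous_reducedPotential (b := (1 - θ) * ((2 + α)
    / (2 * ((N : ℝ) + α)))) ?_ P.tendsto_reducedPotential ?_ fun u hu => ?_
  · have : Vinf - (N : ℝ) * Vinf / ((N : ℝ) + α) = Vinf * α / ((N : ℝ) + α) := by
      field_simp
      ring
    rw [this]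
    positivity
  · have : 0 < 1 - θ := by linarith
    positivity
  · have hN2 : 0 < (N : ℝ) - 2 := by linarith
    have h0 : 0 ≤ 1 / ((N : ℝ) - 2) - 1 / ((N : ℝ) + α) := by
      rw [sub_nonneg]
      exact one_div_le_one_div_of_le hN2 (by linarith)
    have := hu.integral_mul_sq_ge P.three_le P.continuous_reducedPotential
      (c := 1 / 2 * (((N : ℝ) - 2) ^ 3 * θ / 4 * (1 / ((N : ℝ) - 2) - 1 / ((N : ℝ) + α)))) hM
      (by positivity) (fun x hx => by
        have h1 := P.virial_le hx
        have h2 : 1 / 2 * (((N : ℝ) - 2) ^ 3 * θ / 4 * (1 / ((N : ℝ) - 2) - 1 / ((N : ℝ) + α)))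
            / ‖x‖ ^ 2 = 1 / 2 * (((N : ℝ) - 2) ^ 3 * θ / 4 / ‖x‖ ^ 2
            * (1 / ((N : ℝ) - 2) - 1 / ((N : ℝ) + α))) := by ring
        unfold reducedPotential
        rw [h2]
        linarith)
    have e : 1 / 2 * (((N : ℝ) - 2) ^ 3 * θ / 4 * (1 / ((N : ℝ) - 2) - 1 / ((N : ℝ) + α)))
        * (4 / ((N : ℝ) - 2) ^ 2 * gradSq u) = θ * ((2 + α) / (2 * ((N : ℝ) + α))) * gradSq u := by
      field_simp
      ring
    rw [e] at this
    linarith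

/-- The same computation with `virial_ge`: the singular part costs θ(N-2)/2 of the gradient
coefficient (N-2)/2. -/
lemma exists_virialForm_ge (P : PotentialHyp N α V Vinf θ) : ∃ κ : ℝ, 0 < κ ∧
    ∀ u : E N → ℝ, MemH1 u → κ * (gradSq u + massSq u) ≤ virialForm V u := by
  have hN := P.three_le'
  have hα := P.pos
  have hθ := P.nonneg
  have hθ1 := P.lt_one
  have hV := P.v1.2.2.2
  have hN2 : 0 < (N : ℝ) - 2 := by linarith
  obtain ⟨M, -, hM⟩ := P.exists_virial_bound
  have hcont : Continuous fun x => 1 / 2 * virial V x := P.continuous_virial.const_mul _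
  refine exists_coercive P.three_le hcont (q := 1 / 2 * ((N : ℝ) * Vinf))
    (b := (1 - θ) * (((N : ℝ) - 2) / 2)) (by positivity)
    (P.tendsto_virial.const_mul _) ?_ fun u hu => ?_
  · have : 0 < 1 - θ := by linarith
    positivity
  · have := hu.integral_mul_sq_ge P.three_le hcont
      (c := 1 / 2 * (((N : ℝ) - 2) ^ 3 * θ / 4)) (M := 1 / 2 * M) (fun x => by
        rw [abs_mul, abs_of_pos (by norm_num : (0 : ℝ) < 1 / 2)]
        linarith [hM x])
      (by positivity) (fun x hx => by
        have h1 := P.virial_ge hx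
        rw [mul_div_assoc]
        linarith)
    have e : 1 / 2 * (((N : ℝ) - 2) ^ 3 * θ / 4)
        * (4 / ((N : ℝ) - 2) ^ 2 * gradSq u) = θ * (((N : ℝ) - 2) / 2) * gradSq u := by
      field_simp
    rw [e] at this
    linarith

/-- The fundamental inequality relating `𝓘(u)`, `𝓘(u_t)` and `𝓟(u)`. -/
lemma energy_ge_energy_dilate (P : PotentialHyp N α V Vinf θ) {u : E N → ℝ} (hu : MemH1 u)
    {t : ℝ} (ht : 0 < t) :
    energy α V f (dilate t u) + (1 - t ^ ((N : ℝ) + α)) / ((N : ℝ) + α) * pohozaev α V f u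
      + (1 - θ) * ((N : ℝ) - 2) / 2 * dilationGap N α t * gradSq u ≤ energy α V f u := by
  have hN := P.three_le'
  have hα := P.pos
  have hθ := P.nonneg
  have hN2 : 0 < (N : ℝ) - 2 := by linarith
  have hut := hu.dilate ht
  obtain ⟨M, hM0, hM⟩ := P.exists_bound
  obtain ⟨M', hM0', hM'⟩ := P.exists_virial_bound
  have hk := P.dilationGap_nonneg ht
  set k := dilationGap N α t with hkdef
  set β := (1 - t ^ ((N : ℝ) + α)) / ((N : ℝ) + α) with hβ
  -- This is the coefficient of u² in twice the part of the inequality that involves V. The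
  -- integrated (V3) bounds it below by a multiple of -|x|⁻², to which Hardy applies.
  set Q : E N → ℝ := fun x => V x - t ^ (N : ℝ) * V (t • x) - β * virial V x with hQ
  have hVt : Continuous fun x => V (t • x) := P.v1.1.comp (continuous_const_smul t)
  have hQc : Continuous Q := (P.v1.1.sub (hVt.const_mul _)).sub (P.continuous_virial.const_mul _)
  have hQb : ∀ x, |Q x| ≤ M + t ^ (N : ℝ) * M + |β| * M' := by
    intro x
    have h1 := abs_sub (V x - t ^ (N : ℝ) * V (t • x)) (β * virial V x)
    have h2 := abs_sub (V x) (t ^ (N : ℝ) * V (t • x))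
    have h3 : |t ^ (N : ℝ) * V (t • x)| ≤ t ^ (N : ℝ) * M := by
      rw [abs_mul, abs_of_pos (by positivity : 0 < t ^ (N : ℝ))]
      gcongr
      exact hM _
    have h4 : |β * virial V x| ≤ |β| * M' := by
      rw [abs_mul]
      gcongr
      exact hM' _
    linarith [hM x]
  have h1 := hu.integral_mul_sq_ge P.three_le hQc (c := ((N : ℝ) - 2) ^ 3 * θ / 4 * k) hQb
    (by positivity) (fun x hx => by
      have := P.sub_dilate_ge hx ht
      rw [← hβ, ← hkdef] at this
      simp only [hQ]
      rw [mul_div_right_comm]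
      linarith)
  have e1 : ((N : ℝ) - 2) ^ 3 * θ / 4 * k * (4 / ((N : ℝ) - 2) ^ 2 * gradSq u)
      = θ * ((N : ℝ) - 2) * k * gradSq u := by
    field_simp
  rw [e1] at h1
  have i1 := P.integrable_mul_sq hu
  have i2 : Integrable fun x => V (t • x) * u x ^ 2 := hu.integrable_mul_sq hVt fun x => hM _
  have i3 := P.integrable_virial_mul_sq hu
  have e2 : ∫ x, Q x * u x ^ 2 = (∫ x, V x * u x ^ 2) - t ^ (N : ℝ) * (∫ x, V (t • x) * u x ^ 2)
      - β * ∫ x, virial V x * u x ^ 2 := by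
    have i4 : Integrable fun x => V x * u x ^ 2 - t ^ (N : ℝ) * (V (t • x) * u x ^ 2) :=
      i1.sub (i2.const_mul _)
    rw [← integral_const_mul, ← integral_const_mul, ← integral_sub i1 (i2.const_mul _),
      ← integral_sub i4 (i3.const_mul _)]
    congr 1
    ext x
    simp only [hQ]
    ring
  rw [e2] at h1
  have e3 : ∫ x, (1 / 2 * virial V x) * u x ^ 2 = 1 / 2 * ∫ x, virial V x * u x ^ 2 := by
    rw [← integral_const_mul]
    simp_rw [mul_assoc]
  rw [P.energy_eq hu, P.energy_eq hut, hu.gradSq_dilate ht, integral_mul_dilate_sq ht,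
    nonlocalTerm_dilate ht, pohozaev_eq]
  unfold virialForm
  rw [e3]
  -- By definition k + β = (1 - t^(N-2))/(N-2). Expressing both powers of t through k and β makes
  -- the remaining inequality linear.
  have e4 : t ^ ((N : ℝ) - 2) = 1 - ((N : ℝ) - 2) * (k + β) := by
    simp only [hkdef, dilationGap, hβ]
    field_simp
    ring
  have e5 : t ^ ((N : ℝ) + α) = 1 - ((N : ℝ) + α) * β := by
    simp only [hβ]
    field_simp
    ring
  rw [e4, e5]
  linarith

end PotentialHyp

end Functionals

/-! ### Dilations onto 𝓜 and weak limits of minimizing sequences. -/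

section PohozaevManifold

variable {N : ℕ} {α : ℝ} {V : E N → ℝ} {Vinf θ : ℝ} {f : ℝ → ℝ}

lemma continuous_integral_comp_smul {w Q : E N → ℝ} (hw : Integrable w) (hQ : Continuous Q) {M : ℝ}
    (hM : ∀ x, |Q x| ≤ M) : Continuous fun t : ℝ => ∫ x, Q (t • x) * w x := by
  refine continuous_of_dominated (bound := fun x => M * ‖w x‖) (fun t => ?_) (fun t => ?_)
    (hw.norm.const_mul M) (ae_of_all _ fun x => ?_)
  · exact (hQ.comp (continuous_const_smul t)).aestronglyMeasurable.mul hw.1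
  · refine ae_of_all _ fun x => ?_
    rw [norm_mul]
    exact mul_le_mul_of_nonneg_right (hM _) (norm_nonneg _)
  · exact (hQ.comp (continuous_id.smul continuous_const)).mul continuous_const

lemma MemH1.massSq_pos {u : E N → ℝ} (hu : MemH1 u) (h0 : ¬ u =ᵐ[volume] 0) : 0 < massSq u := by
  refine (massSq_nonneg u).lt_of_ne fun h => h0 ?_
  have := (integral_eq_zero_iff_of_nonneg (fun x => sq_nonneg (u x)) hu.integrable_sq).1 h.symm
  filter_upwards [this] with x hx
  simpa using hx

lemma massSq_dilate {t : ℝ} (ht : 0 < t) (u : E N → ℝ) :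
    massSq (dilate t u) = t ^ (N : ℝ) * massSq u := by
  have := integral_mul_dilate_sq ht (fun _ => 1) u
  simpa [massSq] using this

lemma nonlocalTerm_zero {u : E N → ℝ} (h : u =ᵐ[volume] 0) : nonlocalTerm α f u = 0 := by
  rw [nonlocalTerm_congr h, nonlocalTerm_eq]
  simp [rieszForm]

namespace PotentialHyp

/-- After a change of variables t appears only in powers and inside the bounded coefficient, where
dominated convergence applies. -/
lemma continuousOn_pohozaev_dilate (P : PotentialHyp N α V Vinf θ) {u : E N → ℝ} (hu : MemH1 u) :
    ContinuousOn (fun t : ℝ => pohozaev α V f (dilate t u)) (Ioi 0) := by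
  obtain ⟨M, -, hM⟩ := P.exists_virial_bound
  have hM' : ∀ x, |1 / 2 * virial V x| ≤ M := fun x => by
    rw [abs_mul, abs_of_pos (by norm_num : (0 : ℝ) < 1 / 2)]
    linarith [hM x, abs_nonneg (virial V x)]
  have h1 := continuous_integral_comp_smul hu.integrable_sq (P.continuous_virial.const_mul (1 / 2)) hM'
  have hr : ∀ r : ℝ, ContinuousOn (fun t : ℝ => t ^ r) (Ioi 0) := fun r =>
    continuousOn_id.rpow_const fun t ht => Or.inl (ne_of_gt ht)
  have h2 : ContinuousOn (fun t : ℝ => ((N : ℝ) - 2) / 2 * (t ^ ((N : ℝ) - 2) * gradSq u)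
      + t ^ (N : ℝ) * (∫ x, (1 / 2 * virial V (t • x)) * u x ^ 2)
      - ((N : ℝ) + α) / 2 * (t ^ ((N : ℝ) + α) * nonlocalTerm α f u)) (Ioi 0) :=
    ((((hr _).mul continuousOn_const).const_mul _).add ((hr _).mul h1.continuousOn)).sub
      (((hr _).mul continuousOn_const).const_mul _)
  refine h2.congr fun t ht => ?_
  have ht' : 0 < t := ht
  simp only
  rw [pohozaev_eq, nonlocalTerm_dilate ht']
  unfold virialForm
  rw [hu.gradSq_dilate ht', integral_mul_dilate_sq ht' (fun x => 1 / 2 * virial V x)]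

/-- Near zero the coercive quadratic part, of order r = ‖∇u‖² + ‖u‖², beats the nonlocal term, of
order r^(1+α/N). -/
lemma exists_pohozaev_pos (P : PotentialHyp N α V Vinf θ) (H : NonlinearityHyp N α f) :
    ∃ ρ : ℝ, 0 < ρ ∧ ∀ u : E N → ℝ, MemH1 u → ¬ u =ᵐ[volume] 0 → gradSq u + massSq u < ρ →
      0 < pohozaev α V f u := by
  have hN := P.three_le'
  have hα := P.pos
  obtain ⟨κ, hκ, hcoer⟩ := P.exists_virialForm_ge
  obtain ⟨C, hC, hD⟩ := H.exists_abs_nonlocalTerm_le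
  obtain ⟨C₁, hC₁, hG⟩ := exists_integral_growth_le P.three_le
  set γ := ((N : ℝ) + α) / N with hγ
  have hγ1 : γ - 1 = α / N := by
    rw [hγ]
    field_simp
    ring
  have hγ0 : 0 < γ := by positivity
  set K := ((N : ℝ) + α) / 2 * (C * (1 + C₁) ^ γ) with hK
  have hK0 : 0 < K := by positivity
  -- The bound 1 gives (‖∇u‖²)^(2*/2) ≤ ‖∇u‖²; the other bound makes K r^(α/N) < κ.
  refine ⟨min 1 ((κ / K) ^ (N / α : ℝ)), by positivity, fun u hu hne hr => ?_⟩
  have hm := hu.massSq_pos hne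
  have hA := gradSq_nonneg u
  set r := gradSq u + massSq u with hrdef
  have hr0 : 0 < r := by linarith
  have hr1 : r < 1 := hr.trans_le (min_le_left _ _)
  have hr2 : r ^ (α / N : ℝ) < κ / K := by
    calc r ^ (α / N : ℝ) < ((κ / K) ^ (N / α : ℝ)) ^ (α / N : ℝ) :=
          Real.rpow_lt_rpow hr0.le (hr.trans_le (min_le_right _ _)) (by positivity)
      _ = κ / K := by
          rw [← Real.rpow_mul (by positivity), show (N / α : ℝ) * (α / N) = 1 by field_simp,
            Real.rpow_one]
  have hs := two_le_sobExp P.three_le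
  have hgr : ∫ x, growth N (u x) ≤ (1 + C₁) * r := by
    have h1 : gradSq u ^ (sobExp N / 2) ≤ gradSq u := by
      rcases hA.eq_or_lt with h | h
      · rw [← h, Real.zero_rpow (by positivity)]
      · calc gradSq u ^ (sobExp N / 2) ≤ gradSq u ^ (1 : ℝ) :=
              Real.rpow_le_rpow_of_exponent_ge h (by linarith) (by linarith)
          _ = gradSq u := Real.rpow_one _
    have h2 := hG u hu
    have h3 := mul_le_mul_of_nonneg_left h1 hC₁.le
    have h4 : C₁ * gradSq u ≤ C₁ * r := by
      gcongr
      linarith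
    linarith
  have hg0 : 0 ≤ ∫ x, growth N (u x) := integral_nonneg fun x => growth_nonneg _
  have hDu : ((N : ℝ) + α) / 2 * nonlocalTerm α f u ≤ K * r ^ (α / N : ℝ) * r := by
    calc ((N : ℝ) + α) / 2 * nonlocalTerm α f u
        ≤ ((N : ℝ) + α) / 2 * (C * (∫ x, growth N (u x)) ^ γ) := by
          gcongr
          exact (le_abs_self _).trans (hD u hu)
      _ ≤ ((N : ℝ) + α) / 2 * (C * ((1 + C₁) * r) ^ γ) := by gcongr
      _ = K * r ^ γ := by
          rw [Real.mul_rpow (by positivity) hr0.le, hK]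
          ring
      _ = K * r ^ (α / N : ℝ) * r := by
          rw [← hγ1, Real.rpow_sub_one hr0.ne']
          field_simp
  have h5 : K * r ^ (α / N : ℝ) * r < κ * r := by
    rw [lt_div_iff₀ hK0] at hr2
    exact mul_lt_mul_of_pos_right (by linarith) hr0
  rw [pohozaev_eq]
  have := hcoer u hu
  linarith

/-- For t → 0 the dilates tend to zero in H¹, where 𝓟 > 0. For t → ∞ the nonlocal term, scaling like
t^(N+α), dominates the quadratic terms and makes 𝓟 negative. The intermediate value theorem supplies
a zero. -/
lemma exists_dilate_mem (P : PotentialHyp N α V Vinf θ) (H : NonlinearityHyp N α f) {u : E N → ℝ}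
    (hu : MemH1 u) (hD : 0 < nonlocalTerm α f u) :
    ∃ t : ℝ, 0 < t ∧ dilate t u ∈ pohozaevManifold α V f := by
  have hN := P.three_le'
  have hα := P.pos
  have hne : ¬ u =ᵐ[volume] 0 := fun h => hD.ne' (nonlocalTerm_zero h)
  have hne' : ∀ t : ℝ, 0 < t → ¬ dilate t u =ᵐ[volume] 0 := fun t ht h =>
    hne (ae_eq_zero_of_dilate ht h)
  obtain ⟨ρ, hρ, hpos⟩ := P.exists_pohozaev_pos H
  obtain ⟨M, hM0, hM⟩ := P.exists_virial_bound
  obtain ⟨a, ha0, ha⟩ : ∃ a : ℝ, 0 < a ∧ 0 < pohozaev α V f (dilate a u) := by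
    have hz : ∀ r : ℝ, 0 < r → Tendsto (fun t : ℝ => t ^ r) (𝓝[>] 0) (𝓝 0) := by
      intro r hr
      have := (Real.continuousAt_rpow_const 0 r (Or.inr hr.le)).tendsto
      rw [Real.zero_rpow hr.ne'] at this
      exact this.mono_left nhdsWithin_le_nhds
    have h1 : Tendsto (fun t : ℝ => t ^ ((N : ℝ) - 2) * gradSq u + t ^ (N : ℝ) * massSq u)
        (𝓝[>] 0) (𝓝 (0 * gradSq u + 0 * massSq u)) :=
      ((hz _ (by linarith)).mul_const _).add ((hz _ (by linarith)).mul_const _)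
    rw [zero_mul, zero_mul, add_zero] at h1
    obtain ⟨t, ht, ht0⟩ := ((h1.eventually_lt_const hρ).and self_mem_nhdsWithin).exists
    refine ⟨t, ht0, hpos _ (hu.dilate ht0) (hne' t ht0) ?_⟩
    rwa [hu.gradSq_dilate ht0, massSq_dilate ht0]
  obtain ⟨b, hab, hb⟩ : ∃ b : ℝ, a < b ∧ pohozaev α V f (dilate b u) < 0 := by
    have hz : ∀ r : ℝ, 0 < r → Tendsto (fun t : ℝ => t ^ (-r)) atTop (𝓝 0) :=
      fun r hr => tendsto_rpow_neg_atTop hr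
    have h1 : Tendsto (fun t : ℝ => ((N : ℝ) - 2) / 2 * (t ^ (-(2 + α)) * gradSq u)
        + t ^ (-α) * (M * massSq u) - ((N : ℝ) + α) / 2 * nonlocalTerm α f u) atTop
        (𝓝 (((N : ℝ) - 2) / 2 * (0 * gradSq u) + 0 * (M * massSq u)
          - ((N : ℝ) + α) / 2 * nonlocalTerm α f u)) :=
      ((((hz _ (by linarith)).mul_const _).const_mul _).add ((hz _ hα).mul_const _)).sub_const _
    have hneg : ((N : ℝ) - 2) / 2 * (0 * gradSq u) + 0 * (M * massSq u)
          - ((N : ℝ) + α) / 2 * nonlocalTerm α f u < 0 := by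
      have : 0 < ((N : ℝ) + α) / 2 * nonlocalTerm α f u := by positivity
      linarith
    obtain ⟨t, ht, hat⟩ := ((h1.eventually_lt_const hneg).and (eventually_gt_atTop a)).exists
    have ht0 : 0 < t := ha0.trans hat
    refine ⟨t, hat, ?_⟩
    rw [pohozaev_eq, nonlocalTerm_dilate ht0]
    unfold virialForm
    rw [hu.gradSq_dilate ht0]
    have hbd : ∫ x, (1 / 2 * virial V x) * dilate t u x ^ 2 ≤ t ^ (N : ℝ) * (M * massSq u) := by
      have h2 : M * (t ^ (N : ℝ) * massSq u) = ∫ x, M * dilate t u x ^ 2 := by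
        rw [integral_const_mul, ← massSq_dilate ht0]
        rfl
      rw [mul_left_comm, h2]
      refine integral_mono ?_ ((hu.dilate ht0).integrable_sq.const_mul M) fun x => ?_
      · have := (P.integrable_virial_mul_sq (hu.dilate ht0)).const_mul (1 / 2)
        simpa [mul_assoc] using this
      · refine mul_le_mul_of_nonneg_right ?_ (sq_nonneg _)
        linarith [(le_abs_self _).trans (hM x), hM x, abs_nonneg (virial V x)]
    have r1 : t ^ ((N : ℝ) - 2) = t ^ ((N : ℝ) + α) * t ^ (-(2 + α)) := by
      rw [← Real.rpow_add ht0]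
      congr 1
      ring
    have r2 : t ^ (N : ℝ) = t ^ ((N : ℝ) + α) * t ^ (-α) := by
      rw [← Real.rpow_add ht0]
      congr 1
      ring
    have htp : 0 < t ^ ((N : ℝ) + α) := by positivity
    have h3 := mul_neg_of_pos_of_neg htp ht
    rw [r1]
    rw [r2] at hbd
    linarith
  have hcont : ContinuousOn (fun t : ℝ => pohozaev α V f (dilate t u)) (Icc a b) :=
    (P.continuousOn_pohozaev_dilate hu).mono fun t ht => ha0.trans_le ht.1
  obtain ⟨t, ht, ht0⟩ := intermediate_value_Icc' hab.le hcont ⟨hb.le, ha.le⟩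
  have ht' : 0 < t := ha0.trans_le ht.1
  exact ⟨t, ht', hu.dilate ht', hne' t ht', ht0⟩

/-- The quadratic part of 𝓟 is strictly positive for u ≠ 0, so 𝓟(u) ≤ 0 forces the other term to be
positive. In particular 𝓜 lies in Λ. -/
lemma nonlocalTerm_pos (P : PotentialHyp N α V Vinf θ) {u : E N → ℝ} (hu : MemH1 u)
    (hne : ¬ u =ᵐ[volume] 0) (hP : pohozaev α V f u ≤ 0) : 0 < nonlocalTerm α f u := by
  have hN := P.three_le'
  have hα := P.pos
  obtain ⟨κ, hκ, hcoer⟩ := P.exists_virialForm_ge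
  have h1 := hcoer u hu
  rw [pohozaev_eq] at hP
  have h2 : 0 < κ * (gradSq u + massSq u) :=
    mul_pos hκ (add_pos_of_nonneg_of_pos (gradSq_nonneg u) (hu.massSq_pos hne))
  have h3 : 0 < ((N : ℝ) + α) / 2 * nonlocalTerm α f u := by linarith
  exact pos_of_mul_pos_right h3 (by positivity)

lemma energy_dilate_le (P : PotentialHyp N α V Vinf θ) {u : E N → ℝ}
    (hu : u ∈ pohozaevManifold α V f) {t : ℝ} (ht : 0 < t) :
    energy α V f (dilate t u) ≤ energy α V f u := by
  have hN := P.three_le'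
  have h1 := P.energy_ge_energy_dilate (f := f) hu.1 ht
  rw [hu.2.2, mul_zero, add_zero] at h1
  have h2 : 0 ≤ (1 - θ) * ((N : ℝ) - 2) / 2 * dilationGap N α t * gradSq u := by
    have h3 : 0 ≤ 1 - θ := by linarith [P.lt_one]
    have h4 : 0 ≤ (N : ℝ) - 2 := by linarith
    have := P.dilationGap_nonneg ht
    have := gradSq_nonneg u
    positivity
  linarith

lemma exists_norm_ge (P : PotentialHyp N α V Vinf θ) (H : NonlinearityHyp N α f) :
    ∃ ρ : ℝ, 0 < ρ ∧ ∀ u ∈ pohozaevManifold α V f, ρ ≤ gradSq u + massSq u := by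
  obtain ⟨ρ, hρ, h⟩ := P.exists_pohozaev_pos H
  refine ⟨ρ, hρ, fun u hu => ?_⟩
  by_contra! hlt
  exact (h u hu.1 hu.2.1 hlt).ne' hu.2.2

lemma reducedEnergy_eq_energy (P : PotentialHyp N α V Vinf θ) {u : E N → ℝ}
    (hu : u ∈ pohozaevManifold α V f) : reducedEnergy α V u = energy α V f u := by
  rw [P.reducedEnergy_eq (f := f) hu.1, hu.2.2, zero_div, sub_zero]

/-- On 𝓜 the energy equals the coercive reduced energy, and 𝓜 stays away from zero. -/
lemma exists_energy_ge (P : PotentialHyp N α V Vinf θ) (H : NonlinearityHyp N α f) :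
    ∃ c : ℝ, 0 < c ∧ ∀ u ∈ pohozaevManifold α V f, c ≤ energy α V f u := by
  obtain ⟨ρ, hρ, h⟩ := P.exists_norm_ge H
  obtain ⟨κ, hκ, hcoer⟩ := P.exists_reducedEnergy_ge
  refine ⟨κ * ρ, by positivity, fun u hu => ?_⟩
  rw [← P.reducedEnergy_eq_energy hu]
  exact (mul_le_mul_of_nonneg_left (h u hu) hκ.le).trans (hcoer u hu.1)

/-- If `u ≠ 0` and `𝓟(u) ≤ 0` then the reduced energy dominates the infimum over the manifold. -/
lemma le_reducedEnergy (P : PotentialHyp N α V Vinf θ) (H : NonlinearityHyp N α f) {m : ℝ}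
    (hm : ∀ w ∈ pohozaevManifold α V f, m ≤ energy α V f w) {u : E N → ℝ} (hu : MemH1 u)
    (hne : ¬ u =ᵐ[volume] 0) (hP : pohozaev α V f u ≤ 0) :
    m ≤ reducedEnergy α V u ∧ (pohozaev α V f u < 0 → m < reducedEnergy α V u) := by
  have hN := P.three_le'
  have hα := P.pos
  obtain ⟨t, ht, htm⟩ := P.exists_dilate_mem H hu (P.nonlocalTerm_pos hu hne hP)
  have h1 := P.energy_ge_energy_dilate (f := f) hu ht
  have h2 := hm _ htm
  have h3 : 0 ≤ (1 - θ) * ((N : ℝ) - 2) / 2 * dilationGap N α t * gradSq u := by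
    have h3 : 0 ≤ 1 - θ := by linarith [P.lt_one]
    have h4 : 0 ≤ (N : ℝ) - 2 := by linarith
    have := P.dilationGap_nonneg ht
    have := gradSq_nonneg u
    positivity
  -- Taken at the factor t that sends u onto 𝓜, the dilation inequality leaves the surplus
  -- -t^(N+α)/(N+α) · 𝓟(u), which is the source of the strict inequality.
  have e1 : reducedEnergy α V u = energy α V f u - (1 - t ^ ((N : ℝ) + α)) / ((N : ℝ) + α)
      * pohozaev α V f u - t ^ ((N : ℝ) + α) / ((N : ℝ) + α) * pohozaev α V f u := by
    rw [P.reducedEnergy_eq (f := f) hu]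
    ring
  have hc : 0 < t ^ ((N : ℝ) + α) / ((N : ℝ) + α) := by positivity
  constructor
  · have := mul_nonpos_of_nonneg_of_nonpos hc.le hP
    linarith
  · intro hlt
    have := mul_neg_of_pos_of_neg hc hlt
    linarith

/-- Splitting of the reduced energy and of `𝓟` along weakly convergent sequences. -/
lemma tendsto_splitting (P : PotentialHyp N α V Vinf θ) (H : NonlinearityHyp N α f)
    {u : ℕ → E N → ℝ} {u₀ : E N → ℝ} (h : WeakTendsto u u₀) {C : ℝ}
    (hg : ∀ n, gradSq (u n) ≤ C) (hm : ∀ n, massSq (u n) ≤ C)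
    (hae : ∀ᵐ x, Tendsto (fun n => u n x) atTop (𝓝 (u₀ x))) :
    Tendsto (fun n => reducedEnergy α V (u n) - reducedEnergy α V fun x => u n x - u₀ x) atTop
      (𝓝 (reducedEnergy α V u₀)) ∧
    Tendsto (fun n => pohozaev α V f (u n) - pohozaev α V f fun x => u n x - u₀ x) atTop
      (𝓝 (pohozaev α V f u₀)) := by
  have hA := h.tendsto_gradSq_sub
  have hD := H.tendsto_nonlocalTerm_sub h.memH1 h.memH1_lim hg hm hae
  obtain ⟨M, -, hM⟩ := exists_bound_of_tendsto_cocompact P.continuous_reducedPotential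
    P.tendsto_reducedPotential
  have hQ := h.tendsto_integral_mul_sq_sub P.continuous_reducedPotential hM
  obtain ⟨M', -, hM'⟩ := exists_bound_of_tendsto_cocompact (P.continuous_virial.const_mul (1 / 2))
    (P.tendsto_virial.const_mul (1 / 2))
  have hW := h.tendsto_integral_mul_sq_sub (P.continuous_virial.const_mul (1 / 2)) hM'
  constructor
  · unfold reducedEnergy
    refine ((hA.const_mul ((2 + α) / (2 * ((N : ℝ) + α)))).add hQ).congr fun n => ?_
    ring
  · simp_rw [pohozaev_eq]
    unfold virialForm
    refine (((hA.const_mul (((N : ℝ) - 2) / 2)).add hW).sub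
      (hD.const_mul (((N : ℝ) + α) / 2))).congr fun n => ?_
    ring

/-- A nonzero weak limit of an almost minimizing sequence lies on the manifold and minimizes. -/
lemma mem_of_weakTendsto (P : PotentialHyp N α V Vinf θ) (H : NonlinearityHyp N α f) {m : ℝ}
    (hm : ∀ w ∈ pohozaevManifold α V f, m ≤ energy α V f w)
    {u : ℕ → E N → ℝ} {u₀ : E N → ℝ} (h : WeakTendsto u u₀) {C : ℝ}
    (hg : ∀ n, gradSq (u n) ≤ C) (hmass : ∀ n, massSq (u n) ≤ C)
    (hae : ∀ᵐ x, Tendsto (fun n => u n x) atTop (𝓝 (u₀ x))) (hne : ¬ u₀ =ᵐ[volume] 0)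
    (hΨ : Tendsto (fun n => reducedEnergy α V (u n)) atTop (𝓝 m))
    (hP : Tendsto (fun n => pohozaev α V f (u n)) atTop (𝓝 0)) :
    u₀ ∈ pohozaevManifold α V f ∧ energy α V f u₀ ≤ m := by
  obtain ⟨κ, hκ, hcoer⟩ := P.exists_reducedEnergy_ge
  have hpos : ∀ w : E N → ℝ, MemH1 w → 0 ≤ reducedEnergy α V w := fun w hw =>
    (mul_nonneg hκ.le (add_nonneg (gradSq_nonneg w) (massSq_nonneg w))).trans (hcoer w hw)
  have h0 := h.memH1_lim
  have hw := fun n => (h.memH1 n).sub h0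
  have hΨ0 : 0 < reducedEnergy α V u₀ :=
    (mul_pos hκ (add_pos_of_nonneg_of_pos (gradSq_nonneg u₀) (h0.massSq_pos hne))).trans_le
      (hcoer u₀ h0)
  obtain ⟨s1, s2⟩ := P.tendsto_splitting H h hg hmass hae
  have w1 : Tendsto (fun n => reducedEnergy α V fun x => u n x - u₀ x) atTop
      (𝓝 (m - reducedEnergy α V u₀)) := (hΨ.sub s1).congr fun n => by ring
  have w2 : Tendsto (fun n => pohozaev α V f fun x => u n x - u₀ x) atTop
      (𝓝 (0 - pohozaev α V f u₀)) := (hP.sub s2).congr fun n => by ring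
  have hle : reducedEnergy α V u₀ ≤ m := by
    have := ge_of_tendsto w1 (Eventually.of_forall fun n => hpos _ (hw n))
    linarith
  have hPz : pohozaev α V f u₀ = 0 := by
    -- Let Ψ be the reduced energy; Ψ(u₀) ≤ m. If 𝓟(u₀) < 0, then Ψ(u₀) > m, a contradiction. If
    -- 𝓟(u₀) > 0, the remainders eventually have 𝓟 < 0, hence Ψ ≥ m, so that m - Ψ(u₀) ≥ m against
    -- Ψ(u₀) > 0.
    rcases lt_trichotomy (pohozaev α V f u₀) 0 with hlt | heq | hgt
    · have := (P.le_reducedEnergy H hm h0 hne hlt.le).2 hlt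
      linarith
    · exact heq
    · exfalso
      have hev : ∀ᶠ n in atTop, pohozaev α V f (fun x => u n x - u₀ x) < 0 :=
        w2.eventually_lt_const (by linarith)
      have hev2 : ∀ᶠ n in atTop, m ≤ reducedEnergy α V fun x => u n x - u₀ x := by
        filter_upwards [hev] with n hn
        refine (P.le_reducedEnergy H hm (hw n) (fun hz => ?_) hn.le).1
        have hz1 : pohozaev α V f (fun x => u n x - u₀ x) = 0 := by
          have e1 := MemH1.isH1 (hw n)
          have e2 : IsH1 (fun x => u n x - u₀ x) (fun x => (0 : ℝ) • weakGradient u₀ x) :=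
            (h0.isH1.const_mul 0).congr (by
              filter_upwards [hz] with x hx
              rw [hx]
              simp) (ae_eq_refl _)
          rw [pohozaev_eq, nonlocalTerm_zero hz]
          unfold virialForm
          rw [e2.gradSq_eq]
          have e3 : ∫ x, (1 / 2 * virial V x) * (u n x - u₀ x) ^ 2 = 0 := by
            refine integral_eq_zero_of_ae ?_
            filter_upwards [hz] with x hx
            have : u n x - u₀ x = 0 := hx
            simp [this]
          rw [e3]
          simp
        exact hn.ne hz1
      have := ge_of_tendsto w1 hev2
      linarith
  refine ⟨⟨h0, hne, hPz⟩, ?_⟩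
  have := P.reducedEnergy_eq (f := f) h0
  rw [hPz, zero_div, sub_zero] at this
  linarith

end PotentialHyp

end PohozaevManifold

/-! ### Existence of a minimizer through the problem at infinity. -/

section Minimizer

variable {N : ℕ} {α : ℝ} {V : E N → ℝ} {Vinf θ : ℝ} {f : ℝ → ℝ}

lemma virial_const (c : ℝ) (x : E N) : virial (fun _ : E N => c) x = (N : ℝ) * c := by
  simp [virial]

lemma reducedEnergy_const (c : ℝ) (u : E N → ℝ) : reducedEnergy α (fun _ => c) u
    = (2 + α) / (2 * ((N : ℝ) + α)) * gradSq u
      + 1 / 2 * (c - (N : ℝ) * c / ((N : ℝ) + α)) * massSq u := by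
  simp only [reducedEnergy, reducedPotential, virial_const, integral_const_mul, massSq]

lemma virialForm_const (c : ℝ) (u : E N → ℝ) : virialForm (fun _ => c) u
    = ((N : ℝ) - 2) / 2 * gradSq u + 1 / 2 * ((N : ℝ) * c) * massSq u := by
  simp only [virialForm, virial_const, integral_const_mul, massSq]

namespace PotentialHyp

lemma energy_le_const (P : PotentialHyp N α V Vinf θ) {u : E N → ℝ} (hu : MemH1 u) :
    energy α V f u ≤ energy α (fun _ => Vinf) f u := by
  have P' := PotentialHyp.const P.three_le P.pos P.v1.2.2.2
  rw [P.energy_eq hu, P'.energy_eq hu]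
  have : ∫ x, V x * u x ^ 2 ≤ ∫ x, Vinf * u x ^ 2 :=
    integral_mono (P.integrable_mul_sq hu) (P'.integrable_mul_sq hu) fun x =>
      mul_le_mul_of_nonneg_right (P.v2 x) (sq_nonneg _)
  linarith

/-- The minimal energy at infinity is not smaller than the minimal energy. -/
lemma le_energy_const (P : PotentialHyp N α V Vinf θ) (H : NonlinearityHyp N α f)
    {w : E N → ℝ} (hw : w ∈ pohozaevManifold α (fun _ => Vinf) f) :
    ∃ t : ℝ, dilate t w ∈ pohozaevManifold α V f ∧
      energy α V f (dilate t w) ≤ energy α (fun _ => Vinf) f w := by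
  have P' := PotentialHyp.const P.three_le P.pos P.v1.2.2.2
  obtain ⟨t, ht, htm⟩ := P.exists_dilate_mem H hw.1 (P'.nonlocalTerm_pos hw.1 hw.2.1 hw.2.2.le)
  exact ⟨t, htm, (P.energy_le_const htm.1).trans (P'.energy_dilate_le hw ht)⟩

/-- Along sequences vanishing locally, the functionals approach those at infinity. -/
lemma tendsto_sub_const (P : PotentialHyp N α V Vinf θ) {u : ℕ → E N → ℝ} (hu : ∀ n, MemH1 (u n))
    {C : ℝ} (hg : ∀ n, gradSq (u n) ≤ C) (hm : ∀ n, massSq (u n) ≤ C)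
    (hae : ∀ᵐ x, Tendsto (fun n => u n x) atTop (𝓝 0)) :
    Tendsto (fun n => reducedEnergy α V (u n) - reducedEnergy α (fun _ => Vinf) (u n)) atTop (𝓝 0) ∧
    Tendsto (fun n => pohozaev α V f (u n) - pohozaev α (fun _ => Vinf) f (u n)) atTop (𝓝 0) := by
  set q := 1 / 2 * (Vinf - (N : ℝ) * Vinf / ((N : ℝ) + α)) with hq
  have t1 := P.tendsto_reducedPotential.sub_const q
  rw [← hq, sub_self] at t1
  have t2 := (P.tendsto_virial.const_mul (1 / 2)).sub_const (1 / 2 * ((N : ℝ) * Vinf))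
  rw [sub_self] at t2
  have c1 : Continuous fun x => reducedPotential α V x - q := P.continuous_reducedPotential.sub (continuous_const (y := q))
  have c2 : Continuous fun x => 1 / 2 * virial V x - 1 / 2 * ((N : ℝ) * Vinf) := (P.continuous_virial.const_mul (1 / 2)).sub
    (continuous_const (y := 1 / 2 * ((N : ℝ) * Vinf)))
  have l1 := tendsto_integral_mul_sq_zero P.three_le c1 t1 hu hg hm hae
  have l2 := tendsto_integral_mul_sq_zero P.three_le c2 t2 hu hg hm hae
  obtain ⟨M, -, hM⟩ := exists_bound_of_tendsto_cocompact P.continuous_reducedPotential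
    P.tendsto_reducedPotential
  have hsplit : ∀ (Q : E N → ℝ) (r : ℝ) (n : ℕ), Integrable (fun x => Q x * u n x ^ 2) →
      ∫ x, (Q x - r) * u n x ^ 2 = (∫ x, Q x * u n x ^ 2) - r * massSq (u n) := by
    intro Q r n hi
    unfold massSq
    rw [← integral_const_mul, ← integral_sub hi ((hu n).integrable_sq.const_mul r)]
    congr 1
    ext x
    ring
  constructor
  · refine l1.congr fun n => ?_
    rw [hsplit _ _ _ ((hu n).integrable_mul_sq P.continuous_reducedPotential hM),
      reducedEnergy_const, ← hq]
    unfold reducedEnergy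
    ring
  · refine l2.congr fun n => ?_
    have hi : Integrable fun x => (1 / 2 * virial V x) * u n x ^ 2 := by
      simpa [mul_assoc] using (P.integrable_virial_mul_sq (hu n)).const_mul (1 / 2)
    rw [hsplit _ _ _ hi, pohozaev_eq, pohozaev_eq, virialForm_const]
    unfold virialForm
    ring

/-- Concentration–compactness without Palais–Smale sequences: a bounded minimizing sequence either
has a nonzero weak limit, or loses compactness by translation. In the second case the profile found
solves the minimization for V∞ at a level not above m, and a dilation brings it back to 𝓜 because V
≤ V∞. -/
theorem exists_minimizer (P : PotentialHyp N α V Vinf θ) (H : NonlinearityHyp N α f)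
    (h3 : CondF3 f) :
    ∃ u₀ ∈ pohozaevManifold α V f, ∀ w ∈ pohozaevManifold α V f,
      energy α V f u₀ ≤ energy α V f w := by
  have hN := P.three_le'
  have hα := P.pos
  obtain ⟨c, hc, hlow⟩ := P.exists_energy_ge H
  obtain ⟨κ, hκ, hcoer⟩ := P.exists_reducedEnergy_ge
  set S := energy α V f '' pohozaevManifold α V f with hS
  have hSne : S.Nonempty := by
    obtain ⟨u, hu⟩ := H.exists_mem_Lam h3
    obtain ⟨t, -, ht⟩ := P.exists_dilate_mem H hu.1 hu.2
    exact ⟨_, mem_image_of_mem _ ht⟩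
  have hSb : BddBelow S := ⟨c, by
    rintro _ ⟨u, hu, rfl⟩
    exact hlow u hu⟩
  set m := sInf S with hm
  have hmle : ∀ w ∈ pohozaevManifold α V f, m ≤ energy α V f w := fun w hw =>
    csInf_le hSb (mem_image_of_mem _ hw)
  suffices ∃ u₀ ∈ pohozaevManifold α V f, energy α V f u₀ ≤ m by
    obtain ⟨u₀, h1, h2⟩ := this
    exact ⟨u₀, h1, fun w hw => h2.trans (hmle w hw)⟩
  obtain ⟨e, -, he, heS⟩ := exists_seq_tendsto_sInf hSne hSb
  choose u hu hue using heS
  have hΨ : Tendsto (fun n => reducedEnergy α V (u n)) atTop (𝓝 m) :=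
    he.congr fun n => by rw [P.reducedEnergy_eq_energy (hu n), hue n]
  obtain ⟨B, hB⟩ := hΨ.bddAbove_range
  have hsum : ∀ n, gradSq (u n) + massSq (u n) ≤ B / κ := fun n => by
    rw [le_div_iff₀' hκ]
    exact (hcoer _ (hu n).1).trans (hB (mem_range_self n))
  have hg : ∀ n, gradSq (u n) ≤ B / κ := fun n => by linarith [hsum n, massSq_nonneg (u n)]
  have hmass : ∀ n, massSq (u n) ≤ B / κ := fun n => by linarith [hsum n, gradSq_nonneg (u n)]
  obtain ⟨u₁, φ, hφ, hw⟩ := exists_weakTendsto (fun n => (hu n).1) hg hmass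
  obtain ⟨ψ, hψ, hae⟩ := hw.exists_subseq_ae fun n => hg _
  have hw' := hw.comp hψ
  set v : ℕ → E N → ℝ := fun n => u (φ (ψ n)) with hv
  have hφψ : Tendsto (fun n => φ (ψ n)) atTop atTop := (hφ.comp hψ).tendsto_atTop
  have hvM : ∀ n, v n ∈ pohozaevManifold α V f := fun n => hu _
  have hvg : ∀ n, gradSq (v n) ≤ B / κ := fun n => hg _
  have hvm : ∀ n, massSq (v n) ≤ B / κ := fun n => hmass _
  have hvΨ : Tendsto (fun n => reducedEnergy α V (v n)) atTop (𝓝 m) := hΨ.comp hφψ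
  by_cases h0 : u₁ =ᵐ[volume] 0
  swap
  · obtain ⟨h1, h2⟩ := P.mem_of_weakTendsto H hmle hw' hvg hvm hae h0 hvΨ (by
      simp [fun n => (hvM n).2.2])
    exact ⟨u₁, h1, h2⟩
  have hae0 : ∀ᵐ x, Tendsto (fun n => v n x) atTop (𝓝 0) := by
    filter_upwards [hae, h0] with x hx hx0
    rwa [hx0] at hx
  -- the sequence does not vanish
  obtain ⟨ρ, hρ, hnorm⟩ := P.exists_norm_ge H
  obtain ⟨κ', hκ', hcoer'⟩ := P.exists_virialForm_ge
  have hD : ∀ n, 2 / ((N : ℝ) + α) * (κ' * ρ) ≤ nonlocalTerm α f (v n) := by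
    intro n
    have h1 := (mul_le_mul_of_nonneg_left (hnorm _ (hvM n)) hκ'.le).trans (hcoer' _ (hvM n).1)
    have h2 := (hvM n).2.2
    rw [pohozaev_eq] at h2
    rw [div_mul_eq_mul_div, div_le_iff₀ (by positivity)]
    linarith
  -- Otherwise every level set has measure tending to zero along the whole sequence, and the
  -- nonlocal term tends to zero against its positive lower bound.
  obtain ⟨s, hs, δ, hδ, χ, hχ, hvol⟩ : ∃ s : ℝ, 0 < s ∧ ∃ δ : ℝ, 0 < δ ∧ ∃ χ : ℕ → ℕ, StrictMono χ ∧
      ∀ n, ENNReal.ofReal δ ≤ volume {x | s ≤ |v (χ n) x|} := by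
    by_contra! hcon
    have hvan : ∀ s : ℝ, 0 < s → Tendsto (fun n => volume {x | s ≤ |v n x|}) atTop (𝓝 0) := by
      intro s hs
      rw [ENNReal.tendsto_nhds_zero]
      intro ε hε
      by_contra hev
      rw [not_eventually] at hev
      obtain ⟨χ, hχ, hχv⟩ := extraction_of_frequently_atTop hev
      have hε1 : min ε 1 ≠ ⊤ := (min_lt_of_right_lt ENNReal.one_lt_top).ne
      obtain ⟨n, hn⟩ := hcon s hs (min ε 1).toReal
        (ENNReal.toReal_pos (lt_min hε one_pos).ne' hε1) χ hχ
      rw [ENNReal.ofReal_toReal hε1] at hn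
      exact absurd ((min_le_left _ _).trans (not_le.1 (hχv n)).le) (not_le.2 hn)
    have h1 := H.tendsto_nonlocalTerm_zero_of_vanishing (fun n => (hvM n).1) hvg hvm hvan
    have h2 := ge_of_tendsto h1 (Eventually.of_forall hD)
    have h3 : 0 < 2 / ((N : ℝ) + α) * (κ' * ρ) := by positivity
    linarith
  obtain ⟨w, y, τ, hτ, -, hwt, hw0⟩ := (hw'.comp hχ).exists_translate h0 (fun n => hvg _)
    (fun n => hvm _) hs hδ hvol
  have hgt : ∀ n, gradSq (fun x => v (χ (τ n)) (x + y n)) ≤ B / κ := fun n => by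
    rw [(hvM _).1.gradSq_comp_add]
    exact hvg _
  obtain ⟨σ, hσ, haew⟩ := hwt.exists_subseq_ae hgt
  have hwt' := hwt.comp hσ
  have P' := PotentialHyp.const P.three_le P.pos P.v1.2.2.2
  -- V is replaced by V∞ before translating, using that the untranslated sequence tends to zero
  -- almost everywhere; the functionals with constant potential are translation invariant.
  obtain ⟨d1, d2⟩ := P.tendsto_sub_const (f := f) (fun n => (hvM n).1) hvg hvm hae0
  have hsub : Tendsto (fun n => χ (τ (σ n))) atTop atTop :=
    ((hχ.comp hτ).comp hσ).tendsto_atTop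
  have e1 : Tendsto (fun n => reducedEnergy α (fun _ => Vinf) (v n)) atTop (𝓝 m) := by
    have := hvΨ.sub d1
    simpa using this
  have e2 : Tendsto (fun n => pohozaev α (fun _ => Vinf) f (v n)) atTop (𝓝 0) := by
    have := d2.neg
    simpa [fun n => (hvM n).2.2] using this
  -- The number m is also a lower bound for the energy on the manifold at infinity, since each of
  -- its points has a dilate on 𝓜 with no greater energy. The statement on weak limits therefore
  -- applies with the constant potential.
  obtain ⟨k1, k2⟩ := P'.mem_of_weakTendsto H (fun z hz => by
      obtain ⟨t, h1, h2⟩ := P.le_energy_const H hz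
      exact (hmle _ h1).trans h2) hwt' (fun n => hgt _)
    (fun n => by
      rw [massSq_comp_add]
      exact hvm _) haew hw0
    ((e1.comp hsub).congr fun n => by
      simp only [Function.comp]
      rw [reducedEnergy_const, reducedEnergy_const, (hvM _).1.gradSq_comp_add, massSq_comp_add])
    ((e2.comp hsub).congr fun n => by
      simp only [Function.comp]
      rw [pohozaev_eq, pohozaev_eq, virialForm_const, virialForm_const, (hvM _).1.gradSq_comp_add,
        massSq_comp_add, nonlocalTerm_comp_add])
  obtain ⟨t, h1, h2⟩ := P.le_energy_const H k1
  exact ⟨_, h1, h2.trans k2⟩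

end PotentialHyp

end Minimizer

/-! ### Minimizers on 𝓜 are weak solutions. -/

section CriticalPoint

variable {N : ℕ} {α : ℝ} {V : E N → ℝ} {Vinf θ : ℝ} {f : ℝ → ℝ}

lemma MemH1.gradSq_add_smul {u φ : E N → ℝ} (hu : MemH1 u) (hφ : MemH1 φ) (s : ℝ) :
    gradSq (fun x => u x + s * φ x) = gradSq u
      + 2 * s * (∫ x, inner ℝ (weakGradient u x) (weakGradient φ x)) + s ^ 2 * gradSq φ := by
  rw [hu.gradSq_add (hφ.const_mul s), hφ.gradSq_const_mul, hφ.integral_inner_const_mul]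
  ring

lemma MemH1.integrable_mul_mul {u φ Q : E N → ℝ} (hu : MemH1 u) (hφ : MemH1 φ) (hQ : Continuous Q)
    {M : ℝ} (hM : ∀ x, |Q x| ≤ M) : Integrable fun x => Q x * (u x * φ x) :=
  (integrable_mul_of_memLp_two hu.1 hφ.1).bdd_mul hQ.aestronglyMeasurable (ae_of_all _ hM)

lemma MemH1.integral_mul_add_smul_sq {u φ Q : E N → ℝ} (hu : MemH1 u) (hφ : MemH1 φ)
    (hQ : Continuous Q) {M : ℝ} (hM : ∀ x, |Q x| ≤ M) (s : ℝ) :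
    ∫ x, Q x * (u x + s * φ x) ^ 2 = (∫ x, Q x * u x ^ 2) + 2 * s * (∫ x, Q x * (u x * φ x))
      + s ^ 2 * ∫ x, Q x * φ x ^ 2 := by
  have i1 := hu.integrable_mul_sq hQ hM
  have i2 := hφ.integrable_mul_sq hQ hM
  have i3 := hu.integrable_mul_mul hφ hQ hM
  have i4 : Integrable fun x => Q x * u x ^ 2 + 2 * s * (Q x * (u x * φ x)) :=
    i1.add (i3.const_mul _)
  rw [← integral_const_mul, ← integral_const_mul, ← integral_add i1 (i3.const_mul _),
    ← integral_add i4 (i2.const_mul _)]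
  congr 1
  ext x
  ring

namespace PotentialHyp

lemma gradSq_pos (P : PotentialHyp N α V Vinf θ) {u : E N → ℝ} (hu : MemH1 u)
    (hne : ¬ u =ᵐ[volume] 0) : 0 < gradSq u := by
  refine (gradSq_nonneg u).lt_of_ne fun h => hne ?_
  obtain ⟨h1, h2⟩ := hu.hardy P.three_le
  rw [← h, mul_zero] at h2
  have hnn : 0 ≤ fun x => u x ^ 2 / ‖x‖ ^ 2 := fun x => by positivity
  have h3 := (integral_eq_zero_iff_of_nonneg hnn h1).1 (h2.antisymm (integral_nonneg hnn))
  have : Nonempty (Fin N) := ⟨⟨0, by have := P.three_le; omega⟩⟩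
  have hx0 : ∀ᵐ x : E N, x ≠ 0 := by simp [ae_iff]
  filter_upwards [h3, hx0] with x hx hxne
  simpa [hxne] using hx

/-- The dilation inequality is used from u to u_t and from u_t back to u. Adding the two cancels the
energies and leaves the strictly positive gap times ‖∇u‖². So 𝓟(u_t) is positive for t < 1 and
negative for t > 1. -/
lemma pohozaev_dilate_sign (P : PotentialHyp N α V Vinf θ) {u : E N → ℝ}
    (hu : u ∈ pohozaevManifold α V f) {t : ℝ} (ht : 0 < t) (ht1 : t ≠ 1) :
    (1 - t⁻¹ ^ ((N : ℝ) + α)) * pohozaev α V f (dilate t u) < 0 := by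
  have hN := P.three_le'
  have hα := P.pos
  have h1 := P.energy_ge_energy_dilate (f := f) hu.1 ht
  have h2 := P.energy_ge_energy_dilate (f := f) (hu.1.dilate ht) (inv_pos.2 ht)
  rw [dilate_dilate, inv_mul_cancel₀ ht.ne', dilate_one] at h2
  rw [hu.2.2, mul_zero, add_zero] at h1
  have h3 : 0 < 1 - θ := by linarith [P.lt_one]
  have h4 : 0 < (N : ℝ) - 2 := by linarith
  have h5 : 0 < (1 - θ) * ((N : ℝ) - 2) / 2 * dilationGap N α t * gradSq u := by
    have := P.dilationGap_pos ht ht1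
    have := P.gradSq_pos hu.1 hu.2.1
    positivity
  have h6 : 0 ≤ (1 - θ) * ((N : ℝ) - 2) / 2 * dilationGap N α t⁻¹ * gradSq (dilate t u) := by
    have := P.dilationGap_nonneg (inv_pos.2 ht)
    have := gradSq_nonneg (dilate t u)
    positivity
  have h7 : (1 - t⁻¹ ^ ((N : ℝ) + α)) / ((N : ℝ) + α) * pohozaev α V f (dilate t u) < 0 := by
    linarith
  rw [div_mul_eq_mul_div] at h7
  by_contra! h8
  exact absurd h7 (not_lt.2 (div_nonneg h8 (by linarith)))

lemma continuousAt_pohozaev (P : PotentialHyp N α V Vinf θ) (H : NonlinearityHyp N α f)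
    {u φ : E N → ℝ} (hu : MemH1 u) (hφ : MemH1 φ) :
    ContinuousAt (fun s : ℝ => pohozaev α V f fun x => u x + s * φ x) 0 := by
  obtain ⟨M, -, hM⟩ := exists_bound_of_tendsto_cocompact (P.continuous_virial.const_mul (1 / 2))
    (P.tendsto_virial.const_mul (1 / 2))
  have hD := (H.hasDerivAt_nonlocalTerm hu hφ).continuousAt
  simp_rw [pohozaev_eq]
  unfold virialForm
  simp_rw [hu.gradSq_add_smul hφ,
    hu.integral_mul_add_smul_sq hφ (P.continuous_virial.const_mul (1 / 2)) hM]
  refine ContinuousAt.sub (Continuous.continuousAt ?_) (continuousAt_const.mul hD)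
  fun_prop

/-- Perturbations of a point of the manifold can be projected onto it with dilation factor
close to one. -/
lemma eventually_exists_dilate_mem (P : PotentialHyp N α V Vinf θ) (H : NonlinearityHyp N α f)
    {u φ : E N → ℝ} (hu : u ∈ pohozaevManifold α V f) (hφ : MemH1 φ) {δ : ℝ} (hδ : 0 < δ)
    (hδ1 : δ < 1) : ∀ᶠ s : ℝ in 𝓝 0, ∃ t : ℝ, |t - 1| ≤ δ ∧
      dilate t (fun x => u x + s * φ x) ∈ pohozaevManifold α V f := by
  have hN := P.three_le'
  have hα := P.pos
  have ha : 0 < 1 - δ := by linarith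
  have hb : 0 < 1 + δ := by linarith
  have hpa : 0 < pohozaev α V f (dilate (1 - δ) u) := by
    have h1 := P.pohozaev_dilate_sign hu ha (by linarith)
    have h2 : 1 < (1 - δ)⁻¹ ^ ((N : ℝ) + α) :=
      Real.one_lt_rpow ((one_lt_inv₀ ha).2 (by linarith)) (by linarith)
    by_contra! h3
    exact absurd h1 (not_lt.2 (mul_nonneg_of_nonpos_of_nonpos (by linarith) h3))
  have hpb : pohozaev α V f (dilate (1 + δ) u) < 0 := by
    have h1 := P.pohozaev_dilate_sign hu hb (by linarith)
    have h2 : (1 + δ)⁻¹ ^ ((N : ℝ) + α) < 1 :=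
      Real.rpow_lt_one (by positivity) (inv_lt_one_of_one_lt₀ (by linarith)) (by linarith)
    by_contra! h3
    exact absurd h1 (not_lt.2 (mul_nonneg (by linarith) h3))
  -- The strict signs at 1 - δ and 1 + δ persist for small s, so continuity in s is needed only at
  -- these two fixed dilations; t is then found by continuity in t.
  have hc : ∀ t : ℝ, 0 < t → Tendsto (fun s : ℝ => pohozaev α V f
      (dilate t fun x => u x + s * φ x)) (𝓝 0) (𝓝 (pohozaev α V f (dilate t u))) := by
    intro t ht
    have := (P.continuousAt_pohozaev H (hu.1.dilate ht) (hφ.dilate ht)).tendsto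
    simp only [zero_mul, add_zero] at this
    exact this
  filter_upwards [(hc _ ha).eventually_const_lt hpa, (hc _ hb).eventually_lt_const hpb]
    with s hsa hsb
  have hus : MemH1 fun x => u x + s * φ x := hu.1.add (hφ.const_mul s)
  have hcont : ContinuousOn (fun t : ℝ => pohozaev α V f (dilate t fun x => u x + s * φ x))
      (Icc (1 - δ) (1 + δ)) :=
    (P.continuousOn_pohozaev_dilate hus).mono fun t ht => ha.trans_le ht.1
  obtain ⟨t, ht, ht0⟩ := intermediate_value_Icc' (by linarith) hcont ⟨hsb.le, hsa.le⟩
  have ht' : 0 < t := ha.trans_le ht.1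
  refine ⟨t, abs_le.2 ⟨by linarith [ht.1], by linarith [ht.2]⟩, hus.dilate ht', fun h => ?_, ht0⟩
  -- The dilate is not zero: if it were, the nonlocal term would vanish at 1 + δ too and 𝓟 would be
  -- nonnegative there.
  obtain ⟨κ, hκ, hcoer⟩ := P.exists_virialForm_ge
  have hz := ae_eq_zero_of_dilate ht' h
  have hzb : nonlocalTerm α f (dilate (1 + δ) fun x => u x + s * φ x) = 0 := by
    rw [nonlocalTerm_dilate hb, nonlocalTerm_zero hz, mul_zero]
  have h1 := hcoer _ (hus.dilate hb)
  rw [pohozaev_eq, hzb] at hsb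
  have h2 : 0 ≤ κ * (gradSq (dilate (1 + δ) fun x => u x + s * φ x)
      + massSq (dilate (1 + δ) fun x => u x + s * φ x)) :=
    mul_nonneg hκ.le (add_nonneg (gradSq_nonneg _) (massSq_nonneg _))
  linarith

/-- Minimality gives 𝓘(u) ≤ 𝓘((u+sφ)_t) when the latter lies on 𝓜, and maximality along dilations
gives 𝓘(u_t) ≤ 𝓘(u). The same t occurs on both sides, so no differentiability of t in s is needed; t
→ 1 is enough. -/
lemma first_variation_nonneg (P : PotentialHyp N α V Vinf θ) (H : NonlinearityHyp N α f)
    {u φ : E N → ℝ} (hu : u ∈ pohozaevManifold α V f)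
    (hmin : ∀ w ∈ pohozaevManifold α V f, energy α V f u ≤ energy α V f w) (hφ : MemH1 φ) :
    0 ≤ (∫ x, inner ℝ (weakGradient u x) (weakGradient φ x)) + (∫ x, V x * (u x * φ x))
      - rieszForm α (fun x => f (u x) * φ x) fun x => primitive f (u x) := by
  obtain ⟨M, -, hM⟩ := P.exists_bound
  set G := ∫ x, inner ℝ (weakGradient u x) (weakGradient φ x) with hG
  set R := rieszForm α (fun x => f (u x) * φ x) fun x => primitive f (u x) with hR
  have hR' := hasDerivAt_iff_tendsto_slope_zero.1 (H.hasDerivAt_nonlocalTerm hu.1 hφ)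
  simp only [zero_add, zero_mul, add_zero, smul_eq_mul, ← hR] at hR'
  -- J(s, t) is the quotient (𝓘((u+sφ)_t) - 𝓘(u_t))/s, written so that its limit as s → 0+ and t → 1
  -- jointly can be read off term by term.
  set J : ℝ × ℝ → ℝ := fun p => 1 / 2 * (p.2 ^ ((N : ℝ) - 2) * (2 * G + p.1 * gradSq φ))
    + 1 / 2 * (p.2 ^ (N : ℝ) * (2 * (∫ x, V (p.2 • x) * (u x * φ x))
      + p.1 * ∫ x, V (p.2 • x) * φ x ^ 2))
    - 1 / 2 * (p.2 ^ ((N : ℝ) + α) * (p.1⁻¹ * (nonlocalTerm α f (fun x => u x + p.1 * φ x)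
      - nonlocalTerm α f u))) with hJ
  have hJlim : Tendsto J (𝓝[>] 0 ×ˢ 𝓝 1) (𝓝 (1 / 2 * ((1 : ℝ) ^ ((N : ℝ) - 2)
      * (2 * G + 0 * gradSq φ)) + 1 / 2 * ((1 : ℝ) ^ (N : ℝ)
      * (2 * (∫ x, V ((1 : ℝ) • x) * (u x * φ x)) + 0 * ∫ x, V ((1 : ℝ) • x) * φ x ^ 2))
    - 1 / 2 * ((1 : ℝ) ^ ((N : ℝ) + α) * (2 * R)))) := by
    have p1 : Tendsto (fun p : ℝ × ℝ => p.1) (𝓝[>] 0 ×ˢ 𝓝 1) (𝓝 0) :=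
      tendsto_fst.mono_right nhdsWithin_le_nhds
    have p2 : Tendsto (fun p : ℝ × ℝ => p.2) (𝓝[>] (0 : ℝ) ×ˢ 𝓝 1) (𝓝 1) := tendsto_snd
    have hr : ∀ r : ℝ, Tendsto (fun p : ℝ × ℝ => p.2 ^ r) (𝓝[>] (0 : ℝ) ×ˢ 𝓝 1) (𝓝 (1 ^ r)) :=
      fun r => p2.rpow_const (Or.inl one_ne_zero)
    have q1 := ((continuous_integral_comp_smul (integrable_mul_of_memLp_two hu.1.1 hφ.1) P.v1.1
      hM).tendsto 1).comp p2
    have q2 := ((continuous_integral_comp_smul hφ.integrable_sq P.v1.1 hM).tendsto 1).comp p2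
    have q3 : Tendsto (fun p : ℝ × ℝ => p.1⁻¹ * (nonlocalTerm α f (fun x => u x + p.1 * φ x)
      - nonlocalTerm α f u)) (𝓝[>] 0 ×ˢ 𝓝 1) (𝓝 (2 * R)) :=
      (hR'.mono_left (nhdsWithin_mono _ fun s (hs : 0 < s) => hs.ne')).comp tendsto_fst
    exact ((((hr _).mul ((p1.mul_const _).const_add _)).const_mul _).add
      (((hr _).mul ((q1.const_mul 2).add (p1.mul q2))).const_mul _)).sub
      (((hr _).mul q3).const_mul _)
  have e0 : 1 / 2 * ((1 : ℝ) ^ ((N : ℝ) - 2)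
      * (2 * G + 0 * gradSq φ)) + 1 / 2 * ((1 : ℝ) ^ (N : ℝ)
      * (2 * (∫ x, V ((1 : ℝ) • x) * (u x * φ x)) + 0 * ∫ x, V ((1 : ℝ) • x) * φ x ^ 2))
    - 1 / 2 * ((1 : ℝ) ^ ((N : ℝ) + α) * (2 * R)) = G + (∫ x, V x * (u x * φ x)) - R := by
    simp only [Real.one_rpow, one_smul]
    ring
  rw [e0] at hJlim
  by_contra! hneg
  have hev := hJlim.eventually_lt_const hneg
  obtain ⟨pa, hpa, pb, hpb, hp⟩ := eventually_prod_iff.1 hev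
  obtain ⟨δ, hδ, hδb⟩ := Metric.eventually_nhds_iff.1 hpb
  -- The bound δ/2 keeps t in the neighbourhood where J is negative, and 1/2 keeps t positive.
  set δ' := min (δ / 2) (1 / 2) with hδ'
  have hδ'0 : 0 < δ' := by positivity
  have hδ'1 : δ' < 1 := (min_le_right _ _).trans_lt (by norm_num)
  obtain ⟨s, ⟨hsa, ⟨t, ht, htm⟩⟩, hs0⟩ := ((hpa.and (nhdsWithin_le_nhds
    (P.eventually_exists_dilate_mem H hu hφ hδ'0 hδ'1))).and self_mem_nhdsWithin).exists
  have hs : 0 < s := hs0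
  have ht0 : 0 < t := by linarith [(abs_le.1 ht).1]
  have hJneg := hp hsa (hδb (y := t) (by
    rw [Real.dist_eq]
    exact (ht.trans (min_le_left _ _)).trans_lt (half_lt_self hδ)))
  have h1 := hmin _ htm
  have h2 := P.energy_dilate_le hu ht0
  have hVt : Continuous fun x => V (t • x) := P.v1.1.comp (continuous_const_smul t)
  have hus : MemH1 fun x => u x + s * φ x := hu.1.add (hφ.const_mul s)
  have h3 : energy α V f (dilate t fun x => u x + s * φ x) - energy α V f (dilate t u)
      = s * J (s, t) := by
    rw [P.energy_eq (hus.dilate ht0), P.energy_eq (hu.1.dilate ht0), hus.gradSq_dilate ht0,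
      hu.1.gradSq_dilate ht0, integral_mul_dilate_sq ht0, integral_mul_dilate_sq ht0,
      nonlocalTerm_dilate ht0, nonlocalTerm_dilate ht0, hu.1.gradSq_add_smul hφ,
      hu.1.integral_mul_add_smul_sq hφ hVt fun x => hM _, ← hG]
    simp only [hJ]
    field_simp
    ring
  have h4 : s * J (s, t) < 0 := mul_neg_of_pos_of_neg hs hJneg
  linarith

/-- The first variation is linear in the direction, so nonnegativity for φ and for -φ makes it
vanish. Absolute convergence of the right-hand side is the Hardy–Littlewood–Sobolev bound for F(u)
and f(u)φ. -/
theorem isWeakSolution_of_minimizer (P : PotentialHyp N α V Vinf θ) (H : NonlinearityHyp N α f)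
    {u : E N → ℝ} (hu : u ∈ pohozaevManifold α V f)
    (hmin : ∀ w ∈ pohozaevManifold α V f, energy α V f u ≤ energy α V f w) :
    IsWeakSolution α V f u := by
  obtain ⟨M, -, hM⟩ := P.exists_bound
  refine ⟨hu.1, fun φ hφ => ?_⟩
  have hF := H.memLp_primitive hu.1
  have hfφ := H.memLp_f_mul hu.1 hφ
  have hint := integrable_rieszConv_mul H.N_pos H.pos H.lt hfφ hF
  refine ⟨by simpa [mul_assoc] using hint, ?_⟩
  have h1 := P.first_variation_nonneg H hu hmin hφ
  have h2 := P.first_variation_nonneg H hu hmin (hφ.const_mul (-1))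
  rw [hφ.integral_inner_const_mul] at h2
  have e1 : ∫ x, V x * (u x * (-1 * φ x)) = -∫ x, V x * (u x * φ x) := by
    rw [← integral_neg]
    congr 1
    ext x
    ring
  have e2 : rieszForm α (fun x => f (u x) * (-1 * φ x)) (fun x => primitive f (u x))
      = -rieszForm α (fun x => f (u x) * φ x) fun x => primitive f (u x) := by
    have := rieszForm_smul_left (α := α) (-1) (fun x => f (u x) * φ x) fun x => primitive f (u x)
    rw [neg_one_mul] at this
    rw [← this]
    congr 1
    ext x
    ring
  rw [e1, e2] at h2
  have e3 : ∫ x, (inner ℝ (weakGradient u x) (weakGradient φ x) + V x * u x * φ x)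
      = (∫ x, inner ℝ (weakGradient u x) (weakGradient φ x)) + ∫ x, V x * (u x * φ x) := by
    simp_rw [mul_assoc]
    exact integral_add (integrable_inner_of_memLp_two hu.1.isH1.memLp_grad hφ.isH1.memLp_grad)
      (hu.1.integrable_mul_mul hφ P.v1.1 hM)
  have e4 : ∫ x, rieszConv α (fun y => primitive f (u y)) x * f (u x) * φ x
      = rieszForm α (fun x => f (u x) * φ x) fun x => primitive f (u x) := by
    unfold rieszForm
    simp_rw [mul_assoc]
  rw [e3, e4]
  linarith

end PotentialHyp

end CriticalPoint

end Choquard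

end

/-! ### Assembly of the theorem. -/

theorem theorem1p1 (N : ℕ) (hN : 3 ≤ N) (α : ℝ) (hα0 : 0 < α) (hαN : α < N)
    (V : Choquard.E N → ℝ) (Vinf : ℝ) (f : ℝ → ℝ)
    (hV1 : Choquard.CondV1 V Vinf) (hV2 : Choquard.CondV2 V Vinf) (hV3 : Choquard.CondV3 α V)
    (hF1 : Choquard.CondF1 N α f) (hF2 : Choquard.CondF2 N α f) (hF3 : Choquard.CondF3 f) :
    -- for `u ∈ Λ` the maximum of `𝓘(u_t)` over `t > 0` is attained
    (∀ u ∈ Choquard.Lam N α f, ∃ c : ℝ,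
      IsGreatest ((fun t : ℝ => Choquard.energy α V f (Choquard.dilate t u)) '' Set.Ioi 0) c) ∧
    ∃ u₀ : Choquard.E N → ℝ,
      Choquard.IsWeakSolution α V f u₀ ∧
      u₀ ∈ Choquard.pohozaevManifold α V f ∧
      -- `𝓘(u₀) = min_𝓜 𝓘`
      IsLeast (Choquard.energy α V f '' Choquard.pohozaevManifold α V f)
        (Choquard.energy α V f u₀) ∧
      -- `𝓘(u₀) = inf_{u ∈ Λ} max_{t > 0} 𝓘(u_t)`
      IsGLB {c : ℝ | ∃ u ∈ Choquard.Lam N α f,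
          IsGreatest
            ((fun t : ℝ => Choquard.energy α V f (Choquard.dilate t u)) '' Set.Ioi 0) c}
        (Choquard.energy α V f u₀) ∧
      0 < Choquard.energy α V f u₀ := by
  obtain ⟨hVd, θ, hθ0, hθ1, hanti⟩ := hV3
  have P : Choquard.PotentialHyp N α V Vinf θ :=
    ⟨hN, hα0, hV1, hV2, hVd, hθ0, hθ1, hanti⟩
  have H : Choquard.NonlinearityHyp N α f := ⟨hN, hα0, hαN, hF1, hF2⟩
  obtain ⟨u₀, hu₀, hmin⟩ := P.exists_minimizer H hF3
  obtain ⟨c, hc, hlow⟩ := P.exists_energy_ge H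
  refine ⟨fun u hu => ?_, u₀, P.isWeakSolution_of_minimizer H hu₀ hmin, hu₀,
    ⟨Set.mem_image_of_mem _ hu₀, ?_⟩, IsLeast.isGLB ⟨⟨u₀, ?_, ?_⟩, ?_⟩,
    hc.trans_le (hlow u₀ hu₀)⟩
  · obtain ⟨t, ht, htm⟩ := P.exists_dilate_mem H hu.1 hu.2
    refine ⟨_, Set.mem_image_of_mem _ (Set.mem_Ioi.2 ht), ?_⟩
    rintro _ ⟨s, hs, rfl⟩
    -- The dilate by s is the dilate by s/t of the point u_t on 𝓜, where the energy along dilations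
    -- is maximal.
    have := P.energy_dilate_le htm (div_pos hs ht)
    rwa [Choquard.dilate_dilate, div_mul_cancel₀ _ ht.ne'] at this
  · rintro _ ⟨w, hw, rfl⟩
    exact hmin w hw
  · exact ⟨hu₀.1, P.nonlocalTerm_pos hu₀.1 hu₀.2.1 hu₀.2.2.le⟩
  · refine ⟨⟨1, Set.mem_Ioi.2 one_pos, by simp only [Choquard.dilate_one]⟩, ?_⟩
    rintro _ ⟨s, hs, rfl⟩
    exact P.energy_dilate_le hu₀ hs
  · rintro b ⟨u, hu, hb⟩
    -- The maximum along the dilates of u is at least the value at the dilate lying on 𝓜, hence at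
    -- least the minimum over 𝓜.
    obtain ⟨t, ht, htm⟩ := P.exists_dilate_mem H hu.1 hu.2
    exact (hmin _ htm).trans (hb.2 (Set.mem_image_of_mem _ (Set.mem_Ioi.2 ht)))
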